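/- **Setting.** Let $\mathsf G(n,1/2)$ be the Erdős–Rényi distribution on graphs with vertex set $[n]$, and let $\mathsf G(n,1/2,k)$ be the planted clique distribution: a set $K\subseteq[n]$ of size $k$ is chosen uniformly at random, all pairs in $K$ are joined by edges, and each remaining pair is joined independently with probability $1/2$. Let $\mathsf{kG}(\ell k,1/2,k)$ be $\mathsf G(\ell k,1/2,k)$ conditioned on $K$ having exactly one vertex in each block $\{(i-1)\ell+1,\dots,i\ell\}$, $1\le i\le k$, and let $\mathsf{clkG}(\ell k,1/2,k)$ be $\mathsf{kG}(\ell k,1/2,k)$ conditioned on $1\in K$. Graphs are given by their adjacency matrix $A_G$. A randomized logspace algorithm is a probabilistic random-access Turing machine that on every binary input of length $n$ computes one output bit in $O(\log n)$ work space and $\mathrm{poly}(n)$ time, with read-once access to a string $r$ of uniformly random bits; it is a deterministic logspace algorithm if it does not use $r$. **Conjecture ($\mathsf{kPC\text{-}Conj\text{-}Space}$).** For every randomized logspace algorithm $\mathcal A$ and all sequences $\ell=\omega(1)$ and $k$ of non-decreasing positive integers with $k=O(\ell^{1-\delta})$ for some constant $\delta>0$, $$\Pr_{A_G\sim\mathsf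 G(\ell k,1/2),\,r}\big(\mathcal A(\{\ell k,k,A_G\},r)=0\big)+\Pr_{A_G\sim\mathsf{kG}(\ell k,1/2,k),\,r}\big(\mathcal A(\{\ell k,k,A_G\},r)=1\big)=1+o(1).$$ **Lemma.** Let $\ell=\omega(1)$ and $k$ be sequences of non-decreasing positive integers such that $k=\omega(\log(\ell k))$ and $k=O(\ell^{1-\delta})$ for some constant $\delta>0$. If $\mathsf{kPC\text{-}Conj\text{-}Space}$ is true, then no deterministic logspace algorithm solves the clique leakage $k$-partite planted clique recovery problem. That is, there are no deterministic logspace algorithm $\mathcal A$ and constant $c>0$ such that, for all sufficiently large indices of the sequences, with probability at least $c$ over $(K,A_G)\sim\mathsf{clkG}(\ell k,1/2,k)$, the following holds: for every vertex $v\in[\ell k]$, $\mathcal A(\{\ell k,k,A_G,v\})$ is $1$ if $v\in K$ and $0$ if $v\notin K$. -/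

import Mathlib

open MeasureTheory ProbabilityTheory Filter Topology Asymptotics

noncomputable section

/-! ### Random-access Turing machines with a read-once random tape -/

/-- What a machine does in one step: the next control state, the symbols written under the heads
of the work tapes, the moves of these heads (`-1`, `0` or `1`), and whether the head of the
random tape advances. The random tape head has no other moves: random bits are read once. -/
structure StepAction (Q T : Type) where
  next : Q
  write : T → Option Bool
  move : T → SignType
  advance : Bool

/-- A (probabilistic) random-access Turing machine. It has a finite set `Q` of control states and
a finite set `T` of two-way infinite read-write work tapes, whose cells are blank (`none`) or hold
a bit. One work tape, `index`, is the address tape that gives random access to the read-only input.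
A step depends on the control state, the symbols under the work heads, the input bit at the
current address (`none` if the address is beyond the end of the input) and the current bit of the
random tape. In a state `q` with `output q = some b` the machine has halted with output `b`. -/
structure RATM where
  Q : Type
  T : Type
  finiteQ : Finite Q
  finiteT : Finite T
  start : Q
  output : Q → Option Bool
  index : T
  δ : Q → (T → Option Bool) → Option Bool → Bool → StepAction Q T

namespace RATM

/-- A configuration: control state, positions of the work heads, contents of the work tapes,
position of the head of the random tape. -/
structure Config (M : RATM) where
  state : M.Q
  head : M.T → ℤ
  cell : M.T → ℤ → Option Bool
  rpos : ℕ

/-- The initial configuration: all work tapes are blank. -/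
def init (M : RATM) : M.Config where
  state := M.start
  head := fun _ => 0
  cell := fun _ _ => none
  rpos := 0

/-- The current address: the number written in binary on the index tape, least significant bit
first, from the cell under the head rightwards up to the first blank cell. -/
def address (M : RATM) (c : M.Config) : ℕ :=
  ∑ i ∈ Finset.range (sInf {i : ℕ | c.cell M.index (c.head M.index + i) = none}),
    if c.cell M.index (c.head M.index + i) = some true then 2 ^ i else 0

/-- The action that the machine takes in configuration `c`, on input `x` and random tape `r`. -/
def action (M : RATM) (x : List Bool) (r : ℕ → Bool) (c : M.Config) : StepAction M.Q M.T :=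
  M.δ c.state (fun t => c.cell t (c.head t)) (x[M.address c]?) (r c.rpos)

open Classical in
/-- One step of computation. A halted configuration does not change any more. -/
def step (M : RATM) (x : List Bool) (r : ℕ → Bool) (c : M.Config) : M.Config :=
  if (M.output c.state).isSome then c
  else
    let a := M.action x r c
    { state := a.next
      head := fun t => c.head t + (a.move t : ℤ)
      cell := fun t => Function.update (c.cell t) (c.head t) (a.write t)
      rpos := if a.advance then c.rpos + 1 else c.rpos }

/-- The configuration after `s` steps. -/
def run (M : RATM) (x : List Bool) (r : ℕ → Bool) (s : ℕ) : M.Config :=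
  (M.step x r)^[s] M.init

/-- On input `x` and random tape `r` the machine halts with output `b`. -/
def Outputs (M : RATM) (x : List Bool) (r : ℕ → Bool) (b : Bool) : Prop :=
  ∃ s, M.output (M.run x r s).state = some b

/-- Logarithmic space and polynomial time, on every input and for every random tape: within
`n ^ C + C` steps the machine halts (so it reads at most that many random bits), and no work head
ever leaves the `O(log n)` cells around its initial position. -/
def IsRandomizedLogspace (M : RATM) : Prop :=
  ∃ C : ℕ, ∀ (x : List Bool) (r : ℕ → Bool),
    (M.output (M.run x r (x.length ^ C + C)).state).isSome ∧
    ∀ (s : ℕ) (t : M.T), |(M.run x r s).head t| ≤ C * Nat.log 2 x.length + C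

/-- A deterministic logspace algorithm: a logspace machine that ignores the random tape. -/
def IsDeterministicLogspace (M : RATM) : Prop :=
  M.IsRandomizedLogspace ∧
    ∀ (q : M.Q) (σ : M.T → Option Bool) (i : Option Bool), M.δ q σ i true = M.δ q σ i false

end RATM

/-- The law of an infinite string of independent uniformly random bits. -/
def coinMeasure : Measure (ℕ → Bool) :=
  Measure.infinitePi fun _ : ℕ => uniformOn (Set.univ : Set Bool)

/-! ### Random graphs; the vertex named `i + 1` is the element `i` of `Fin N` -/

/-- The Erdős–Rényi distribution `G(N, 1/2)`. -/
def erdosRenyi (N : ℕ) : Measure (SimpleGraph (Fin N)) :=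
  SimpleGraph.binomialRandom (Fin N) ⟨1 / 2, by norm_num, by norm_num⟩

/-- The complete graph on the vertex set `K` (with no edge outside of `K`). -/
def cliqueOn {N : ℕ} (K : Finset (Fin N)) : SimpleGraph (Fin N) :=
  SimpleGraph.fromRel fun u v => u ∈ K ∧ v ∈ K

/-- The planted clique distribution `G(N, 1/2, k)`, as the joint law of the planted set `K`,
uniform among the sets of `k` vertices, and of the graph. -/
def plantedClique (N k : ℕ) : Measure (Finset (Fin N) × SimpleGraph (Fin N)) :=
  ((uniformOn {K : Finset (Fin N) | K.card = k}).prod (erdosRenyi N)).map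
    fun p => (p.1, p.2 ⊔ cliqueOn p.1)

/-- The `k`-partite planted clique distribution `kG(ℓ k, 1/2, k)`, jointly with the planted set:
`G(ℓ k, 1/2, k)` conditioned on having exactly one planted vertex in each of the `k` blocks of
`ℓ` consecutive vertices. -/
def partitePlantedClique (ℓ k : ℕ) : Measure (Finset (Fin (ℓ * k)) × SimpleGraph (Fin (ℓ * k))) :=
  cond (plantedClique (ℓ * k) k)
    {p | ∀ i < k, ∃! v : Fin (ℓ * k), v ∈ p.1 ∧ i * ℓ ≤ (v : ℕ) ∧ (v : ℕ) < (i + 1) * ℓ}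

/-- The clique leakage `k`-partite planted clique distribution `clkG(ℓ k, 1/2, k)`, jointly with
the planted set: `kG(ℓ k, 1/2, k)` conditioned on the first vertex being planted. -/
def leakagePlantedClique (ℓ k : ℕ) : Measure (Finset (Fin (ℓ * k)) × SimpleGraph (Fin (ℓ * k))) :=
  cond (partitePlantedClique ℓ k) {p | ∃ v ∈ p.1, (v : ℕ) = 0}

/-! ### Encoding of the inputs as bit strings -/

open Classical in
/-- The `N ^ 2` bits of the adjacency matrix, row by row. -/
def adjBits {N : ℕ} (G : SimpleGraph (Fin N)) : List Bool :=
  List.ofFn fun e : Fin (N * N) => decide (G.Adj e.divNat e.modNat)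

/-- The triple `{N, k, A_G}`, where `N` is the number of vertices, as the bit string
`1 ^ N 0 1 ^ k 0 A_G`. (The length is of order `N ^ 2` for `k ≤ N`, as for binary `N` and `k`.) -/
def graphInput {N : ℕ} (k : ℕ) (G : SimpleGraph (Fin N)) : List Bool :=
  List.replicate N true ++ false :: (List.replicate k true ++ false :: adjBits G)

/-- The triple `{N, k, A_G}` followed by the name, in `{1, ..., N}`, of a vertex. -/
def vertexInput {N : ℕ} (k : ℕ) (G : SimpleGraph (Fin N)) (v : Fin N) : List Bool :=
  graphInput k G ++ List.replicate (v + 1) true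

/-! ### The conjecture and the recovery task -/

/-- `ℓ = ω(1)` and `k` are non-decreasing sequences of positive integers. -/
def AdmissibleSeqs (ℓ k : ℕ → ℕ) : Prop :=
  Monotone ℓ ∧ Monotone k ∧ (∀ t, 0 < ℓ t) ∧ (∀ t, 0 < k t) ∧ Tendsto ℓ atTop atTop

/-- The logspace `k`-partite planted clique conjecture: for every randomized logspace algorithm
and all sequences `ℓ = ω(1)`, `k` with `k = O(ℓ ^ (1 - δ))` for some constant `δ > 0`, the
probability of output `0` on `G(ℓ k, 1/2)` plus that of output `1` on `kG(ℓ k, 1/2, k)`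
is `1 + o(1)`. -/
def KPCConjSpace : Prop :=
  ∀ M : RATM, M.IsRandomizedLogspace →
  ∀ ℓ k : ℕ → ℕ, AdmissibleSeqs ℓ k →
  ∀ δ : ℝ, 0 < δ → (fun t => (k t : ℝ)) =O[atTop] (fun t => (ℓ t : ℝ) ^ (1 - δ)) →
  Tendsto (fun t =>
      ((erdosRenyi (ℓ t * k t)).prod coinMeasure).real
        {p | M.Outputs (graphInput (k t) p.1) p.2 false} +
      (((partitePlantedClique (ℓ t) (k t)).map Prod.snd).prod coinMeasure).real
        {p | M.Outputs (graphInput (k t) p.1) p.2 true})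
    atTop (𝓝 1)

open Classical in
/-- The machine `M` recovers the planted clique in `clkG(ℓ k, 1/2, k)`: with at least constant
probability over the input, for every vertex its output tells whether the vertex is in the
planted clique. -/
def SolvesLeakageRecovery (M : RATM) (ℓ k : ℕ → ℕ) : Prop :=
  ∃ c : ℝ, 0 < c ∧ ∀ᶠ t in atTop,
    c ≤ (leakagePlantedClique (ℓ t) (k t)).real
      {p | ∀ (v : Fin (ℓ t * k t)) (r : ℕ → Bool),
        M.Outputs (vertexInput (k t) p.2 v) r (decide (v ∈ p.1))}

end

/-! Recovery with a leaked clique vertex becomes detection without leakage by guessing the leaked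
vertex. Given a deterministic logspace `M` that recovers the clique with probability at least c, the
detector `searcher M` tries every vertex u: it exchanges the labels of the first vertex and of u,
asks `M` about each vertex of the relabelled graph, and tests whether the vertices with answer 1 are
pairwise adjacent and at least k in number. It outputs 1 if some u passes.

Soundness holds whatever `M` does: acceptance exhibits a k-clique (`exists_isNClique_of_accepts`),
and by a union bound G(N, 1/2) contains one with probability at most N^k 2^(-k(k-1)/2), which tends
to 0 because log N = o(k) (`tendsto_acceptedGraphs`). Completeness is a symmetry argument: under kG
exactly one vertex u of the first block is planted, and exchanging it with the first vertex respects
both the planted clique measure and the blocks, so that the relabelled graph has law clkG. Hence the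
detector accepts with probability at least c (`leakagePlantedClique_le`, `recovery_real_le`). The
two probabilities in the conjecture then add up to at least 1 + c - o(1), a contradiction.

Most of the work is to show that the detector is a logspace machine in the sense of `RATM`. It is
written in the language `Prog`, with finitely many flags and natural number registers, and `machine`
compiles such programs, one tape per register, in binary. A program whose registers stay below 2^H
runs in about H cells (`Exec.leads`). Polynomial time then needs no separate analysis: a halting
deterministic run never repeats a configuration before it halts, and if H = O(log n) there are only
polynomially many configurations (`machine_isRandomizedLogspace`).

Inside the detector, each tape of `M` is a pair of base three numbers that meet at the head
(`enc_moved`). The relabelled input of `M` is never stored; each bit is recomputed from the original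
input when it is needed (`exec_fetch`). Likewise the answers of `M` are recomputed rather than
remembered. -/

noncomputable section

/-! ### Programs over finitely many flags and binary registers -/

/-- Programs that act on flags in `F` and on natural number registers named by `R`. -/
inductive Prog (F R : Type)
  | upd (h : F → Option Bool → F)
  | inc (r : R)
  | dec (r : R)
  | seq (p q : Prog F R)
  | ite (c : F → Bool) (p q : Prog F R)
  | ifnz (r : R) (p q : Prog F R)
  | loop (r : R) (p : Prog F R)

namespace Prog

variable {F R : Type}

/-- Big-step semantics on input `x`, where the register `i` addresses the input and all values stay
below `2 ^ H`. The program `loop r p` decrements `r` and runs `p` until `r` vanishes. -/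
inductive Exec [DecidableEq R] (x : List Bool) (i : R) (H : ℕ) :
    Prog F R → F → (R → ℕ) → F → (R → ℕ) → Prop
  | upd (h f σ) : Exec x i H (.upd h) f σ (h f x[σ i]?) σ
  | inc {r} (f) {σ} (hr : σ r + 1 < 2 ^ H) :
      Exec x i H (.inc r) f σ f (Function.update σ r (σ r + 1))
  | dec {r} (f) {σ} (hr : σ r ≠ 0) :
      Exec x i H (.dec r) f σ f (Function.update σ r (σ r - 1))
  | seq {p q f σ f₁ σ₁ f₂ σ₂} (hp : Exec x i H p f σ f₁ σ₁) (hq : Exec x i H q f₁ σ₁ f₂ σ₂) :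
      Exec x i H (.seq p q) f σ f₂ σ₂
  | ite_true {c : F → Bool} {p q f σ f₁ σ₁} (hc : c f = true) (hp : Exec x i H p f σ f₁ σ₁) :
      Exec x i H (.ite c p q) f σ f₁ σ₁
  | ite_false {c : F → Bool} {p q f σ f₁ σ₁} (hc : c f = false) (hp : Exec x i H q f σ f₁ σ₁) :
      Exec x i H (.ite c p q) f σ f₁ σ₁
  | ifnz_pos {r p q f σ f₁ σ₁} (hr : σ r ≠ 0) (hp : Exec x i H p f σ f₁ σ₁) :
      Exec x i H (.ifnz r p q) f σ f₁ σ₁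
  | ifnz_zero {r p q f σ f₁ σ₁} (hr : σ r = 0) (hp : Exec x i H q f σ f₁ σ₁) :
      Exec x i H (.ifnz r p q) f σ f₁ σ₁
  | loop_zero {r p} (f) {σ} (hr : σ r = 0) : Exec x i H (.loop r p) f σ f σ
  | loop_succ {r p f σ f₁ σ₁ f₂ σ₂} (hr : σ r ≠ 0)
      (hp : Exec x i H p f (Function.update σ r (σ r - 1)) f₁ σ₁)
      (hl : Exec x i H (.loop r p) f₁ σ₁ f₂ σ₂) : Exec x i H (.loop r p) f σ f₂ σ₂

/-! ### Control states: lists of programs that remain to be executed -/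

/-- The register that is swept by the first step of a program. -/
def sweepReg : Prog F R → Option R
  | .inc r | .dec r | .ifnz r _ _ | .loop r _ => some r
  | _ => none

/-- The new digit and the new carry in a sweep. -/
def digit : Prog F R → Bool → Bool → Bool × Bool
  | .inc _, c, b => (xor b c, c && b)
  | .dec _, c, b => (xor b c, c && !b)
  | _, c, b => (b, c && !b)

/-- Whether a digit `1` is appended at the end of a sweep. -/
def tailBit : Prog F R → Bool → Bool
  | .inc _, c => c
  | _, _ => false

/-- The control state after the first step; `b` is the carry after the sweep. -/
def contNext (f : F) (b : Bool) : List (Prog F R) → List (Prog F R)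
  | [] => []
  | .upd _ :: k | .inc _ :: k | .dec _ :: k => k
  | .seq p q :: k => p :: q :: k
  | .ite c p q :: k => if c f then p :: k else q :: k
  | .ifnz _ p q :: k => if b then q :: k else p :: k
  | .loop r p :: k => if b then k else .dec r :: p :: .loop r p :: k

/-- The flags after the first step, if the input bit is `a`. -/
def flagNext (f : F) (a : Option Bool) : List (Prog F R) → F
  | .upd h :: _ => h f a
  | _ => f

/-- The control states that occur while `p` is executed with `k` remaining afterwards. -/
def conts : Prog F R → List (Prog F R) → Set (List (Prog F R))
  | .seq p q, k => {.seq p q :: k} ∪ (conts p (q :: k) ∪ conts q k)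
  | .ite c p q, k => {.ite c p q :: k} ∪ (conts p k ∪ conts q k)
  | .ifnz r p q, k => {.ifnz r p q :: k} ∪ (conts p k ∪ conts q k)
  | .loop r p, k =>
      {.loop r p :: k, .dec r :: p :: .loop r p :: k} ∪ conts p (.loop r p :: k)
  | p, k => {p :: k}

lemma conts_finite (p : Prog F R) (k : List (Prog F R)) : (conts p k).Finite := by
  induction p generalizing k with
  | upd h => exact Set.finite_singleton _
  | inc r => exact Set.finite_singleton _
  | dec r => exact Set.finite_singleton _
  | seq p q hp hq => exact (Set.finite_singleton _).union ((hp _).union (hq _))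
  | ite c p q hp hq => exact (Set.finite_singleton _).union ((hp _).union (hq _))
  | ifnz r p q hp hq => exact (Set.finite_singleton _).union ((hp _).union (hq _))
  | loop r p hp => exact (Set.toFinite _).union (hp _)

lemma cons_mem_conts (p : Prog F R) (k : List (Prog F R)) : p :: k ∈ conts p k := by
  cases p <;> simp [conts]

/-- A loop pushes itself back onto the list of remaining programs, but always in front of the same
`k`. So the list never grows beyond a fixed finite set, and it can be part of the state of a
machine. -/
lemma contNext_mem_conts (p : Prog F R) (k : List (Prog F R)) (f : F) (b : Bool) :
    ∀ c ∈ conts p k, contNext f b c ∈ conts p k ∨ contNext f b c = k := by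
  induction p generalizing k with
  | upd h => rintro c rfl; simp [contNext]
  | inc r => rintro c rfl; simp [contNext]
  | dec r => rintro c rfl; simp [contNext]
  | seq p q hp hq =>
    rintro c (rfl | h | h)
    · left; right; left; exact cons_mem_conts _ _
    · rcases hp _ c h with h | h
      · left; right; left; exact h
      · left; right; right; rw [h]; exact cons_mem_conts _ _
    · rcases hq _ c h with h | h
      · left; right; right; exact h
      · right; exact h
  | ite d p q hp hq =>
    rintro c (rfl | h | h)
    · left
      simp only [contNext]
      split_ifs
      · right; left; exact cons_mem_conts _ _
      · right; right; exact cons_mem_conts _ _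
    · rcases hp _ c h with h | h
      · left; right; left; exact h
      · right; exact h
    · rcases hq _ c h with h | h
      · left; right; right; exact h
      · right; exact h
  | ifnz r p q hp hq =>
    rintro c (rfl | h | h)
    · left
      simp only [contNext]
      split_ifs
      · right; right; exact cons_mem_conts _ _
      · right; left; exact cons_mem_conts _ _
    · rcases hp _ c h with h | h
      · left; right; left; exact h
      · right; exact h
    · rcases hq _ c h with h | h
      · left; right; right; exact h
      · right; exact h
  | loop r p hp =>
    rintro c ((rfl | rfl) | h)
    · simp only [contNext]
      split_ifs
      · right; rfl
      · left; left; right; rfl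
    · left; right; exact cons_mem_conts _ _
    · rcases hp _ c h with h | h
      · left; right; exact h
      · left; left; left; exact h

/-- The control states of the machine that executes `p`. -/
def Ctl (p : Prog F R) : Type := {c : List (Prog F R) // c ∈ conts p [] ∨ c = []}

instance (p : Prog F R) : Finite (Ctl p) :=
  Set.Finite.to_subtype (((conts_finite p []).union (Set.finite_singleton [])))

/-- The control state after the first step. -/
def Ctl.next {p : Prog F R} (c : Ctl p) (f : F) (b : Bool) : Ctl p :=
  ⟨contNext f b c.1, by
    rcases c with ⟨c, h | rfl⟩
    · exact contNext_mem_conts p [] f b c h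
    · exact Or.inr rfl⟩

/-- The family `s`, changed to `a` at `r`. -/
def put [DecidableEq R] {Z : Type} (s : R → Z) (r : R) (a : Z) : R → Z := Function.update s r a

@[simp] lemma put_self [DecidableEq R] {Z : Type} (s : R → Z) (r : R) (a : Z) : put s r a r = a :=
  Function.update_self ..

@[simp] lemma put_of_ne [DecidableEq R] {Z : Type} (s : R → Z) {r t : R} (h : t ≠ r) (a : Z) :
    put s r a t = s t :=
  Function.update_of_ne h ..

@[simp] lemma put_zero_zero [DecidableEq R] {Z : Type} [Zero Z] (r : R) :
    put (0 : R → Z) r 0 = 0 :=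
  Function.update_eq_self ..

/-- The machine that executes the program `p` from the flags `f₀`, with a tape for each register.
The state consists of the control state, the flags, the direction (`true` is right) of the current
sweep, and its carry. -/
def machine [DecidableEq R] [Finite F] [Finite R] (p : Prog F R) (i : R) (f₀ : F)
    (out : F → Bool) : RATM where
  Q := Ctl p × F × Bool × Bool
  T := R
  finiteQ := inferInstance
  finiteT := inferInstance
  start := (⟨[p], Or.inl (cons_mem_conts _ _)⟩, f₀, true, true)
  output q := if q.1.1 = [] then some (out q.2.1) else none
  index := i
  δ q s a _ :=
    match q.1.1 with
    | [] => ⟨q, s, 0, false⟩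
    | c :: _ =>
      match sweepReg c with
      | none => ⟨(q.1.next q.2.1 q.2.2.2, flagNext q.2.1 a q.1.1, true, true), s, 0, false⟩
      | some r =>
        match q.2.2.1, s r with
        | true, some d =>
            ⟨(q.1, q.2.1, true, (digit c q.2.2.2 d).2),
              put s r (some (digit c q.2.2.2 d).1), put 0 r 1, false⟩
        | true, none =>
            ⟨(q.1, q.2.1, false, q.2.2.2),
              put s r (if tailBit c q.2.2.2 then some true else none),
              put 0 r (-1), false⟩
        | false, some _ => ⟨q, s, put 0 r (-1), false⟩
        | false, none =>
            ⟨(q.1.next q.2.1 q.2.2.2, q.2.1, true, true), s, put 0 r 1, false⟩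

/-! ### Binary numbers on tapes -/

/-- The tape that holds the bits `l` from cell `0` on. -/
def tape (l : List Bool) : ℤ → Option Bool
  | Int.ofNat n => l[n]?
  | Int.negSucc _ => none

@[simp] lemma tape_natCast (l : List Bool) (n : ℕ) : tape l n = l[n]? := rfl

@[simp] lemma tape_neg_one (l : List Bool) : tape l (-1) = none := rfl

lemma tape_of_neg (l : List Bool) {z : ℤ} (hz : z < 0) : tape l z = none := by
  rcases z with n | n
  · simp at hz; omega
  · rfl

lemma tape_of_le (l : List Bool) {z : ℤ} (hz : l.length ≤ z) : tape l z = none := by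
  rcases z with n | n
  · simp only [Int.ofNat_eq_natCast, Nat.cast_le] at hz
    exact List.getElem?_eq_none hz
  · rfl

lemma update_tape_append (a l : List Bool) (d e : Bool) :
    Function.update (tape (a ++ d :: l)) (a.length : ℤ) (some e) = tape (a ++ e :: l) := by
  funext z
  rcases z with n | n
  · simp only [Int.ofNat_eq_natCast, Function.update_apply, Nat.cast_inj, tape_natCast]
    rcases lt_trichotomy n a.length with h | rfl | h
    · simp [h.ne, List.getElem?_append_left h]
    · simp
    · obtain ⟨m, rfl⟩ := Nat.exists_eq_add_of_lt h
      rw [if_neg h.ne', List.getElem?_append_right h.le, List.getElem?_append_right h.le]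
      have : a.length + m + 1 - a.length = m + 1 := by omega
      simp [this]
  · rw [Function.update_of_ne (by rintro h; exact absurd h (by simp [← Int.ofNat_eq_natCast]))]
    rfl

lemma update_tape_length (a : List Bool) :
    Function.update (tape a) (a.length : ℤ) (some true) = tape (a ++ [true]) := by
  funext z
  rcases z with n | n
  · simp only [Int.ofNat_eq_natCast, Function.update_apply, Nat.cast_inj, tape_natCast]
    rcases lt_trichotomy n a.length with h | rfl | h
    · simp [h.ne, List.getElem?_append_left h]
    · simp
    · rw [if_neg h.ne', List.getElem?_eq_none h.le, List.getElem?_eq_none (by simpa using h)]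
  · rw [Function.update_of_ne (by rintro h; exact absurd h (by simp [← Int.ofNat_eq_natCast]))]
    rfl

/-- The value of a binary number, least significant bit first. -/
def val : List Bool → ℕ
  | [] => 0
  | b :: l => b.toNat + 2 * val l

lemma val_append_true (l : List Bool) : val (l ++ [true]) = val l + 2 ^ l.length := by
  induction l with
  | nil => rfl
  | cons b l ih => simp only [List.cons_append, val, ih, List.length_cons]; ring

lemma val_lt (l : List Bool) : val l < 2 ^ l.length := by
  induction l with
  | nil => simp [val]
  | cons b l ih =>
    simp only [val, List.length_cons, pow_succ]
    have := Bool.toNat_le b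
    omega

lemma sum_bits_eq_val (l : List Bool) :
    ∑ i ∈ Finset.range l.length, (if l[i]? = some true then 2 ^ i else 0) = val l := by
  induction l with
  | nil => rfl
  | cons b l ih =>
    rw [List.length_cons, Finset.sum_range_succ', val, ← ih, Finset.mul_sum, add_comm]
    congr 1
    · cases b <;> simp
    · refine Finset.sum_congr rfl fun i _ => ?_
      simp only [List.getElem?_cons_succ, mul_ite, mul_zero, pow_succ']

/-- The digits and the carry after a sweep. -/
def trans (p : Prog F R) : Bool → List Bool → List Bool × Bool
  | c, [] => ([], c)
  | c, b :: l => ((digit p c b).1 :: (trans p (digit p c b).2 l).1, (trans p (digit p c b).2 l).2)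

/-- The digits after a sweep, with a possible new digit at the end. -/
def swept (p : Prog F R) (l : List Bool) : List Bool :=
  (trans p true l).1 ++ if tailBit p (trans p true l).2 then [true] else []

lemma length_trans (p : Prog F R) (c : Bool) (l : List Bool) :
    (trans p c l).1.length = l.length := by
  induction l generalizing c with
  | nil => rfl
  | cons b l ih => simp [trans, ih]

/-- Ripple carry. The incoming carry is arbitrary so that the induction can pass from digit to
digit; the outgoing carry has the weight of the next free position. -/
lemma val_trans_inc (r : R) (c : Bool) (l : List Bool) :
    val (trans (.inc r : Prog F R) c l).1 + 2 ^ l.length * (trans (.inc r : Prog F R) c l).2.toNat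
      = val l + c.toNat := by
  induction l generalizing c with
  | nil => simp [trans, val]
  | cons b l ih =>
    have := ih (c && b)
    simp only [trans, digit, val, List.length_cons, pow_succ] at this ⊢
    generalize (trans (Prog.inc r : Prog F R) (c && b) l) = w at *
    cases b <;> cases c <;> simp at this ⊢ <;> linarith

lemma val_trans_dec (r : R) (c : Bool) (l : List Bool) :
    val (trans (.dec r : Prog F R) c l).1 + c.toNat
      = val l + 2 ^ l.length * (trans (.dec r : Prog F R) c l).2.toNat := by
  induction l generalizing c with
  | nil => simp [trans, val]
  | cons b l ih =>
    have := ih (c && !b)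
    simp only [trans, digit, val, List.length_cons, pow_succ] at this ⊢
    generalize (trans (Prog.dec r : Prog F R) (c && !b) l) = w at *
    cases b <;> cases c <;> simp at this ⊢ <;> linarith

lemma val_swept_inc (r : R) (l : List Bool) : val (swept (.inc r : Prog F R) l) = val l + 1 := by
  have h := val_trans_inc (F := F) r true l
  cases h' : (trans (.inc r : Prog F R) true l).2 <;> rw [h'] at h
  · simpa [swept, tailBit, h'] using h
  · simpa [swept, tailBit, h', val_append_true, length_trans] using h

/-- A digit is appended only when the carry runs off the end. Then the new value is at least `2 ^
l.length`, and the bound on the value forces `l.length < H`. -/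
lemma length_swept_inc (r : R) {l : List Bool} {H : ℕ} (hl : l.length ≤ H)
    (h : val l + 1 < 2 ^ H) : (swept (.inc r : Prog F R) l).length ≤ H := by
  have h₁ := val_trans_inc (F := F) r true l
  cases h' : (trans (.inc r : Prog F R) true l).2 <;> rw [h'] at h₁
  · simpa [swept, tailBit, h', length_trans] using hl
  · have : 2 ^ l.length < 2 ^ H := by
      refine lt_of_le_of_lt ?_ h
      simp only [Bool.toNat_true, mul_one] at h₁
      omega
    have := (Nat.pow_lt_pow_iff_right (by norm_num)).1 this
    simp [swept, tailBit, h', length_trans]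
    omega

lemma swept_of_ne_inc {p : Prog F R} (hp : ∀ c, tailBit p c = false) (l : List Bool) :
    swept p l = (trans p true l).1 := by
  simp [swept, hp]

lemma val_swept_dec (r : R) {l : List Bool} (hl : val l ≠ 0) :
    val (swept (.dec r : Prog F R) l) = val l - 1 := by
  have h := val_trans_dec (F := F) r true l
  have h₁ := val_lt (trans (.dec r : Prog F R) true l).1
  rw [length_trans] at h₁
  rw [swept_of_ne_inc (fun _ => rfl)]
  -- A remaining borrow would give a value of at least `2 ^ l.length`, since `val l ≠ 0`; this
  -- contradicts `h₁`.
  cases h' : (trans (.dec r : Prog F R) true l).2 <;> rw [h'] at h <;> simp at h <;> omega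

/-- For a test the carry records that only zeros have been met so far, so the sweep decides whether
the register vanishes without changing it. -/
lemma trans_test {p : Prog F R} (hp : ∀ c b, digit p c b = (b, c && !b)) (c : Bool)
    (l : List Bool) : trans p c l = (l, c && (val l == 0)) := by
  induction l generalizing c with
  | nil => simp [trans, val]
  | cons b l ih =>
    simp only [trans, hp, ih, val]
    cases b <;> cases c <;> simp

/-! ### The machine executes the program -/

section Machine

variable [DecidableEq R] [Finite F] [Finite R] {p : Prog F R} {i : R} {f₀ : F} {out : F → Bool}

lemma config_ext {M : RATM} {a b : M.Config} (hs : a.state = b.state)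
    (hh : ∀ t, a.head t = b.head t)
    (hc : ∀ t, a.cell t = b.cell t) (hr : a.rpos = b.rpos) : a = b := by
  cases a; cases b
  obtain rfl : _ = _ := hs
  obtain rfl : _ = _ := funext hh
  obtain rfl : _ = _ := funext hc
  obtain rfl : _ = _ := hr
  rfl

/-- The configuration with the head of tape `r` at `h`, the other heads at `0`, and the bits `L t`
on tape `t`. -/
def cfg (i : R) (f₀ : F) (out : F → Bool) (c : Ctl p) (f : F) (dir b : Bool) (r : R) (h : ℤ)
    (L : R → List Bool) : (machine p i f₀ out).Config where
  state := (c, f, dir, b)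
  head := put (R := R) (0 : R → ℤ) r h
  cell := fun t => tape (L t)
  rpos := 0

/-- Between two sweeps every head rests on cell `0`, so the address is the full value of the index
register. Only the control steps, taken in this position, look at the input. -/
lemma address_cfg (c : Ctl p) (f : F) (dir b : Bool) (r : R) (L : R → List Bool) :
    (machine p i f₀ out).address (cfg i f₀ out c f dir b r 0 L) = val (L i) := by
  have hz : put (R := R) (0 : R → ℤ) r 0 i = 0 := by simp
  have hi : (machine p i f₀ out).index = i := rfl
  simp only [RATM.address, cfg, hi, hz, zero_add, tape_natCast]
  have : sInf {j : ℕ | (L i)[j]? = none} = (L i).length := by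
    have : {j : ℕ | (L i)[j]? = none} = Set.Ici (L i).length := by
      ext j; simp
    rw [this, csInf_Ici]
  rw [this, sum_bits_eq_val]

lemma step_eq (x : List Bool) (ρ : ℕ → Bool) (c : Ctl p) (q : Prog F R) (k : List (Prog F R))
    (hc : c.1 = q :: k) (f : F) (dir b : Bool) (r : R) (h : ℤ) (L : R → List Bool) :
    (machine p i f₀ out).step x ρ (cfg i f₀ out c f dir b r h L) =
      let a := (machine p i f₀ out).action x ρ (cfg i f₀ out c f dir b r h L)
      { state := a.next
        head := fun t => put (R := R) (0 : R → ℤ) r h t + (a.move t : ℤ)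
        cell := fun t => Function.update (tape (L t)) (put (R := R) (0 : R → ℤ) r h t) (a.write t)
        rpos := if a.advance then 1 else 0 } := by
  rw [RATM.step, if_neg]
  · rfl
  · simp [machine, cfg, hc]

lemma step_control (x : List Bool) (ρ : ℕ → Bool) (c : Ctl p) (q : Prog F R)
    (k : List (Prog F R)) (hc : c.1 = q :: k) (hq : sweepReg q = none) (f : F) (b : Bool) (r : R)
    (L : R → List Bool) :
    (machine p i f₀ out).step x ρ (cfg i f₀ out c f true b r 0 L) =
      cfg i f₀ out (c.next f b) (flagNext f x[val (L i)]? (q :: k)) true true r 0 L := by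
  rw [step_eq x ρ c q k hc]
  have ha : (machine p i f₀ out).action x ρ (cfg i f₀ out c f true b r 0 L) =
      ⟨(c.next f b, flagNext f x[val (L i)]? (q :: k), true, true),
        fun t => tape (L t) (put (R := R) (0 : R → ℤ) r 0 t), 0, false⟩ := by
    rw [RATM.action, address_cfg]
    simp [machine, cfg, hc, hq]
    rfl
  rw [ha]
  simp [cfg]

lemma step_right_some (x : List Bool) (ρ : ℕ → Bool) (c : Ctl p) (q : Prog F R)
    (k : List (Prog F R)) (hc : c.1 = q :: k) {r : R} (hq : sweepReg q = some r) (f : F) (b : Bool)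
    (L : R → List Bool) (l₁ l₂ : List Bool) (d : Bool) (hL : L r = l₁ ++ d :: l₂) :
    (machine p i f₀ out).step x ρ (cfg i f₀ out c f true b r l₁.length L) =
      cfg i f₀ out c f true (digit q b d).2 r ((l₁.length + 1 : ℕ) : ℤ)
        (put (R := R) L r (l₁ ++ (digit q b d).1 :: l₂)) := by
  rw [step_eq x ρ c q k hc]
  have ha : (machine p i f₀ out).action x ρ (cfg i f₀ out c f true b r l₁.length L) =
      ⟨(c, f, true, (digit q b d).2),
        put (R := R) (fun t => tape (L t) (put (R := R) (0 : R → ℤ) r l₁.length t)) r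
          (some (digit q b d).1), put (R := R) 0 r 1, false⟩ := by
    simp [RATM.action, machine, cfg, hc, hq, hL]
  rw [ha]
  refine config_ext rfl (fun (t : R) => ?_) (fun (t : R) => ?_) rfl
  · by_cases ht : t = r
    · subst ht; simp [cfg]
    · simp [cfg, ht]
  · by_cases ht : t = r
    · subst ht; simp [cfg, hL, update_tape_append]
    · simp [cfg, ht]

lemma step_right_none (x : List Bool) (ρ : ℕ → Bool) (c : Ctl p) (q : Prog F R)
    (k : List (Prog F R)) (hc : c.1 = q :: k) {r : R} (hq : sweepReg q = some r) (f : F) (b : Bool)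
    (L : R → List Bool) :
    (machine p i f₀ out).step x ρ (cfg i f₀ out c f true b r (L r).length L) =
      cfg i f₀ out c f false b r ((L r).length - 1)
        (put (R := R) L r (L r ++ if tailBit q b then [true] else [])) := by
  rw [step_eq x ρ c q k hc]
  have ha : (machine p i f₀ out).action x ρ (cfg i f₀ out c f true b r (L r).length L) =
      ⟨(c, f, false, b),
        put (R := R) (fun t => tape (L t) (put (R := R) (0 : R → ℤ) r (L r).length t)) r
          (if tailBit q b then some true else none), put (R := R) 0 r (-1), false⟩ := by
    simp [RATM.action, machine, cfg, hc, hq]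
  rw [ha]
  refine config_ext rfl (fun (t : R) => ?_) (fun (t : R) => ?_) rfl
  · by_cases ht : t = r
    · subst ht; simp [cfg]; rfl
    · simp [cfg, ht]
  · by_cases ht : t = r
    · subst ht
      cases tailBit q b
      · simp [cfg, Function.update_eq_self_iff]
      · simp [cfg, update_tape_length]
    · simp [cfg, ht]

lemma step_left_some (x : List Bool) (ρ : ℕ → Bool) (c : Ctl p) (q : Prog F R)
    (k : List (Prog F R)) (hc : c.1 = q :: k) {r : R} (hq : sweepReg q = some r) (f : F) (b : Bool)
    (L : R → List Bool) (n : ℕ) (hn : n < (L r).length) :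
    (machine p i f₀ out).step x ρ (cfg i f₀ out c f false b r n L) =
      cfg i f₀ out c f false b r (n - 1) L := by
  rw [step_eq x ρ c q k hc]
  have ha : (machine p i f₀ out).action x ρ (cfg i f₀ out c f false b r n L) =
      ⟨(c, f, false, b), fun t => tape (L t) (put (R := R) (0 : R → ℤ) r n t),
        put (R := R) 0 r (-1), false⟩ := by
    simp [RATM.action, machine, cfg, hc, hq, hn]
  rw [ha]
  refine config_ext rfl (fun (t : R) => ?_) (fun t => by simp [cfg]) rfl
  by_cases ht : t = r
  · subst ht; simp [cfg]; rfl
  · simp [cfg, ht]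

lemma step_left_none (x : List Bool) (ρ : ℕ → Bool) (c : Ctl p) (q : Prog F R)
    (k : List (Prog F R)) (hc : c.1 = q :: k) {r : R} (hq : sweepReg q = some r) (f : F) (b : Bool)
    (L : R → List Bool) :
    (machine p i f₀ out).step x ρ (cfg i f₀ out c f false b r (-1) L) =
      cfg i f₀ out (c.next f b) f true true r 0 L := by
  rw [step_eq x ρ c q k hc]
  have ha : (machine p i f₀ out).action x ρ (cfg i f₀ out c f false b r (-1) L) =
      ⟨(c.next f b, f, true, true), fun t => tape (L t) (put (R := R) (0 : R → ℤ) r (-1) t),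
        put (R := R) 0 r 1, false⟩ := by
    simp [RATM.action, machine, cfg, hc, hq]
  rw [ha]
  refine config_ext rfl (fun (t : R) => ?_) (fun t => by simp [cfg]) rfl
  by_cases ht : t = r
  · subst ht; simp [cfg]
  · simp [cfg, ht]

end Machine

end Prog
end

/-! ### Execution of programs within bounded space -/

noncomputable section

/-- The heads of the configuration are in the cells from `-1` to `H`, and only the cells from `0` to
`H - 1` are in use; no random bit has been read. -/
def RATM.Config.Small {M : RATM} (H : ℕ) (a : M.Config) : Prop :=
  (∀ t, -1 ≤ a.head t ∧ a.head t ≤ H ∧ ∀ z : ℤ, z < 0 ∨ H ≤ z → a.cell t z = none) ∧ a.rpos = 0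

namespace Prog

variable {F R : Type} [DecidableEq R] [Finite F] [Finite R] {p : Prog F R} {i : R} {f₀ : F}
  {out : F → Bool}

/-- The machine comes from `a` to `b` through small configurations. -/
def Leads (M : RATM) (x : List Bool) (ρ : ℕ → Bool) (H : ℕ) : M.Config → M.Config → Prop :=
  Relation.ReflTransGen fun a b => a.Small H ∧ M.step x ρ a = b

lemma Leads.head {M : RATM} {x : List Bool} {ρ : ℕ → Bool} {H : ℕ} {a b c : M.Config}
    (ha : a.Small H) (hab : M.step x ρ a = b) (hbc : Leads M x ρ H b c) : Leads M x ρ H a c :=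
  Relation.ReflTransGen.head ⟨ha, hab⟩ hbc

lemma Leads.trans {M : RATM} {x : List Bool} {ρ : ℕ → Bool} {H : ℕ} {a b c : M.Config}
    (hab : Leads M x ρ H a b) (hbc : Leads M x ρ H b c) : Leads M x ρ H a c :=
  Relation.ReflTransGen.trans hab hbc

lemma cfg_small {H : ℕ} (c : Ctl p) (f : F) (dir b : Bool) (r : R) {h : ℤ} {L : R → List Bool}
    (hL : ∀ t, (L t).length ≤ H) (h₁ : -1 ≤ h) (h₂ : h ≤ H) :
    (cfg i f₀ out c f dir b r h L).Small H := by
  refine ⟨fun (t : R) => ⟨?_, ?_, fun z hz => ?_⟩, rfl⟩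
  · by_cases ht : t = r
    · subst ht; simpa [cfg] using h₁
    · simp [cfg, ht]
  · by_cases ht : t = r
    · subst ht; simpa [cfg] using h₂
    · simp [cfg, ht]
  · rcases hz with hz | hz
    · exact tape_of_neg (L t) hz
    · exact tape_of_le (L t) (le_trans (by exact_mod_cast hL t) hz)

lemma cfg_zero (c : Ctl p) (f : F) (dir b : Bool) (r s : R) (L : R → List Bool) :
    cfg i f₀ out c f dir b r 0 L = cfg i f₀ out c f dir b s 0 L := by
  simp [cfg]

variable {x : List Bool} {ρ : ℕ → Bool} {H : ℕ}

lemma leads_right {c : Ctl p} {q : Prog F R} {k : List (Prog F R)} (hc : c.1 = q :: k) {r : R}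
    (hq : sweepReg q = some r) (f : F) (l₂ : List Bool) (b : Bool) (l₁ : List Bool)
    (L : R → List Bool) (hL : ∀ t, (L t).length ≤ H) (hr : L r = l₁ ++ l₂) :
    Leads (machine p i f₀ out) x ρ H (cfg i f₀ out c f true b r l₁.length L)
      (cfg i f₀ out c f true (trans q b l₂).2 r (L r).length
        (put L r (l₁ ++ (trans q b l₂).1))) := by
  induction l₂ generalizing b l₁ L with
  | nil =>
    have : put L r (l₁ ++ (trans q b []).1) = L := by
      simp only [put, trans, ← hr, Function.update_eq_self]
    rw [this, hr, List.append_nil]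
    exact Relation.ReflTransGen.refl
  | cons d l ih =>
    refine Leads.head (cfg_small _ _ _ _ _ hL (by omega) ?_)
      (step_right_some x ρ c q k hc hq f b L l₁ l d hr) ?_
    · have := hL r
      rw [hr] at this
      simp at this
      omega
    · have := ih (digit q b d).2 (l₁ ++ [(digit q b d).1])
        (put L r (l₁ ++ (digit q b d).1 :: l)) ?_ (by simp)
      · simpa [put, trans, hr] using this
      · intro t
        by_cases ht : t = r
        · subst ht; simpa [hr] using hL t
        · simpa [ht] using hL t

lemma leads_left {c : Ctl p} {q : Prog F R} {k : List (Prog F R)} (hc : c.1 = q :: k) {r : R}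
    (hq : sweepReg q = some r) (f : F) (b : Bool) {L : R → List Bool} (hL : ∀ t, (L t).length ≤ H)
    (n : ℕ) (hn : n ≤ (L r).length) :
    Leads (machine p i f₀ out) x ρ H (cfg i f₀ out c f false b r (n - 1) L)
      (cfg i f₀ out c f false b r (-1) L) := by
  induction n with
  | zero => exact Relation.ReflTransGen.refl
  | succ n ih =>
    have := step_left_some (i := i) (f₀ := f₀) (out := out) x ρ c q k hc hq f b L n (by omega)
    refine Leads.head (cfg_small _ _ _ _ _ hL (by push_cast; omega) ?_)
      (by simpa using this) (ih (by omega))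
    have := hL r
    push_cast
    omega

/-- One program instruction on a register costs a round trip: right over all digits with the carry,
a turn at the first blank, left to cell `-1`, and one step back to `0`. This is why the heads may
reach `-1` and `H`. -/
lemma leads_sweep {c : Ctl p} {q : Prog F R} {k : List (Prog F R)} (hc : c.1 = q :: k) {r : R}
    (hq : sweepReg q = some r) (f : F) {L : R → List Bool} (hL : ∀ t, (L t).length ≤ H)
    (hr : (swept q (L r)).length ≤ H) (s : R) :
    Leads (machine p i f₀ out) x ρ H (cfg i f₀ out c f true true s 0 L)
      (cfg i f₀ out (c.next f (trans q true (L r)).2) f true true s 0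
        (put L r (swept q (L r)))) := by
  have hlen : (trans q true (L r)).1.length = (L r).length := length_trans ..
  have h₁ : ∀ t, (put L r (trans q true (L r)).1 t).length ≤ H := by
    intro t
    by_cases ht : t = r
    · subst ht; simpa [hlen] using hL t
    · simpa [ht] using hL t
  have h₂ : ∀ t, (put L r (swept q (L r)) t).length ≤ H := by
    intro t
    by_cases ht : t = r
    · subst ht; simpa using hr
    · simpa [ht] using hL t
  rw [cfg_zero _ _ _ _ s r, cfg_zero _ _ _ _ s r]
  refine (leads_right hc hq f (L r) true [] L hL rfl).trans ?_
  have h₃ := step_right_none (i := i) (f₀ := f₀) (out := out) x ρ c q k hc hq f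
    (trans q true (L r)).2 (put L r (trans q true (L r)).1)
  simp only [put_self, hlen] at h₃
  have hput : put (put L r (trans q true (L r)).1) r
      ((trans q true (L r)).1 ++ if tailBit q (trans q true (L r)).2 then [true] else []) =
      put L r (swept q (L r)) := by
    simp [put, swept]
  rw [hput] at h₃
  refine Leads.head (cfg_small _ _ _ _ _ h₁ (by omega) (by exact_mod_cast hL r)) h₃ ?_
  refine (leads_left hc hq f _ h₂ (L r).length ?_).trans ?_
  · simp [swept, hlen]
  · exact Leads.head (cfg_small _ _ _ _ _ h₂ le_rfl (by omega))
      (step_left_none x ρ c q k hc hq f _ _) Relation.ReflTransGen.refl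

omit [Finite R] in
lemma val_put {L : R → List Bool} {σ : R → ℕ} (hL : ∀ t, val (L t) = σ t) (r : R) {l : List Bool}
    {v : ℕ} (hl : val l = v) (t : R) : val (put L r l t) = Function.update σ r v t := by
  by_cases ht : t = r
  · subst ht; simpa using hl
  · simpa [ht] using hL t

omit [Finite R] in
lemma length_put {L : R → List Bool} (hL : ∀ t, (L t).length ≤ H) (r : R) {l : List Bool}
    (hl : l.length ≤ H) (t : R) : (put L r l t).length ≤ H := by
  by_cases ht : t = r
  · subst ht; simpa using hl
  · simpa [ht] using hL t

lemma leads_control {c : Ctl p} {q : Prog F R} {k l : List (Prog F R)} (hc : c.1 = q :: k)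
    (hq : sweepReg q = none) {f : F} (hf : ∀ a, flagNext f a (q :: k) = f)
    (hl : contNext f true (q :: k) = l) {L : R → List Bool} (hL : ∀ t, (L t).length ≤ H) (s : R) :
    ∃ hl' : l ∈ conts p [] ∨ l = [], Leads (machine p i f₀ out) x ρ H
      (cfg i f₀ out c f true true s 0 L) (cfg i f₀ out ⟨l, hl'⟩ f true true s 0 L) := by
  have h := (c.next f true).2
  have hn : (c.next f true).1 = l := by rw [← hl, ← hc]; rfl
  have hs := step_control (i := i) (f₀ := f₀) (out := out) x ρ c q k hc hq f true s L
  rw [hf, Subtype.ext hn (a2 := (⟨l, hn ▸ h⟩ : Ctl p))] at hs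
  exact ⟨hn ▸ h, Leads.head (cfg_small _ _ _ _ _ hL (by omega) (by omega)) hs
    Relation.ReflTransGen.refl⟩

lemma leads_test {c : Ctl p} {q : Prog F R} {k : List (Prog F R)} (hc : c.1 = q :: k) {r : R}
    (hq : sweepReg q = some r) (hd : ∀ c b, digit q c b = (b, c && !b))
    (ht : ∀ c, tailBit q c = false) (f : F) {L : R → List Bool} (hL : ∀ t, (L t).length ≤ H)
    (s : R) :
    Leads (machine p i f₀ out) x ρ H (cfg i f₀ out c f true true s 0 L)
      (cfg i f₀ out (c.next f (val (L r) == 0)) f true true s 0 L) := by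
  have hs : swept q (L r) = L r := by rw [swept_of_ne_inc ht, trans_test hd]
  have := leads_sweep (i := i) (f₀ := f₀) (out := out) (x := x) (ρ := ρ) hc hq f hL
    (by rw [hs]; exact hL r) s
  rw [hs, trans_test hd] at this
  simpa [put] using this

/-- Induction on the execution, with the remaining programs `k` general. The digit lists `L` may
have leading zeros, because decrementing never shortens a list; hence values and lengths are tracked
separately. -/
lemma Exec.leads {q : Prog F R} {f : F} {σ : R → ℕ} {f' : F} {σ' : R → ℕ}
    (h : Exec x i H q f σ f' σ') (s : R) (k : List (Prog F R))
    (hk : q :: k ∈ conts p [] ∨ q :: k = []) (L : R → List Bool) (hv : ∀ t, val (L t) = σ t)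
    (hL : ∀ t, (L t).length ≤ H) :
    ∃ (hk' : k ∈ conts p [] ∨ k = []) (L' : R → List Bool), (∀ t, val (L' t) = σ' t) ∧
      (∀ t, (L' t).length ≤ H) ∧
      Leads (machine p i f₀ out) x ρ H (cfg i f₀ out ⟨q :: k, hk⟩ f true true s 0 L)
        (cfg i f₀ out ⟨k, hk'⟩ f' true true s 0 L') := by
  induction h generalizing k L with
  | upd h f σ =>
    refine ⟨(Ctl.next ⟨_, hk⟩ f true).2, L, hv, hL, ?_⟩
    refine Leads.head (cfg_small _ _ _ _ _ hL (by omega) (by omega))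
      (step_control x ρ _ _ k rfl rfl f true s L) ?_
    rw [← hv i]
    exact Relation.ReflTransGen.refl
  | @inc r f σ hr =>
    have hlen : (swept (.inc r : Prog F R) (L r)).length ≤ H :=
      length_swept_inc r (hL r) (by rw [hv]; exact hr)
    exact ⟨(Ctl.next ⟨_, hk⟩ f true).2, _,
      val_put hv r (by rw [val_swept_inc, hv]), length_put hL r hlen,
      leads_sweep (c := ⟨_, hk⟩) rfl rfl f hL hlen s⟩
  | @dec r f σ hr =>
    have hlen : (swept (.dec r : Prog F R) (L r)).length ≤ H := by
      rw [swept_of_ne_inc (fun _ => rfl), length_trans]; exact hL r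
    exact ⟨(Ctl.next ⟨_, hk⟩ f true).2, _,
      val_put hv r (by rw [val_swept_dec r (by rw [hv]; exact hr), hv]), length_put hL r hlen,
      leads_sweep (c := ⟨_, hk⟩) rfl rfl f hL hlen s⟩
  | @seq p q f σ f₁ σ₁ f₂ σ₂ hp hq ihp ihq =>
    obtain ⟨hk₀, h₀⟩ := leads_control (i := i) (f₀ := f₀) (out := out) (x := x) (ρ := ρ)
      (c := ⟨_, hk⟩) rfl rfl (f := f) (fun _ => rfl) rfl hL s
    obtain ⟨hk₁, L₁, hv₁, hL₁, h₁⟩ := ihp _ hk₀ L hv hL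
    obtain ⟨hk₂, L₂, hv₂, hL₂, h₂⟩ := ihq _ hk₁ L₁ hv₁ hL₁
    exact ⟨hk₂, L₂, hv₂, hL₂, h₀.trans (h₁.trans h₂)⟩
  | @ite_true c p q f σ f₁ σ₁ hc hp ih =>
    obtain ⟨hk₀, h₀⟩ := leads_control (i := i) (f₀ := f₀) (out := out) (x := x) (ρ := ρ)
      (c := ⟨_, hk⟩) (l := p :: k) rfl rfl (f := f) (fun _ => rfl) (by simp [contNext, hc]) hL s
    obtain ⟨hk₁, L₁, hv₁, hL₁, h₁⟩ := ih k hk₀ L hv hL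
    exact ⟨hk₁, L₁, hv₁, hL₁, h₀.trans h₁⟩
  | @ite_false c p q f σ f₁ σ₁ hc hp ih =>
    obtain ⟨hk₀, h₀⟩ := leads_control (i := i) (f₀ := f₀) (out := out) (x := x) (ρ := ρ)
      (c := ⟨_, hk⟩) (l := q :: k) rfl rfl (f := f) (fun _ => rfl) (by simp [contNext, hc]) hL s
    obtain ⟨hk₁, L₁, hv₁, hL₁, h₁⟩ := ih k hk₀ L hv hL
    exact ⟨hk₁, L₁, hv₁, hL₁, h₀.trans h₁⟩
  | @ifnz_pos r p q f σ f₁ σ₁ hr hp ih =>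
    have h₀ := leads_test (i := i) (f₀ := f₀) (out := out) (x := x) (ρ := ρ) (c := ⟨_, hk⟩)
      rfl rfl (fun _ _ => rfl) (fun _ => rfl) f hL s
    rw [hv, beq_false_of_ne hr] at h₀
    obtain ⟨hk₁, L₁, hv₁, hL₁, h₁⟩ := ih k (Ctl.next ⟨_, hk⟩ f false).2 L hv hL
    exact ⟨hk₁, L₁, hv₁, hL₁, h₀.trans h₁⟩
  | @ifnz_zero r p q f σ f₁ σ₁ hr hp ih =>
    have h₀ := leads_test (i := i) (f₀ := f₀) (out := out) (x := x) (ρ := ρ) (c := ⟨_, hk⟩)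
      rfl rfl (fun _ _ => rfl) (fun _ => rfl) f hL s
    rw [hv, hr] at h₀
    obtain ⟨hk₁, L₁, hv₁, hL₁, h₁⟩ := ih k (Ctl.next ⟨_, hk⟩ f true).2 L hv hL
    exact ⟨hk₁, L₁, hv₁, hL₁, h₀.trans h₁⟩
  | @loop_zero r p f σ hr =>
    have h₀ := leads_test (i := i) (f₀ := f₀) (out := out) (x := x) (ρ := ρ) (c := ⟨_, hk⟩)
      rfl rfl (fun _ _ => rfl) (fun _ => rfl) f hL s
    rw [hv, hr] at h₀
    exact ⟨(Ctl.next ⟨_, hk⟩ f true).2, L, hv, hL, h₀⟩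
  -- A round is a test, a decrement, the body, and then the same loop again in front of `k`.
  | @loop_succ r p f σ f₁ σ₁ f₂ σ₂ hr hp hl ihp ihl =>
    have h₀ := leads_test (i := i) (f₀ := f₀) (out := out) (x := x) (ρ := ρ) (c := ⟨_, hk⟩)
      rfl rfl (fun _ _ => rfl) (fun _ => rfl) f hL s
    rw [hv, beq_false_of_ne hr] at h₀
    have hk₀ := (Ctl.next ⟨_, hk⟩ f false).2
    have hlen : (swept (.dec r : Prog F R) (L r)).length ≤ H := by
      rw [swept_of_ne_inc (fun _ => rfl), length_trans]; exact hL r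
    have h₁ := leads_sweep (i := i) (f₀ := f₀) (out := out) (x := x) (ρ := ρ) (c := ⟨_, hk₀⟩)
      rfl rfl f hL hlen s
    obtain ⟨hk₂, L₂, hv₂, hL₂, h₂⟩ := ihp _ (Ctl.next ⟨_, hk₀⟩ f true).2 _
      (val_put hv r (by rw [val_swept_dec r (by rw [hv]; exact hr), hv])) (length_put hL r hlen)
    obtain ⟨hk₃, L₃, hv₃, hL₃, h₃⟩ := ihl _ hk₂ L₂ hv₂ hL₂
    exact ⟨hk₃, L₃, hv₃, hL₃, h₀.trans (h₁.trans (h₂.trans h₃))⟩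

end Prog
end

/-! ### Polynomial time from counting configurations -/

noncomputable section

/-- Pigeonhole: before `P` is first reached no element of the orbit occurs twice, so the time to
reach it is at most the number of codes. After that the orbit is constant by `hP`. -/
lemma iterate_of_card_le {α β : Type*} [Finite β] {f : α → α} {P : α → Prop}
    (hP : ∀ a, P a → f a = a) {a : α} {S : Set α} (e : α → β) (he : Set.InjOn e S)
    (hS : ∀ s, f^[s] a ∈ S) (h : ∃ s, P (f^[s] a)) {n : ℕ} (hn : Nat.card β ≤ n) :
    P (f^[n] a) := by
  classical
  have hs := Nat.find_spec h
  set s := Nat.find h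
  by_cases hsn : s ≤ n
  · obtain ⟨m, rfl⟩ := Nat.exists_eq_add_of_le hsn
    rw [add_comm, Function.iterate_add_apply, Function.iterate_fixed (hP _ hs)]
    exact hs
  · exfalso
    have := Fintype.ofFinite β
    obtain ⟨i, j, hij, hfij⟩ := Fintype.exists_ne_map_eq_of_card_lt
      (fun j : Fin (n + 1) => e (f^[j] a)) (by rw [← Nat.card_eq_fintype_card, Fintype.card_fin]; omega)
    have key : ∀ i j : ℕ, i < j → j ≤ n → f^[i] a = f^[j] a → False := by
      intro i j hij hj hfij
      -- Cutting the cycle between the times `i` and `j` out of the orbit would reach `P` before its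
      -- first time `s`.
      refine Nat.find_min h (m := s - j + i) (by omega) ?_
      have : f^[s - j + i] a = f^[s] a := by
        rw [Function.iterate_add_apply, hfij, ← Function.iterate_add_apply]
        congr 2
        omega
      rw [this]
      exact hs
    have hfij' := he (hS _) (hS _) hfij
    rcases lt_or_gt_of_ne (Fin.val_ne_of_ne hij) with hlt | hlt
    · exact key i j hlt (by omega) hfij'
    · exact key j i hlt (by omega) hfij'.symm

/-- For `n ≥ 2` the constant factor `2 ^ A` is absorbed by `n ^ A`; the additive `C` is there for `n
< 2`, where the logarithm is zero. -/
lemma exists_two_pow_le (A B D : ℕ) :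
    ∃ C ≥ D, ∀ n : ℕ, 2 ^ (A + B * Nat.log 2 n) ≤ n ^ C + C := by
  have hA : 0 < 2 ^ A := by positivity
  refine ⟨A + B + 2 ^ A + D, by linarith, fun n => ?_⟩
  rcases Nat.lt_or_ge n 2 with hn | hn
  · rw [Nat.log_of_lt hn]
    simp only [mul_zero, add_zero]
    omega
  · calc 2 ^ (A + B * Nat.log 2 n) = 2 ^ A * (2 ^ Nat.log 2 n) ^ B := by
          rw [pow_add, mul_comm B, pow_mul]
      _ ≤ n ^ A * n ^ B := by
          gcongr
          exact Nat.pow_log_le_self 2 (by omega)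
      _ = n ^ (A + B) := (pow_add ..).symm
      _ ≤ n ^ (A + B + 2 ^ A + D) := Nat.pow_le_pow_right (by omega) (by linarith)
      _ ≤ _ := Nat.le_add_right _ _

namespace RATM

lemma step_of_halted {M : RATM} (x : List Bool) (ρ : ℕ → Bool) {a : M.Config}
    (h : (M.output a.state).isSome) : M.step x ρ a = a := by
  rw [step, if_pos h]

lemma run_eq_of_halted {M : RATM} {x : List Bool} {ρ : ℕ → Bool} {s t : ℕ} (hst : s ≤ t)
    (h : (M.output (M.run x ρ s).state).isSome) : M.run x ρ t = M.run x ρ s := by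
  obtain ⟨m, rfl⟩ := Nat.exists_eq_add_of_le hst
  rw [run, add_comm, Function.iterate_add_apply]
  exact Function.iterate_fixed (step_of_halted x ρ h) m

lemma Outputs.unique {M : RATM} {x : List Bool} {ρ : ℕ → Bool} {b c : Bool}
    (hb : M.Outputs x ρ b) (hc : M.Outputs x ρ c) : b = c := by
  obtain ⟨s, hs⟩ := hb
  obtain ⟨t, ht⟩ := hc
  rcases le_total s t with h | h
  · rw [run_eq_of_halted h (by simp [hs]), hs] at ht
    exact Option.some_injective _ ht
  · rw [run_eq_of_halted h (by simp [ht]), ht] at hs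
    exact (Option.some_injective _ hs).symm

/-- Small configurations, as elements of a finite type. -/
def Config.code {M : RATM} (H : ℕ) (a : M.Config) :
    M.Q × (M.T → Fin (H + 2)) × (M.T → Fin H → Option Bool) :=
  (a.state, fun t => Fin.ofNat (H + 2) (a.head t + 1).toNat, fun t z => a.cell t z)

/-- Heads from `-1` to `H` are shifted by one to fit into `Fin (H + 2)`, cells outside of `0, ..., H
- 1` are blank, and the position on the random tape is `0`; so the code loses nothing. -/
lemma Config.code_injOn {M : RATM} (H : ℕ) :
    Set.InjOn (Config.code H) {a : M.Config | a.Small H} := by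
  intro a ha b hb hab
  simp only [code, Prod.mk.injEq] at hab
  obtain ⟨hs, hh, hc⟩ := hab
  have hh' : a.head = b.head := by
    funext t
    have h := congrArg Fin.val (congrFun hh t)
    have ha := ha.1 t
    have hb := hb.1 t
    simp only [Fin.ofNat, Fin.val_mk] at h
    rw [Nat.mod_eq_of_lt (by omega), Nat.mod_eq_of_lt (by omega)] at h
    omega
  have hc' : a.cell = b.cell := by
    funext t z
    by_cases hz : z < 0 ∨ H ≤ z
    · rw [(ha.1 t).2.2 z hz, (hb.1 t).2.2 z hz]
    · have h := congrFun (congrFun hc t) ⟨z.toNat, by omega⟩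
      have hz' : ((z.toNat : ℕ) : ℤ) = z := by omega
      simpa only [hz'] using h
  exact Prog.config_ext hs (congrFun hh') (congrFun hc') (ha.2.trans hb.2.symm)

end RATM

namespace Prog

variable {F R : Type} [DecidableEq R] [Finite F] [Finite R] {p : Prog F R} {i : R} {f₀ : F}
  {out : F → Bool} {x : List Bool} {ρ : ℕ → Bool} {H : ℕ}

/-- Since the last configuration is a fixed point of the step, smallness along the finite path gives
smallness at all times. -/
lemma Leads.exists_run {M : RATM} {a b : M.Config} (h : Leads M x ρ H a b) (hb : b.Small H)
    (hb' : M.step x ρ b = b) :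
    (∀ s, ((M.step x ρ)^[s] a).Small H) ∧ ∃ s, (M.step x ρ)^[s] a = b := by
  induction h using Relation.ReflTransGen.head_induction_on with
  | refl => exact ⟨fun s => by rwa [Function.iterate_fixed hb'], 0, rfl⟩
  | head hac _ ih =>
    obtain ⟨h₁, s, h₂⟩ := ih
    refine ⟨fun s => ?_, s + 1, ?_⟩
    · cases s with
      | zero => exact hac.1
      | succ s => rw [Function.iterate_succ_apply, hac.2]; exact h₁ s
    · rw [Function.iterate_succ_apply, hac.2, h₂]

lemma Exec.run {f : F} {σ : R → ℕ} (h : Exec x i H p f₀ 0 f σ) (ρ : ℕ → Bool) :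
    (∀ s, ((machine p i f₀ out).run x ρ s).Small H) ∧
      ∃ s, (machine p i f₀ out).output ((machine p i f₀ out).run x ρ s).state = some (out f) := by
  obtain ⟨hk, L, -, hL, hl⟩ := h.leads (out := out) (ρ := ρ) i []
    (Or.inl (cons_mem_conts p [])) (fun _ => []) (fun _ => rfl) (by simp)
  have hi : (machine p i f₀ out).init = cfg i f₀ out ⟨[p], Or.inl (cons_mem_conts p [])⟩ f₀
      true true i 0 (fun _ => []) := by
    refine config_ext rfl (fun (t : R) => ?_) (fun (t : R) => ?_) rfl
    · change (0 : ℤ) = put (R := R) 0 i 0 t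
      simp
    · funext z
      rcases z with n | n <;> rfl
  have ho : (machine p i f₀ out).output (cfg i f₀ out ⟨[], hk⟩ f true true i 0 L).state =
      some (out f) := by
    rfl
  obtain ⟨h₁, s, h₂⟩ := hl.exists_run (cfg_small _ _ _ _ _ hL (by omega) (by omega))
    (RATM.step_of_halted x ρ (Option.isSome_of_mem ho))
  rw [← hi] at h₁ h₂
  exact ⟨h₁, s, by rw [RATM.run, h₂, ho]⟩

/-- The machine outputs what the program computes. -/
theorem Exec.outputs_iff {f : F} {σ : R → ℕ} (h : Exec x i H p f₀ 0 f σ) {b : Bool} :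
    (machine p i f₀ out).Outputs x ρ b ↔ b = out f := by
  have ho : (machine p i f₀ out).Outputs x ρ (out f) := (h.run ρ).2
  exact ⟨fun hb => hb.unique ho, fun hb => hb ▸ ho⟩

/-- A program whose values are polynomially bounded is executed by a logspace machine. -/
theorem machine_isRandomizedLogspace {c : ℕ} (h : ∀ x : List Bool, ∃ (f : F) (σ : R → ℕ),
    Exec x i (c * Nat.log 2 x.length + c) p f₀ 0 f σ) :
    (machine p i f₀ out).IsRandomizedLogspace := by
  set M := machine p i f₀ out
  have := M.finiteQ
  have := M.finiteT
  -- With q states and m tapes there are at most q (H + 2)^m 3^(Hm) codes, which is at most 2^(q +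
  -- 2m + 3mH); substituting H = c log n + c gives these two constants. The last argument `c + 1`
  -- makes `C` positive, to cover a head on cell `-1`.
  obtain ⟨C, hC, hC'⟩ := exists_two_pow_le (Nat.card M.Q + 2 * Nat.card M.T + 3 * Nat.card M.T * c)
    (3 * Nat.card M.T * c) (c + 1)
  refine ⟨C, fun x ρ => ?_⟩
  obtain ⟨f, σ, hx⟩ := h x
  obtain ⟨h₁, s, h₂⟩ := hx.run (out := out) ρ
  set H := c * Nat.log 2 x.length + c with hH
  refine ⟨?_, fun s t => ?_⟩
  · refine iterate_of_card_le (P := fun a : M.Config => (M.output a.state).isSome)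
      (fun a ha => RATM.step_of_halted x ρ ha) (RATM.Config.code H) (RATM.Config.code_injOn H) h₁
      ⟨s, by rw [RATM.run] at h₂; rw [h₂]; rfl⟩ (le_trans ?_ (hC' x.length))
    have := Fintype.ofFinite M.Q
    have := Fintype.ofFinite M.T
    classical
    simp only [Nat.card_eq_fintype_card, Fintype.card_prod, Fintype.card_fun, Fintype.card_fin,
      Fintype.card_option, Fintype.card_bool]
    calc Fintype.card M.Q * ((H + 2) ^ Fintype.card M.T * ((2 + 1) ^ H) ^ Fintype.card M.T)
        ≤ 2 ^ Fintype.card M.Q * ((2 ^ (H + 2)) ^ Fintype.card M.T *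
            ((2 ^ 2) ^ H) ^ Fintype.card M.T) := by
          gcongr
          · exact Nat.lt_two_pow_self.le
          · exact Nat.lt_two_pow_self.le
          · norm_num
      _ = _ := by
          simp only [← pow_mul, ← pow_add]
          rw [hH]
          ring_nf
  · have h := (h₁ s).1 t
    have hc : c * Nat.log 2 x.length ≤ C * Nat.log 2 x.length := by gcongr; omega
    rw [abs_le]
    have h1 := h.1
    have h2 := h.2.1
    zify at hc hC hH
    constructor
    · have : (0 : ℤ) ≤ c * Nat.log 2 x.length := by positivity
      linarith
    · linarith

end Prog
end

noncomputable section

/-! ### Elementary programs -/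

namespace Prog

open Function (update)

variable {F R : Type} [DecidableEq R] {x : List Bool} {ι : R} {H : ℕ} {f : F} {σ : R → ℕ}

lemma Exec.congr {p : Prog F R} {f f₁ f₂ : F} {σ σ₁ σ₂ : R → ℕ} (h : Exec x ι H p f σ f₁ σ₁)
    (hf : f₁ = f₂) (hσ : σ₁ = σ₂) : Exec x ι H p f σ f₂ σ₂ := hf ▸ hσ ▸ h

/-- A loop is verified by giving the flags `φ m` and the registers `τ m` before round `m`. The proof
is by induction on the number `j` of rounds that are left. -/
lemma exec_loop {r : R} {p : Prog F R} {f' : F} {σ' : R → ℕ} (n : ℕ) (φ : ℕ → F)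
    (τ : ℕ → R → ℕ) (hf : φ 0 = f) (hσ : τ 0 = σ) (hf' : φ n = f') (hσ' : τ n = σ')
    (hr : ∀ m ≤ n, τ m r = n - m)
    (h : ∀ m < n, Exec x ι H p (φ m) (update (τ m) r (n - m - 1)) (φ (m + 1)) (τ (m + 1))) :
    Exec x ι H (.loop r p) f σ f' σ' := by
  subst hf hσ hf' hσ'
  suffices ∀ j ≤ n, Exec x ι H (.loop r p) (φ (n - j)) (τ (n - j)) (φ n) (τ n) by
    simpa using this n le_rfl
  intro j
  induction j with
  | zero => intro _; exact Exec.loop_zero _ (by simp [hr n le_rfl])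
  | succ j ih =>
    intro hj
    have h₁ := h (n - (j + 1)) (by omega)
    have h₂ : n - (j + 1) + 1 = n - j := by omega
    rw [h₂] at h₁
    refine Exec.loop_succ (by rw [hr _ (by omega)]; omega) ?_ (ih (by omega))
    rw [hr _ (by omega)]
    exact h₁

/-- Do nothing. -/
def skip : Prog F R := .upd fun f _ => f

lemma exec_skip : Exec x ι H skip f σ f σ := Exec.upd ..

/-- Set the register `a` to zero. -/
def clear (a : R) : Prog F R := .loop a skip

lemma exec_clear (a : R) : Exec x ι H (clear a) f σ f (update σ a 0) := by
  refine exec_loop (σ a) (fun _ => f) (fun m => update σ a (σ a - m)) rfl (by simp) rfl (by simp)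
    (by simp) fun m _ => ?_
  exact exec_skip.congr rfl (by simp [Nat.sub_sub])

/-- Add the register `a` to `b`, and set it to zero. -/
def drain (a b : R) : Prog F R := .loop a (.inc b)

lemma exec_drain {a b : R} (hab : a ≠ b := by simp) (hH : σ b + σ a < 2 ^ H) :
    Exec x ι H (drain a b) f σ f (update (update σ a 0) b (σ b + σ a)) := by
  refine exec_loop (σ a) (fun _ => f) (fun m => update (update σ a (σ a - m)) b (σ b + m)) rfl
    (by simp) rfl (by simp) (by simp [hab]) fun m hm => (Exec.inc _ ?_).congr rfl ?_
  · simp [hab.symm]; omega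
  · funext z
    simp only [Function.update_apply]
    split_ifs <;> simp_all <;> omega

/-- Add the register `a` to `d`, with the help of the zero register `t`. -/
def addTo (d a t : R) : Prog F R := .seq (.loop a (.seq (.inc d) (.inc t))) (drain t a)

/-- A loop destroys its counter, so `a` is also counted into `t`, from where it is drained back. The
conditions on distinct registers have default proofs that settle them for concrete names. -/
lemma exec_addTo {d a t : R} (hda : d ≠ a := by simp) (hdt : d ≠ t := by simp)
    (hat : a ≠ t := by simp) (ht : σ t = 0)
    (hH : σ d + σ a < 2 ^ H) :
    Exec x ι H (addTo d a t) f σ f (update σ d (σ d + σ a)) := by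
  refine Exec.seq (f₁ := f) (σ₁ := update (update (update σ a 0) d (σ d + σ a)) t (σ a)) ?_
    ((exec_drain hat.symm ?_).congr rfl ?_)
  · refine exec_loop (σ a) (fun _ => f)
      (fun m => update (update (update σ a (σ a - m)) d (σ d + m)) t m) rfl ?_ rfl (by simp)
      (by simp [hda.symm, hat]) fun m hm => Exec.seq (Exec.inc _ ?_) (Exec.inc _ ?_) |>.congr rfl ?_
    · funext z; simp only [Function.update_apply]; split_ifs <;> simp_all
    · simp [hda, hdt]; omega
    · simp [hdt.symm, hat.symm]; omega
    · funext z; simp only [Function.update_apply]; split_ifs <;> simp_all <;> omega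
  · simp [hda.symm, hat]; omega
  · funext z; simp only [Function.update_apply]; split_ifs <;> simp_all

/-- Set `d` to the value of the register `a`, with the help of the zero register `t`. -/
def copy (d a t : R) : Prog F R := .seq (clear d) (addTo d a t)

lemma exec_copy {d a t : R} (hda : d ≠ a := by simp) (hdt : d ≠ t := by simp)
    (hat : a ≠ t := by simp) (ht : σ t = 0)
    (hH : σ a < 2 ^ H) : Exec x ι H (copy d a t) f σ f (update σ d (σ a)) := by
  refine Exec.seq (exec_clear d) (exec_addTo hda hdt hat ?_ ?_) |>.congr rfl ?_
  · simpa [hdt.symm]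
  · simpa [hda.symm]
  · simp [hda.symm]

/-- Run `p` as often as the register `n` says, with the index in `i`, with the help of the zero
registers `c` and `t`. -/
def for' (i c n t : R) (p : Prog F R) : Prog F R :=
  .seq (copy c n t) (.seq (.loop c (.seq p (.inc i))) (clear i))

/-- Seen from outside, the counter `c` and the index `i` are zero in every `τ m`. During round `m`
they hold `a - m - 1` and `m`, and the body has to leave them so. -/
lemma exec_for {i c n t : R} {p : Prog F R} (hcn : c ≠ n := by simp) (hct : c ≠ t := by simp)
    (hnt : n ≠ t := by simp) (hic : i ≠ c := by simp)
    (φ : ℕ → F) (τ : ℕ → R → ℕ) (ht : τ 0 t = 0) {a : ℕ} (ha : τ 0 n = a) (hH : a < 2 ^ H)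
    (hc : ∀ m ≤ a, τ m c = 0) (hi : ∀ m ≤ a, τ m i = 0)
    (h : ∀ m < a, Exec x ι H p (φ m) (update (update (τ m) c (a - m - 1)) i m)
      (φ (m + 1)) (update (update (τ (m + 1)) c (a - m - 1)) i m)) :
    Exec x ι H (for' i c n t p) (φ 0) (τ 0) (φ a) (τ a) := by
  refine Exec.seq (exec_copy hcn hct hnt ht (by rwa [ha])) (Exec.seq (f₁ := φ a)
    (σ₁ := update (update (τ a) c 0) i a) ?_ ((exec_clear i).congr rfl ?_))
  · refine exec_loop a φ (fun m => update (update (τ m) c (a - m)) i m) rfl ?_ rfl (by simp)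
      (by simp [hic.symm]) fun m hm => Exec.seq (f₁ := φ (m + 1))
        (σ₁ := update (update (τ (m + 1)) c (a - m - 1)) i m) ?_ ((Exec.inc _ ?_).congr rfl ?_)
    · rw [ha]
      funext z
      have := hi 0 (Nat.zero_le _)
      simp only [Function.update_apply]
      split_ifs <;> simp_all
    · convert h m hm using 1
      funext z
      simp only [Function.update_apply]
      split_ifs <;> simp_all
    · simp; omega
    · funext z
      simp only [Function.update_apply]
      split_ifs <;> simp_all
      omega
  · have := hi a le_rfl
    have := hc a le_rfl
    funext z
    simp only [Function.update_apply]
    split_ifs <;> simp_all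

/-- Add `a * b` to `d`, with the help of the zero registers `c` and `t`. -/
def mulAdd (d a b c t : R) : Prog F R := .seq (copy c a t) (.loop c (addTo d b t))

lemma exec_mulAdd {d a b c t : R} (hca : c ≠ a := by simp) (hct : c ≠ t := by simp)
    (hat : a ≠ t := by simp) (hdb : d ≠ b := by simp)
    (hdt : d ≠ t := by simp) (hbt : b ≠ t := by simp) (hdc : d ≠ c := by simp)
    (hbc : b ≠ c := by simp) (ht : σ t = 0) (hc : σ c = 0)
    (ha : σ a < 2 ^ H) (hH : σ d + σ a * σ b < 2 ^ H) :
    Exec x ι H (mulAdd d a b c t) f σ f (update σ d (σ d + σ a * σ b)) := by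
  refine Exec.seq (exec_copy hca hct hat ht ha) (exec_loop (σ a) (fun _ => f)
    (fun m => update (update σ c (σ a - m)) d (σ d + m * σ b)) rfl ?_ rfl ?_ (by simp [hdc.symm])
    fun m hm => (exec_addTo hdb hdt hbt ?_ ?_).congr rfl ?_)
  · funext z
    simp only [Function.update_apply]
    split_ifs <;> simp_all
  · funext z
    simp only [Function.update_apply]
    split_ifs <;> simp_all
  · simp [hct.symm, hdt.symm, ht]
  · have hmul : σ d + (m + 1) * σ b ≤ σ d + σ a * σ b := by gcongr; omega
    simp [hdb.symm, hbc, hdc]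
    linarith
  · funext z
    simp only [Function.update_apply]
    split_ifs <;> simp_all
    · ring
    · omega

/-- Run `p` or `q` according to whether the registers `a` and `b` agree, with the help of the zero
registers `c`, `e`, `s` and `t`. -/
def ifEq (a b c e s t : R) (p q : Prog F R) : Prog F R :=
  .seq (copy c a t) (.seq (copy e b t) (.seq (.loop c (.ifnz e (.dec e) (.inc s)))
    (.ifnz s (.seq (clear s) (.seq (clear e) q)) (.ifnz e (.seq (clear e) q) p))))

/-- The loop leaves the truncated differences `σ b - σ a` in `e` and `σ a - σ b` in `s`; the
registers agree exactly if both vanish. All helpers are zero again when the chosen branch starts. -/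
lemma exec_ifEq {a b c e s t : R} {p q : Prog F R} {f' : F} {σ' : R → ℕ}
    (hca : c ≠ a := by simp) (hct : c ≠ t := by simp)
    (hat : a ≠ t := by simp) (heb : e ≠ b := by simp) (het : e ≠ t := by simp)
    (hbt : b ≠ t := by simp) (hce : c ≠ e := by simp) (hcs : c ≠ s := by simp)
    (hes : e ≠ s := by simp) (hcb : c ≠ b := by simp) (ht : σ t = 0)
    (hc : σ c = 0) (he : σ e = 0) (hs : σ s = 0) (ha : σ a < 2 ^ H) (hb : σ b < 2 ^ H)
    (h : Exec x ι H (if σ a = σ b then p else q) f σ f' σ') :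
    Exec x ι H (ifEq a b c e s t p q) f σ f' σ' := by
  refine Exec.seq (exec_copy hca hct hat ht ha) (Exec.seq (exec_copy heb het hbt ?_ ?_)
    (Exec.seq (f₁ := f) (σ₁ := update (update (update σ c 0) e (σ b - σ a)) s (σ a - σ b)) ?_ ?_))
  · simpa [hct.symm]
  · simpa [hcb.symm]
  · refine exec_loop (σ a) (fun _ => f)
      (fun m => update (update (update σ c (σ a - m)) e (σ b - m)) s (m - σ b)) rfl ?_ rfl (by simp)
      (by simp [hce, hcs]) fun m hm => ?_
    · funext z
      simp only [Function.update_apply]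
      split_ifs <;> simp_all
    · by_cases hmb : m < σ b
      · refine (Exec.ifnz_pos ?_ (Exec.dec _ ?_)).congr rfl ?_
        · simp [hes, hce.symm]; omega
        · simp [hes, hce.symm]; omega
        · funext z
          simp only [Function.update_apply]
          split_ifs <;> simp_all <;> omega
      · refine (Exec.ifnz_zero ?_ (Exec.inc _ ?_)).congr rfl ?_
        · simp [hes, hce.symm]; omega
        · simp [hcs.symm]; omega
        · funext z
          simp only [Function.update_apply]
          split_ifs <;> simp_all <;> omega
  · rcases lt_trichotomy (σ a) (σ b) with hlt | heq | hgt
    · rw [if_neg hlt.ne] at h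
      refine Exec.ifnz_zero (by simp; omega) (Exec.ifnz_pos (by simp [hes]; omega)
        (Exec.seq (exec_clear e) ?_))
      convert h using 1
      funext z
      have : σ a - σ b = 0 := by omega
      simp only [Function.update_apply]
      split_ifs <;> simp_all
    · rw [if_pos heq] at h
      refine Exec.ifnz_zero (by simp; omega) (Exec.ifnz_zero (by simp [hes]; omega) ?_)
      convert h using 1
      funext z
      simp only [Function.update_apply]
      split_ifs <;> simp_all
    · rw [if_neg hgt.ne'] at h
      refine Exec.ifnz_pos (by simp; omega) (Exec.seq (exec_clear s) (Exec.seq (exec_clear e) ?_))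
      convert h using 1
      funext z
      simp only [Function.update_apply]
      split_ifs <;> simp_all

/-- Run the programs of a list one after the other. -/
def seqs : List (Prog F R) → Prog F R
  | [] => skip
  | p :: l => .seq p (seqs l)

end Prog
end

noncomputable section

/-! ### The simulation of a machine on a graph with two vertices exchanged -/

/-- Names of registers. -/
inductive Var
  | idx | N | k | u | v | w | y | i | j | si | sj | need | go | run | A | pow | Y
  | s1 | s2 | s3 | s4 | ci | cj | cu | cv | cw
  deriving DecidableEq

instance : Finite Var := by
  refine Set.finite_univ_iff.1 ((List.finite_toSet [.idx, .N, .k, .u, .v, .w, .y, .i, .j, .si, .sj,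
    .need, .go, .run, .A, .pow, .Y, .s1, .s2, .s3, .s4, .ci, .cj, .cu, .cv, .cw]).subset ?_)
  intro v _
  cases v <;> simp

/-- The registers: two for each tape of the simulated machine (the contents to the left of the head
are in the register with `false`, the rest is in the one with `true`), and those with names. -/
abbrev Reg (T : Type) : Type := T × Bool ⊕ Var

instance (T : Type) : Coe Var (Reg T) := ⟨Sum.inr⟩

instance (T : Type) : DecidableEq (Reg T) := Classical.decEq _

/-- The flags of the simulation: the state of the simulated machine, the symbols that it reads,
writes, and its moves; the last digit popped from a register; the last bit of the simulated input
read; the result of a simulation; and two flags for the test for cliques. -/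
structure Flags (M : RATM) where
  q : M.Q
  sym : M.T → Option Bool
  wr : M.T → Option Bool
  mv : M.T → SignType
  d : Option Bool
  bit : Option Bool
  out : Bool
  good : Bool
  res : Bool

instance (M : RATM) : Finite (Flags M) := by
  have := M.finiteQ
  have := M.finiteT
  refine Finite.of_injective (fun f : Flags M =>
    (f.q, f.sym, f.wr, f.mv, f.d, f.bit, f.out, f.good, f.res)) fun f g h => ?_
  cases f
  cases g
  simpa using h

instance (M : RATM) : Finite (Reg M.T) := by
  have := M.finiteT
  infer_instance

namespace Prog

open Function (update)
open Var

variable {M : RATM} {x : List Bool} {H : ℕ} {f : Flags M} {σ : Reg M.T → ℕ}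

/-- The address of the bit for the pair `a, b` in the encoding of a graph with `N` vertices. -/
def entryPos (N k a b : ℕ) : ℕ := N + k + 2 + a * N + b

/-- The transposition of `0` and `u`. -/
def swapZero (u a : ℕ) : ℕ := if a = 0 then u else if a = u then 0 else a

/-- Add to `d` the image of `a` under the transposition of `0` and `u`. -/
def swapTo (d a : Reg M.T) : Prog (Flags M) (Reg M.T) :=
  .ifnz a (ifEq a u s2 s3 s4 s1 skip (addTo d a s1)) (addTo d u s1)

lemma exec_swapTo {d a : Reg M.T} (hda : d ≠ a) (hdu : d ≠ u) (hd : d ≠ s1) (h₁ : a ≠ s1)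
    (h₂ : a ≠ s2) (h₃ : a ≠ s3) (hd₀ : σ d = 0) (z₁ : σ s1 = 0) (z₂ : σ s2 = 0) (z₃ : σ s3 = 0)
    (z₄ : σ s4 = 0) (ha : σ a < 2 ^ H) (hu : σ u < 2 ^ H) :
    Exec x (idx : Reg M.T) H (swapTo d a) f σ f (update σ d (swapZero (σ u) (σ a))) := by
  by_cases h : σ a = 0
  · refine (Exec.ifnz_zero h (exec_addTo hdu hd (by simp) z₁ (by omega))).congr rfl ?_
    simp [swapZero, h, hd₀]
  · refine Exec.ifnz_pos h (exec_ifEq h₂.symm (by simp) h₁ (by simp) (by simp) (by simp) (by simp)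
      (by simp) (by simp) (by simp) z₁ z₂ z₃ z₄ ha hu ?_)
    by_cases hau : σ a = σ u
    · rw [if_pos hau]
      refine exec_skip.congr rfl ?_
      have : swapZero (σ u) (σ a) = σ d := by simp [swapZero, h, hau, hd₀]
      rw [this, Function.update_eq_self]
    · rw [if_neg hau]
      refine (exec_addTo hda hd h₁ z₁ (by omega)).congr rfl ?_
      simp [swapZero, h, hau, hd₀]

lemma swapZero_le (u a : ℕ) : swapZero u a ≤ u + a := by
  unfold swapZero; split_ifs <;> omega

/-- Set the input address to that of the pair `a, b`, with the vertices `0` and `u` exchanged. -/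
def locate (a b : Reg M.T) : Prog (Flags M) (Reg M.T) :=
  .seq (swapTo si a) <| .seq (swapTo sj b) <| .seq (addTo idx N s1) <| .seq (addTo idx k s1) <|
  .seq (.inc idx) <| .seq (.inc idx) <| .seq (mulAdd idx si N s2 s1) <|
  .seq (drain sj idx) (clear si)

/-- The crude estimate `swapZero u a ≤ u + a` gives a bound that needs no assumption that `u`, `a`
and `b` are names of vertices. -/
lemma entryPos_lt {N k u a b H : ℕ} (hB : (N + k + u + 4) ^ 2 + (a + b) * (N + 1) < 2 ^ H) :
    entryPos N k (swapZero u a) (swapZero u b) < 2 ^ H := by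
  have h₁ := swapZero_le u a
  have h₂ := swapZero_le u b
  have : swapZero u a * N ≤ (u + a) * N := Nat.mul_le_mul_right _ h₁
  unfold entryPos
  nlinarith

/-- Registers that vanish. -/
def Zeros (σ : Reg M.T → ℕ) (l : List Var) : Prop := ∀ n ∈ l, σ (.inr n) = 0

lemma exec_locate {a b : Var} (ha : a ∉ [idx, si, sj, s1, s2, s3, s4])
    (hb : b ∉ [idx, si, sj, s1, s2, s3, s4]) (hz : Zeros σ [idx, si, sj, s1, s2, s3, s4])
    (hB : (σ N + σ k + σ u + 4) ^ 2 + (σ a + σ b) * (σ N + 1) < 2 ^ H) :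
    Exec x (idx : Reg M.T) H (locate a b) f σ f
      (update σ idx (entryPos (σ N) (σ k) (swapZero (σ u) (σ a)) (swapZero (σ u) (σ b)))) := by
  simp only [List.mem_cons, List.not_mem_nil, or_false, not_or] at ha hb
  simp only [Zeros, List.mem_cons, List.not_mem_nil, or_false, forall_eq_or_imp, forall_eq] at hz
  obtain ⟨a₁, a₂, a₃, a₄, a₅, a₆, a₇⟩ := ha
  obtain ⟨b₁, b₂, b₃, b₄, b₅, b₆, b₇⟩ := hb
  obtain ⟨z₁, z₂, z₃, z₄, z₅, z₆, z₇⟩ := hz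
  have hp := entryPos_lt hB
  have hs := swapZero_le (σ u) (σ a)
  have hs' := swapZero_le (σ u) (σ b)
  have hsum : σ N + σ k + σ u + σ a + σ b + 2 < 2 ^ H := by nlinarith
  unfold entryPos at hp
  refine Exec.seq (exec_swapTo ?_ ?_ ?_ ?_ ?_ ?_ ?_ ?_ ?_ ?_ ?_ ?_ ?_) <|
    Exec.seq (exec_swapTo ?_ ?_ ?_ ?_ ?_ ?_ ?_ ?_ ?_ ?_ ?_ ?_ ?_) <|
    Exec.seq (exec_addTo (ht := ?_) (hH := ?_)) <| Exec.seq (exec_addTo (ht := ?_) (hH := ?_)) <|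
    Exec.seq (Exec.inc _ ?_) <| Exec.seq (Exec.inc _ ?_) <|
    Exec.seq (exec_mulAdd (ht := ?_) (hc := ?_) (ha := ?_) (hH := ?_)) <|
    Exec.seq (exec_drain (hH := ?_)) (exec_clear _) |>.congr rfl ?_
  all_goals try simp only [ne_eq, Function.update_apply, Sum.inr.injEq, reduceCtorEq, ↓reduceIte,
    not_false_eq_true, a₁, a₂, a₃, a₄, a₅, a₆, a₇, b₁, b₂, b₃, b₄, b₅, b₆, b₇, z₁, z₂, z₃, z₄, z₅,
    z₆, z₇, Ne.symm a₂, Ne.symm b₃, zero_add]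
  all_goals try omega
  funext z
  by_cases h₁ : z = Sum.inr idx
  · subst h₁; simp [entryPos]
  by_cases h₂ : z = Sum.inr si
  · subst h₂; simp [z₂]
  by_cases h₃ : z = Sum.inr sj
  · subst h₃; simp [z₃]
  simp [Function.update_apply, h₁, h₂, h₃]

/-! ### Reading a bit of the simulated input -/

/-- The register `A` counts down to the wanted bit of a list whose bits are produced in order;
produce the bit `g a`, where `a` is the present input bit. -/
def emit (g : Option Bool → Bool) : Prog (Flags M) (Reg M.T) :=
  .ite (fun f => f.bit.isSome) skip
    (.ifnz A (.dec A) (.upd fun f a => { f with bit := some (g a) }))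

/-- The program `p` produces the bits `b`. -/
def Emits (x : List Bool) (H : ℕ) (p : Prog (Flags M) (Reg M.T)) (σ : Reg M.T → ℕ)
    (b : List Bool) : Prop :=
  ∀ (f : Flags M) (l : List Bool) (a : ℕ), f.bit = l[a]? →
    Exec x (idx : Reg M.T) H p f (update σ A (a - l.length)) { f with bit := (l ++ b)[a]? }
      (update σ A (a - (l ++ b).length))

/-- The three cases are: the wanted bit has been found before, it is this one, or it comes later.
The truncated counter vanishes in the first two, which are told apart by the flag `bit`. -/
lemma emits_emit (g : Option Bool → Bool) {b : Bool} (hb : g x[σ idx]? = b) :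
    Emits x H (emit g) σ [b] := by
  intro f l a hf
  rcases lt_trichotomy a l.length with h | rfl | h
  · refine (Exec.ite_true ?_ exec_skip).congr ?_ ?_
    · simp [hf, h]
    · rw [List.getElem?_append_left h, ← hf]
    · congr 1
      simp
      omega
  · refine (Exec.ite_false ?_ (Exec.ifnz_zero (by simp) (Exec.upd _ _ _))).congr ?_ ?_
    · simp [hf]
    · simp [hb]
    · simp
  · refine (Exec.ite_false ?_ (Exec.ifnz_pos (by simp; omega) (Exec.dec _ (by simp; omega)))).congr
      ?_ ?_
    · simp [hf, h.le]
    · rw [List.getElem?_eq_none (by simpa using h), ← List.getElem?_eq_none h.le, ← hf]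
    · simp [Nat.sub_sub]

/-- Because the list `l` of bits already produced is arbitrary in `Emits`, the pieces of an input
can be chained. -/
lemma Emits.seq {p q : Prog (Flags M) (Reg M.T)} {b c : List Bool} (hp : Emits x H p σ b)
    (hq : Emits x H q σ c) : Emits x H (.seq p q) σ (b ++ c) := by
  intro f l a hf
  have := (hp f l a hf).seq (hq _ (l ++ b) a rfl)
  rwa [List.append_assoc] at this

lemma Emits.for' {i c n : Var} (h : [i, c, n, A, s1].Nodup) (hz : Zeros σ [i, c, s1])
    {p : Prog (Flags M) (Reg M.T)} {b : ℕ → List Bool} (hn : σ n < 2 ^ H)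
    (hp : ∀ m < σ n, Emits x H p (update (update σ c (σ n - m - 1)) i m) (b m)) :
    Emits x H (for' i c n s1 p) σ ((List.range (σ n)).flatMap b) := by
  intro f l a hf
  simp only [List.nodup_cons, List.mem_cons, List.not_mem_nil, or_false, not_or, List.nodup_nil,
    not_false_eq_true, and_true] at h
  simp only [Zeros, List.mem_cons, List.not_mem_nil, or_false, forall_eq_or_imp, forall_eq] at hz
  obtain ⟨⟨h₁, h₂, h₃, h₄⟩, ⟨h₅, h₆, h₇⟩, ⟨h₈, h₉⟩, h₀⟩ := h
  obtain ⟨z₁, z₂, z₃⟩ := hz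
  have := exec_for (x := x) (ι := (idx : Reg M.T)) (H := H) (i := (i : Reg M.T)) (c := c) (n := n)
    (t := s1) (p := p) (by simpa) (by simpa) (by simpa) (by simpa)
    (fun m => { f with bit := (l ++ (List.range m).flatMap b)[a]? })
    (fun m => update σ A (a - (l ++ (List.range m).flatMap b).length)) (by simp [z₃])
    (a := σ n) (by simp [h₈]) hn (by simp [h₆, z₂]) (by simp [h₃, z₁]) (fun m hm => ?_)
  · simpa [← hf] using this
  · have := hp m hm { f with bit := (l ++ (List.range m).flatMap b)[a]? }
      (l ++ (List.range m).flatMap b) a rfl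
    simp only [List.append_assoc] at this
    have hr : (List.range (m + 1)).flatMap b = (List.range m).flatMap b ++ b m := by
      simp [List.range_succ]
    rw [hr]
    convert this using 1
    · rw [Function.update_comm (a := Sum.inr i) (b := Sum.inr A) (by simpa),
        Function.update_comm (a := Sum.inr c) (b := Sum.inr A) (by simpa)]
    · rw [Function.update_comm (a := Sum.inr i) (b := Sum.inr A) (by simpa),
        Function.update_comm (a := Sum.inr c) (b := Sum.inr A) (by simpa)]

/-- The adjacency of `a` and `b`, with the vertices `0` and `u` exchanged, in the graph that is
encoded by `x`. -/
def swapAdj (x : List Bool) (N k u a b : ℕ) : Bool :=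
  x[entryPos N k (swapZero u a) (swapZero u b)]? == some true

/-- The bits of the simulated input. -/
def simInput (x : List Bool) (N k u y : ℕ) : List Bool :=
  (List.range N).flatMap (fun _ => [true]) ++ ([false] ++ ((List.range k).flatMap (fun _ => [true])
    ++ ([false] ++ ((List.range N).flatMap (fun a => (List.range N).flatMap fun b =>
      [swapAdj x N k u a b]) ++ ((List.range y).flatMap (fun _ => [true]) ++ [true])))))

/-- Produce the entry of the adjacency matrix for `i` and `j`, with `0` and `u` exchanged. -/
def emitEntry : Prog (Flags M) (Reg M.T) :=
  .seq (locate i j) (.seq (emit fun a => a == some true) (clear idx))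

lemma emits_emitEntry (hz : Zeros σ [idx, si, sj, s1, s2, s3, s4])
    (hB : (σ N + σ k + σ u + 4) ^ 2 + (σ i + σ j) * (σ N + 1) < 2 ^ H) :
    Emits x H emitEntry σ [swapAdj x (σ N) (σ k) (σ u) (σ i) (σ j)] := by
  intro f l a hf
  refine Exec.seq (exec_locate (by simp) (by simp) ?_ (by simpa using hB)) <|
    Exec.seq (f₁ := { f with bit := (l ++ [swapAdj x (σ N) (σ k) (σ u) (σ i) (σ j)])[a]? })
      (σ₁ := update (update σ idx (entryPos (σ N) (σ k) (swapZero (σ u) (σ i))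
        (swapZero (σ u) (σ j)))) A (a - (l.length + 1))) ?_ ((exec_clear _).congr rfl ?_)
  · intro n hn
    have := hz n hn
    simp only [List.mem_cons, List.not_mem_nil, or_false] at hn
    rcases hn with rfl | rfl | rfl | rfl | rfl | rfl | rfl <;> simpa using this
  · rw [Function.update_comm (by simp)]
    simpa using emits_emit (H := H) (fun a => a == some true) (σ := update σ idx (entryPos (σ N) (σ k)
      (swapZero (σ u) (σ i)) (swapZero (σ u) (σ j)))) (b := swapAdj x (σ N) (σ k) (σ u) (σ i) (σ j))
      (by simp [swapAdj]) f l a hf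
  · have := hz idx (by simp)
    rw [Function.update_comm (by simp), Function.update_idem, ← this, Function.update_eq_self]
    simp

/-- Produce the simulated input. -/
def generate : Prog (Flags M) (Reg M.T) :=
  .seq (for' i ci N s1 (emit fun _ => true)) (.seq (emit fun _ => false)
    (.seq (for' i ci k s1 (emit fun _ => true)) (.seq (emit fun _ => false)
      (.seq (for' i ci N s1 (for' j cj N s1 emitEntry)) (.seq (for' i ci y s1 (emit fun _ => true))
        (emit fun _ => true))))))

/-- Read the bit with address `A` of the simulated input. -/
def fetch : Prog (Flags M) (Reg M.T) := .seq generate (clear A)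

/-- The simulated input is too long to be stored in logarithmic space. Each read produces all of it
anew and keeps only the bit with address `A`; clearing `A` at the end matters for addresses beyond
the end. -/
lemma exec_fetch (hz : Zeros σ [idx, i, j, si, sj, s1, s2, s3, s4, ci, cj])
    (hB : (σ N + σ k + σ u + σ y + 4) ^ 2 + 2 * σ N * (σ N + 1) < 2 ^ H) (hf : f.bit = none) :
    Exec x (idx : Reg M.T) H fetch f σ
      { f with bit := (simInput x (σ N) (σ k) (σ u) (σ y))[σ A]? } (update σ A 0) := by
  have hz' : ∀ n ∈ [idx, i, j, si, sj, s1, s2, s3, s4, ci, cj], σ (.inr n) = 0 := hz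
  simp only [List.mem_cons, List.not_mem_nil, or_false, forall_eq_or_imp, forall_eq] at hz'
  obtain ⟨z₁, z₂, z₃, z₄, z₅, z₆, z₇, z₈, z₉, z₁₀, z₁₁⟩ := hz'
  have hsum : σ N + σ k + σ u + σ y < 2 ^ H := by nlinarith
  have h : Emits x H generate σ (simInput x (σ N) (σ k) (σ u) (σ y)) :=
    (Emits.for' (i := i) (c := ci) (n := N) (by simp) (by simp [Zeros, *]) (by omega)
      fun m _ => emits_emit (fun _ => true) rfl).seq <|
    (emits_emit (fun _ => false) rfl).seq <|
    (Emits.for' (i := i) (c := ci) (n := k) (by simp) (by simp [Zeros, *]) (by omega)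
      fun m _ => emits_emit (fun _ => true) rfl).seq <|
    (emits_emit (fun _ => false) rfl).seq <|
    (Emits.for' (i := i) (c := ci) (n := N) (by simp) (by simp [Zeros, *]) (by omega)
      fun m hm => ?_).seq <|
    (Emits.for' (i := i) (c := ci) (n := y) (by simp) (by simp [Zeros, *]) (by omega)
      fun m _ => emits_emit (fun _ => true) rfl).seq <|
    (emits_emit (fun _ => true) rfl)
  · have := (h f [] (σ A) (by simpa using hf)).seq (exec_clear (A : Reg M.T))
    simpa [fetch] using this
  · have := Emits.for' (x := x) (H := H) (σ := update (update σ ci (σ N - m - 1)) i m) (i := j)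
      (c := cj) (n := N) (p := emitEntry) (b := fun b => [swapAdj x (σ N) (σ k) (σ u) m b]) (by simp)
      (by simp [Zeros, *]) (by simp; omega) fun m' hm' => ?_
    · simpa using this
    · have := emits_emitEntry (x := x) (H := H) (σ := update (update (update (update σ ci (σ N - m - 1))
        i m) cj (σ N - m' - 1)) j m') (by simp [Zeros, *]) ?_
      · simpa using this
      · simp at hm'
        -- Both indices are below `σ N`; this is the source of the second summand in `hB`.
        have : (m + m') * (σ N + 1) ≤ 2 * σ N * (σ N + 1) := by gcongr; omega
        simp
        nlinarith

end Prog
end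

noncomputable section

namespace Prog

open Function (update)
open Var

/-! ### Tapes as numbers in base three -/

/-- The digit for a tape symbol. -/
def code : Option Bool → ℕ
  | none => 0
  | some false => 1
  | some true => 2

/-- The tape symbol for the last digit of a number. -/
def symOf (v : ℕ) : Option Bool := if v % 3 = 0 then none else some (v % 3 == 2)

/-- The successor of a digit modulo three. -/
def succSym : Option Bool → Option Bool
  | none => some false
  | some false => some true
  | some true => none

lemma symOf_succ (v : ℕ) : symOf (v + 1) = succSym (symOf v) := by
  have : v % 3 = 0 ∨ v % 3 = 1 ∨ v % 3 = 2 := by omega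
  rcases this with h | h | h <;> simp [symOf, succSym, Nat.add_mod, h]

lemma symOf_eq_true {v : ℕ} : symOf v = some true ↔ v % 3 = 2 := by
  simp only [symOf]; split_ifs <;> simp <;> omega

lemma symOf_push (v : ℕ) (a : Option Bool) : symOf (3 * v + code a) = a := by
  rcases a with _ | _ | _ <;> simp [symOf, code, Nat.add_mod]

lemma code_le (a : Option Bool) : code a ≤ 2 := by
  rcases a with _ | _ | _ <;> simp [code]

/-- The digits of `v`, from the last one on, are those of the sequence `g`. -/
def Enc (g : ℕ → Option Bool) (v : ℕ) : Prop := ∀ i, symOf (v / 3 ^ i) = g i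

lemma enc_zero : Enc (fun _ => none) 0 := fun i => by simp [symOf]

lemma Enc.symOf {g : ℕ → Option Bool} {v : ℕ} (h : Enc g v) : symOf v = g 0 := by
  simpa using h 0

lemma Enc.pop {g : ℕ → Option Bool} {v : ℕ} (h : Enc g v) : Enc (fun i => g (i + 1)) (v / 3) :=
  fun i => by rw [Nat.div_div_eq_div_mul, ← pow_succ']; exact h _

lemma Enc.push {g g' : ℕ → Option Bool} {v : ℕ} (h : Enc g v) (hg : ∀ i, g' (i + 1) = g i) :
    Enc g' (3 * v + code (g' 0)) := by
  intro i
  cases i with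
  | zero => simpa using symOf_push v (g' 0)
  | succ i =>
    have := code_le (g' 0)
    rw [pow_succ', ← Nat.div_div_eq_div_mul, hg, ← h i]
    congr 2
    omega

lemma eq_zero_of_enc {v : ℕ} (h : Enc (fun _ => none) v) : v = 0 := by
  induction v using Nat.strong_induction_on with
  | _ v ih =>
    by_contra hv
    have h₀ := h.symOf
    have h₁ := ih (v / 3) (by omega) h.pop
    simp only [Prog.symOf] at h₀
    split_ifs at h₀
    omega

/-- As the blank has digit zero, the unused part of a tape consists of leading zeros. A tape with
O(log n) cells in use is therefore a polynomially bounded number. -/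
lemma Enc.lt {g : ℕ → Option Bool} {v : ℕ} (h : Enc g v) {n : ℕ} (hg : ∀ i, n ≤ i → g i = none) :
    v < 3 ^ n := by
  have : v / 3 ^ n = 0 := eq_zero_of_enc fun i => by
    rw [Nat.div_div_eq_div_mul, ← pow_add, h, hg _ (by omega)]
  exact (Nat.div_eq_zero_iff_lt (by positivity)).1 this

variable {M : RATM} {x : List Bool} {H : ℕ} {f : Flags M} {σ : Reg M.T → ℕ}

/-- Remove the last digit of the register `X` and store it in a flag. -/
def pop (X : Reg M.T) : Prog (Flags M) (Reg M.T) :=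
  .seq (.loop X (.seq (.ite (fun f => f.d = some true) (.inc s1) skip)
    (.upd fun f _ => { f with d := succSym f.d }))) (drain s1 X)

/-- Division by three by counting: the flag `d` holds the residue of the number of rounds, and `s1`
grows whenever it wraps around. The flag must start at `none`, the residue zero. -/
lemma exec_pop {X : Reg M.T} (hX : X ≠ s1) (hd : f.d = none) (h₁ : σ s1 = 0) (hH : σ X < 2 ^ H) :
    Exec x (idx : Reg M.T) H (pop X) f σ { f with d := symOf (σ X) } (update σ X (σ X / 3)) := by
  refine Exec.seq (f₁ := { f with d := symOf (σ X) })
    (σ₁ := update (update σ X 0) s1 (σ X / 3)) ?_ ((exec_drain hX.symm ?_).congr rfl ?_)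
  · refine exec_loop (σ X) (fun m => { f with d := symOf m })
      (fun m => update (update σ X (σ X - m)) s1 (m / 3)) ?_ ?_ rfl (by simp) (by simp [hX])
      fun m hm => Exec.seq (f₁ := { f with d := symOf m })
        (σ₁ := update (update σ X (σ X - (m + 1))) s1 ((m + 1) / 3)) ?_ ?_
    · simp [← hd, symOf]
    · funext z
      simp only [Function.update_apply]
      split_ifs <;> simp_all
    · by_cases h : symOf m = some true
      · have h2 := symOf_eq_true.1 h
        refine (Exec.ite_true (by simp [h]) (Exec.inc _ ?_)).congr rfl ?_
        · simp [hX.symm]; omega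
        · funext z
          simp only [Function.update_apply]
          split_ifs <;> simp_all <;> omega
      · have h2 := mt symOf_eq_true.2 h
        refine (Exec.ite_false (by simp [h]) exec_skip).congr rfl ?_
        funext z
        simp only [Function.update_apply]
        split_ifs <;> simp_all <;> omega
    · refine (Exec.upd _ _ _).congr ?_ rfl
      simp [symOf_succ]
  · simp [hX]; omega
  · funext z
    simp only [Function.update_apply]
    split_ifs <;> simp_all

/-- Append the digit that is selected by `g` to the register `X`. -/
def push (X : Reg M.T) (g : Flags M → Option Bool) : Prog (Flags M) (Reg M.T) :=
  .seq (.loop X (.seq (.inc s1) (.seq (.inc s1) (.inc s1)))) <| .seq (drain s1 X) <|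
    .ite (fun f => g f = none) skip
      (.seq (.inc X) (.ite (fun f => g f = some false) skip (.inc X)))

lemma exec_push {X : Reg M.T} (g : Flags M → Option Bool) (hX : X ≠ s1) (h₁ : σ s1 = 0)
    (hH : 3 * σ X + 2 < 2 ^ H) :
    Exec x (idx : Reg M.T) H (push X g) f σ f (update σ X (3 * σ X + code (g f))) := by
  refine Exec.seq (f₁ := f) (σ₁ := update (update σ X 0) s1 (3 * σ X)) ?_
    (Exec.seq (f₁ := f) (σ₁ := update σ X (3 * σ X)) ((exec_drain hX.symm ?_).congr rfl ?_) ?_)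
  · refine exec_loop (σ X) (fun m => f)
      (fun m => update (update σ X (σ X - m)) s1 (3 * m)) rfl ?_ rfl (by simp) (by simp [hX])
      fun m hm => Exec.seq (Exec.inc _ ?_) (Exec.seq (Exec.inc _ ?_) (Exec.inc _ ?_)) |>.congr rfl ?_
    · funext z
      simp only [Function.update_apply]
      split_ifs <;> simp_all
    · simp [hX.symm]; omega
    · simp [hX.symm]; omega
    · simp [hX.symm]; omega
    · funext z
      simp only [Function.update_apply]
      split_ifs <;> simp_all <;> omega
  · simp [hX]; omega
  · funext z
    simp only [Function.update_apply]
    split_ifs <;> simp_all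
  · rcases hg : g f with _ | _ | _
    · exact Exec.ite_true (by simp [hg]) exec_skip
    · refine Exec.ite_false (by simp [hg]) (Exec.seq (Exec.inc _ ?_)
        (Exec.ite_true (by simp [hg]) exec_skip)) |>.congr rfl ?_
      · simp; omega
      · simp [code]
    · refine Exec.ite_false (by simp [hg]) (Exec.seq (Exec.inc _ ?_)
        (Exec.ite_false (by simp [hg]) (Exec.inc _ ?_))) |>.congr rfl ?_
      · simp; omega
      · simp; omega
      · simp [code]

/-- A loop that goes on as long as its body sets the register `r` to one. -/
lemma exec_while {F R : Type} [DecidableEq R] {ι r : R} {p : Prog F R} {f : F} {σ : R → ℕ} {n : ℕ}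
    (Inv : ℕ → F → (R → ℕ) → Prop) (Post : F → (R → ℕ) → Prop) (h₀ : Inv 0 f σ) (hr : σ r = 0)
    (h : ∀ m < n, ∀ f σ, Inv m f σ → σ r = 0 → ∃ f' σ', Exec x ι H p f σ f' (update σ' r 1) ∧
      σ' r = 0 ∧ Inv (m + 1) f' σ')
    (hn : ∀ f σ, Inv n f σ → σ r = 0 → ∃ f' σ', Exec x ι H p f σ f' σ' ∧ σ' r = 0 ∧ Post f' σ') :
    ∃ f' σ', Exec x ι H (.loop r p) f (update σ r 1) f' σ' ∧ Post f' σ' := by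
  suffices ∀ j ≤ n, ∀ f σ, Inv (n - j) f σ → σ r = 0 →
      ∃ f' σ', Exec x ι H (.loop r p) f (update σ r 1) f' σ' ∧ Post f' σ' from
    this n le_rfl f σ (by simpa using h₀) hr
  have key : ∀ (σ : R → ℕ), σ r = 0 →
      update (update σ r 1) r (update σ r 1 r - 1) = σ := by
    intro σ hσ
    simp [← hσ]
  intro j
  induction j with
  | zero =>
    intro _ f σ hI hσ
    obtain ⟨f', σ', he, hσ', hP⟩ := hn f σ hI hσ
    refine ⟨f', σ', Exec.loop_succ (by simp) ?_ (Exec.loop_zero _ hσ'), hP⟩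
    rwa [key σ hσ]
  | succ j ih =>
    intro hj f σ hI hσ
    obtain ⟨f₁, σ₁, he, hσ₁, hI₁⟩ := h _ (by omega) f σ hI hσ
    have : n - (j + 1) + 1 = n - j := by omega
    rw [this] at hI₁
    obtain ⟨f₂, σ₂, he₂, hP⟩ := ih (by omega) f₁ σ₁ hI₁ hσ₁
    refine ⟨f₂, σ₂, Exec.loop_succ (by simp) ?_ he₂, hP⟩
    rwa [key σ hσ]

/-- Compute in `A` the address that is written on the index tape of the simulated machine. -/
def addr : Prog (Flags M) (Reg M.T) :=
  .seq (copy Y (.inl (M.index, true)) s1) <| .seq (.inc pow) <| .seq (.inc go) <|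
  .seq (.loop go <| .seq (pop Y) <|
    .seq (.ite (fun f => f.d = none) skip <|
      .seq (.ite (fun f => f.d = some true) (addTo A pow s1) skip) <|
      .seq (copy s2 pow s1) <| .seq (drain s2 pow) (.inc go)) <|
    .upd fun f _ => { f with d := none }) <|
  .seq (clear Y) (clear pow)

/-- The digits are popped from a copy `Y` of the index tape up to the first blank, at position `n`.
The register `pow` reaches `2 ^ n` and the partial sums stay below it, which explains the last
bound. -/
lemma exec_addr {g : ℕ → Option Bool} (hg : Enc g (σ (.inl (M.index, true)))) {n : ℕ}
    (hn : g n = none) (hn' : ∀ i < n, g i ≠ none)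
    (hz : Zeros σ [A, pow, Y, go, s1, s2]) (hd : f.d = none)
    (h₁ : σ (.inl (M.index, true)) < 2 ^ H) (h₂ : 2 ^ (n + 1) < 2 ^ H) :
    Exec x (idx : Reg M.T) H addr f σ f
      (update σ A (∑ i ∈ Finset.range n, if g i = some true then 2 ^ i else 0)) := by
  simp only [Zeros, List.mem_cons, List.not_mem_nil, or_false, forall_eq_or_imp, forall_eq] at hz
  obtain ⟨z₁, z₂, z₃, z₄, z₅, z₆⟩ := hz
  set v := σ (.inl (M.index, true)) with hv
  set S : ℕ → ℕ := fun m => ∑ i ∈ Finset.range m, if g i = some true then 2 ^ i else 0 with hS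
  have hSlt : ∀ m, S m < 2 ^ m := by
    intro m
    induction m with
    | zero => simp [hS]
    | succ m ih =>
      have : S (m + 1) = S m + if g m = some true then 2 ^ m else 0 := Finset.sum_range_succ ..
      rw [this, pow_succ]
      split_ifs <;> omega
  have hpow : ∀ m ≤ n, 2 ^ m ≤ 2 ^ n := fun m hm => Nat.pow_le_pow_right (by norm_num) hm
  have hpos : 0 < 2 ^ n := by positivity
  rw [pow_succ] at h₂
  have hdiv : ∀ m, v / 3 ^ m < 2 ^ H := fun m => (Nat.div_le_self _ _).trans_lt h₁
  have hf : { f with d := none } = f := by rw [← hd]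
  -- Only the loop needs an invariant: after `m` digits `Y` is `v / 3 ^ m`, `pow` is `2 ^ m` and `A`
  -- is the partial sum. The terminating blank is popped too, hence the extra division by three.
  suffices hw : ∃ f' σ', Exec x (idx : Reg M.T) H (.loop go <| .seq (pop Y) <|
      .seq (.ite (fun f => f.d = none) skip <|
        .seq (.ite (fun f => f.d = some true) (addTo A pow s1) skip) <|
        .seq (copy s2 pow s1) <| .seq (drain s2 pow) (.inc go)) <|
      .upd fun f _ => { f with d := none }) f (update (update (update σ Y v) pow 1) go 1) f' σ' ∧
      (f' = f ∧ σ' = update (update (update σ Y (v / 3 ^ n / 3)) pow (2 ^ n)) A (S n)) by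
    have h1 : 1 < 2 ^ H := by omega
    obtain ⟨f', σ', he, hf', hσ'⟩ := hw
    rw [hf', hσ'] at he
    refine Exec.seq (exec_copy (ht := z₅) (hH := h₁)) <| Exec.seq (Exec.inc _ ?_) <|
      Exec.seq (Exec.inc _ ?_) <| Exec.seq (f₁ := f)
      (σ₁ := update (update (update σ Y (v / 3 ^ n / 3)) pow (2 ^ n)) A (S n)) ?_ <|
      Exec.seq (exec_clear _) (exec_clear _) |>.congr rfl ?_
    · simpa [z₂] using h1
    · simpa [z₄] using h1
    · convert he using 1
      funext z
      simp only [Function.update_apply]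
      split_ifs <;> simp_all
    · funext z
      simp only [Function.update_apply]
      split_ifs <;> simp_all
  refine exec_while (n := n)
    (fun m f' σ' => f' = f ∧
      σ' = update (update (update σ Y (v / 3 ^ m)) pow (2 ^ m)) A (S m)) _ ?_ ?_ ?_ ?_
  · refine ⟨rfl, ?_⟩
    have hS₀ : S 0 = 0 := rfl
    funext z
    simp only [Function.update_apply, hS₀]
    split_ifs <;> simp_all
  · simp [z₄]
  · rintro m hm f₁ _ ⟨hf₁, rfl⟩ _
    rw [hf₁]
    have hp := hpow (m + 1) (by omega)
    rw [pow_succ] at hp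
    have hsym : symOf (v / 3 ^ m) = g m := hg m
    refine ⟨f, _, Exec.seq (exec_pop (by simp) hd ?_ ?_) <| Exec.seq
      (Exec.ite_false ?_ <| Exec.seq (f₁ := { f with d := g m })
        (σ₁ := update (update (update σ Y (v / 3 ^ (m + 1))) pow (2 ^ m)) A (S (m + 1))) ?_ <|
        Exec.seq (exec_copy (ht := ?_) (hH := ?_)) <| Exec.seq (exec_drain (hH := ?_)) <|
        Exec.inc _ ?_) <|
      (Exec.upd _ _ _).congr ?_ ?_, ?_, rfl, rfl⟩
    · simp [z₅]
    · simpa using hdiv m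
    · simpa [hsym] using hn' m hm
    · have hS' : S (m + 1) = S m + if g m = some true then 2 ^ m else 0 := Finset.sum_range_succ ..
      have := hSlt m
      have hd₃ : v / 3 ^ (m + 1) = v / 3 ^ m / 3 := by rw [pow_succ, Nat.div_div_eq_div_mul]
      by_cases hgm : g m = some true
      · refine (Exec.ite_true ?_ (exec_addTo (ht := ?_) (hH := ?_))).congr ?_ ?_
        · simp [hsym, hgm]
        · simp [z₅]
        · simp; omega
        · simp [hsym]
        · rw [hS', hd₃]
          funext z
          by_cases hA : z = Sum.inr A
          · subst hA; simp [hgm]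
          · by_cases hY : z = Sum.inr Y
            · subst hY; simp
            · simp [Function.update_apply, hA, hY]
      · refine (Exec.ite_false ?_ exec_skip).congr ?_ ?_
        · simp [hsym, hgm]
        · simp [hsym]
        · rw [hS', hd₃]
          funext z
          by_cases hA : z = Sum.inr A
          · subst hA; simp [hgm]
          · by_cases hY : z = Sum.inr Y
            · subst hY; simp
            · simp [Function.update_apply, hA, hY]
    · simp [z₅]
    · have : 2 ^ m < 2 ^ H := by omega
      simpa using this
    · simp; omega
    · have : 1 < 2 ^ H := by omega
      simpa [z₄] using this
    · exact hf
    · funext z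
      simp only [Function.update_apply]
      split_ifs <;> simp_all [pow_succ] <;> omega
    · simp [z₄]
  · rintro f₁ _ ⟨hf₁, rfl⟩ _
    rw [hf₁]
    have hsym : symOf (v / 3 ^ n) = none := (hg n).trans hn
    refine ⟨f, _, Exec.seq (exec_pop (by simp) hd ?_ ?_) <| Exec.seq
      (Exec.ite_true ?_ exec_skip) <| (Exec.upd _ _ _).congr ?_ ?_, ?_, rfl, rfl⟩
    · simp [z₅]
    · simpa using hdiv n
    · simp [hsym]
    · exact hf
    · funext z
      simp only [Function.update_apply]
      split_ifs <;> simp_all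
    · simp [z₄]

end Prog
end

noncomputable section

instance (M : RATM) : DecidableEq M.T := Classical.decEq _

instance (M : RATM) : Fintype M.T := @Fintype.ofFinite _ M.finiteT

namespace Prog

open Function (update)
open Var

variable {M : RATM} {x : List Bool} {H : ℕ} {f : Flags M} {σ : Reg M.T → ℕ}

/-! ### One step of the simulated machine -/

/-- States are indexed by the set of tapes already treated, so the unspecified order of the list of
tapes plays no role. -/
lemma exec_seqs {ι : Reg M.T} (P : M.T → Prog (Flags M) (Reg M.T)) (φ : Finset M.T → Flags M)
    (τ : Finset M.T → Reg M.T → ℕ)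
    (h : ∀ s t, t ∉ s → Exec x ι H (P t) (φ s) (τ s) (φ (insert t s)) (τ (insert t s)))
    (l : List M.T) (hl : l.Nodup) (s : Finset M.T) (hs : ∀ t ∈ l, t ∉ s) :
    Exec x ι H (seqs (l.map P)) (φ s) (τ s) (φ (s ∪ l.toFinset)) (τ (s ∪ l.toFinset)) := by
  induction l generalizing s with
  | nil => simpa [seqs] using exec_skip
  | cons t l ih =>
    rw [List.nodup_cons] at hl
    have := ih hl.2 (insert t s) (by
      intro t' ht'
      rw [Finset.mem_insert, not_or]
      exact ⟨fun h => hl.1 (h ▸ ht'), hs t' (by simp [ht'])⟩)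
    rw [Finset.insert_union, ← Finset.union_insert, ← List.toFinset_cons] at this
    exact Exec.seq (h s t (hs t (by simp))) this

/-- Run a program for each tape of the simulated machine. -/
def forTapes (P : M.T → Prog (Flags M) (Reg M.T)) : Prog (Flags M) (Reg M.T) :=
  seqs (Finset.univ.toList.map P)

lemma exec_forTapes {ι : Reg M.T} (P : M.T → Prog (Flags M) (Reg M.T)) (φ : Finset M.T → Flags M)
    (τ : Finset M.T → Reg M.T → ℕ)
    (h : ∀ s t, t ∉ s → Exec x ι H (P t) (φ s) (τ s) (φ (insert t s)) (τ (insert t s))) :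
    Exec x ι H (forTapes P) (φ ∅) (τ ∅) (φ Finset.univ) (τ Finset.univ) := by
  rw [forTapes]
  simpa using exec_seqs P φ τ h _ (Finset.nodup_toList _) ∅ (by simp)

/-- Change the tape registers for the tapes in `s`. -/
def setTapes (σ : Reg M.T → ℕ) (w : M.T → Bool → ℕ) (s : Finset M.T) : Reg M.T → ℕ
  | .inl p => if p.1 ∈ s then w p.1 p.2 else σ (.inl p)
  | .inr n => σ (.inr n)

@[simp] lemma setTapes_empty (w : M.T → Bool → ℕ) : setTapes σ w ∅ = σ := by
  funext z; cases z <;> simp [setTapes]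

@[simp] lemma setTapes_inr (w : M.T → Bool → ℕ) (s : Finset M.T) (n : Var) :
    setTapes σ w s (.inr n) = σ (.inr n) := rfl

lemma setTapes_inl_of_notMem (w : M.T → Bool → ℕ) {s : Finset M.T} {t : M.T} (ht : t ∉ s)
    (b : Bool) : setTapes σ w s (.inl (t, b)) = σ (.inl (t, b)) := by simp [setTapes, ht]

@[simp] lemma setTapes_univ_inl (w : M.T → Bool → ℕ) (t : M.T)
    (b : Bool) : setTapes σ w Finset.univ (.inl (t, b)) = w t b := by simp [setTapes]

lemma setTapes_insert (w : M.T → Bool → ℕ) (s : Finset M.T) (t : M.T) :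
    setTapes σ w (insert t s) =
      update (update (setTapes σ w s) (.inl (t, false)) (w t false)) (.inl (t, true)) (w t true) := by
  funext z
  rcases z with ⟨t', b⟩ | n
  · by_cases h : t' = t
    · subst h; cases b <;> simp [setTapes]
    · simp [setTapes, h]
  · simp [setTapes]

/-- Pop the symbol under the head of the tape `t`. -/
def readTape (t : M.T) : Prog (Flags M) (Reg M.T) :=
  .seq (pop (.inl (t, true))) (.upd fun f _ => { f with sym := update f.sym t f.d, d := none })

lemma exec_readTapes (hs : f.sym = fun _ => none) (hd : f.d = none) (h₁ : σ s1 = 0)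
    (hH : ∀ t, σ (.inl (t, true)) < 2 ^ H) :
    Exec x (idx : Reg M.T) H (forTapes readTape) f σ
      { f with sym := fun t => symOf (σ (.inl (t, true))) }
      (setTapes σ (fun t b => if b then σ (.inl (t, true)) / 3 else σ (.inl (t, false)))
        Finset.univ) := by
  set w : M.T → Bool → ℕ := fun t b => if b then σ (.inl (t, true)) / 3 else σ (.inl (t, false))
  have := exec_forTapes (x := x) (H := H) (ι := (idx : Reg M.T)) readTape
    (fun s => { f with sym := fun t => if t ∈ s then symOf (σ (.inl (t, true))) else none })
    (setTapes σ w) (fun s t ht => ?_)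
  · simpa [← hs] using this
  · refine Exec.seq (exec_pop (by simp) hd (by simpa using h₁) ?_) ((Exec.upd _ _ _).congr ?_ ?_)
    · simpa [setTapes_inl_of_notMem w ht] using hH t
    · simp only [setTapes_inl_of_notMem w ht, hd, Flags.mk.injEq, true_and, and_true]
      funext t'
      by_cases h : t' = t
      · subst h; simp
      · simp [h]
    · rw [setTapes_insert, setTapes_inl_of_notMem w ht]
      have : update (setTapes σ w s) (.inl (t, false)) (w t false) = setTapes σ w s := by
        rw [Function.update_eq_self_iff, setTapes_inl_of_notMem w ht]
        simp [w]
      rw [this]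
      simp [w]

/-- The numbers for a tape after a symbol `a` is written and the head is moved by `m`, if they were
`l` and `r` after the symbol under the head had been removed. -/
def moved (m : SignType) (a : Option Bool) (l r : ℕ) : Bool → ℕ
  | false => if m = 1 then 3 * l + code a else if m = -1 then l / 3 else l
  | true => if m = 1 then r else if m = -1 then 3 * (3 * r + code a) + code (symOf l) else
      3 * r + code a

/-- The two numbers are stacks that meet at the head. After a move to the right the written symbol
is on top of the left stack; after a move to the left it lies in the right one, below the symbol
popped from the left. -/
lemma enc_moved {g : ℤ → Option Bool} {p : ℤ} (m : SignType) (a : Option Bool) {l r : ℕ}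
    (hr : Enc (fun i => g (p + i)) r) (hl : Enc (fun i => g (p - 1 - i)) l) :
    Enc (fun i => update g p a (p + m + i)) (moved m a l (r / 3) true) ∧
      Enc (fun i => update g p a (p + m - 1 - i)) (moved m a l (r / 3) false) := by
  have h₀ : Enc (fun i => update g p a (p + i)) (3 * (r / 3) + code a) := by
    have := hr.pop.push (g' := fun i => update g p a (p + i)) fun i => by
      rw [Function.update_of_ne (by omega)]
    simpa using this
  have h₁ : Enc (fun i => update g p a (p - 1 - i)) l := by
    convert hl using 2 with i
    rw [Function.update_of_ne (by omega)]
  -- The cases are, in this order: stay, left, right.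
  rcases m with _ | _ | _
  · simp only [moved]
    constructor
    · simpa using h₀
    · simpa using h₁
  · simp only [moved]
    constructor
    · have h := h₀.push (g' := fun i => update g p a (p + (-1) + i)) fun i => by
        congr 1; push_cast; ring
      have hs : g (p + -1) = symOf l := by
        rw [hl.symOf]; simp; rfl
      simpa [hs] using h
    · have h := h₁.pop
      have he : (fun i : ℕ => update g p a (p - 1 - ((i + 1 : ℕ) : ℤ))) =
          fun i : ℕ => update g p a (p + ((-1 : SignType) : ℤ) - 1 - i) := by
        funext i; congr 1; push_cast; simp; ring
      rw [he] at h
      simpa using h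
  · simp only [moved]
    constructor
    · have h := hr.pop
      have he : (fun i : ℕ => g (p + ((i + 1 : ℕ) : ℤ))) =
          fun i : ℕ => update g p a (p + ((1 : SignType) : ℤ) + i) := by
        funext i
        rw [Function.update_of_ne (by simp; omega)]
        congr 1; push_cast; simp; ring
      rw [he] at h
      simpa using h
    · have h := h₁.push (g' := fun i => update g p a (p + 1 - 1 - i)) fun i => by
        congr 1; push_cast; ring
      simpa using h

/-- Write on the tape `t` and move its head. -/
def writeTape (t : M.T) : Prog (Flags M) (Reg M.T) :=
  .ite (fun f => f.mv t = 1) (push (.inl (t, false)) fun f => f.wr t) <|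
    .seq (push (.inl (t, true)) fun f => f.wr t) <|
      .ite (fun f => f.mv t = -1) (.seq (pop (.inl (t, false))) <|
        .seq (push (.inl (t, true)) fun f => f.d) <| .upd fun f _ => { f with d := none }) skip

/-- Moving left pushes two digits onto the right number, which gives 3(3r + 2) + 2 = 9r + 8 in the
bound. -/
lemma exec_writeTape {t : M.T} (hd : f.d = none) (h₁ : σ s1 = 0)
    (hl : 3 * σ (.inl (t, false)) + 2 < 2 ^ H) (hr : 9 * σ (.inl (t, true)) + 8 < 2 ^ H) :
    Exec x (idx : Reg M.T) H (writeTape t) f σ f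
      (update (update σ (.inl (t, false))
        (moved (f.mv t) (f.wr t) (σ (.inl (t, false))) (σ (.inl (t, true))) false))
        (.inl (t, true))
        (moved (f.mv t) (f.wr t) (σ (.inl (t, false))) (σ (.inl (t, true))) true)) := by
  by_cases hp : f.mv t = 1
  · refine (Exec.ite_true (by simp [hp]) (exec_push _ (by simp) h₁ hl)).congr rfl ?_
    have h' : moved 1 (f.wr t) (σ (.inl (t, false))) (σ (.inl (t, true))) true =
        σ (.inl (t, true)) := rfl
    rw [hp, h']
    funext z
    rcases eq_or_ne z (.inl (t, true)) with rfl | h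
    · simp
    · rw [Function.update_of_ne h]
      rfl
  · refine Exec.ite_false (by simp [hp]) (Exec.seq (exec_push _ (by simp) h₁ (by omega)) ?_)
    have hc := code_le (f.wr t)
    by_cases hn : f.mv t = -1
    · refine Exec.ite_true (by simp [hn]) (Exec.seq (exec_pop (by simp) hd ?_ ?_) (Exec.seq
        (exec_push _ (by simp) ?_ ?_) ((Exec.upd _ _ _).congr ?_ ?_)))
      · simpa using h₁
      · simp; omega
      · simpa using h₁
      · simp; omega
      · rw [← hd]
      · funext z
        have h' : ∀ l r a, moved (-1) a l r true = 3 * (3 * r + code a) + code (symOf l) :=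
          fun _ _ _ => rfl
        have h₂ : ∀ l r a, moved (-1) a l r false = l / 3 := fun _ _ _ => rfl
        rw [hn, h', h₂]
        rcases eq_or_ne z (.inl (t, true)) with rfl | h
        · simp
        · rcases eq_or_ne z (.inl (t, false)) with rfl | h
          · simp
          · simp [*]
    · refine (Exec.ite_false (by simp [hn]) exec_skip).congr rfl ?_
      simp [moved, hp, hn]

lemma exec_writeTapes (hd : f.d = none) (h₁ : σ s1 = 0)
    (hl : ∀ t, 3 * σ (.inl (t, false)) + 2 < 2 ^ H) (hr : ∀ t, 9 * σ (.inl (t, true)) + 8 < 2 ^ H) :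
    Exec x (idx : Reg M.T) H (forTapes writeTape) f σ f
      (setTapes σ (fun t => moved (f.mv t) (f.wr t) (σ (.inl (t, false))) (σ (.inl (t, true))))
        Finset.univ) := by
  have := exec_forTapes (x := x) (H := H) (ι := (idx : Reg M.T)) writeTape (fun _ => f)
    (setTapes σ (fun t => moved (f.mv t) (f.wr t) (σ (.inl (t, false))) (σ (.inl (t, true)))))
    (fun s t ht => ?_)
  · simpa using this
  · refine (exec_writeTape hd (by simpa using h₁) ?_ ?_).congr rfl ?_
    · rw [setTapes_inl_of_notMem _ ht]; exact hl t
    · rw [setTapes_inl_of_notMem _ ht]; exact hr t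
    · rw [setTapes_insert]
      simp only [setTapes_inl_of_notMem _ ht]

/-- Apply the transition function of the simulated machine. -/
def applyδ : Prog (Flags M) (Reg M.T) := .upd fun f _ =>
  let a := M.δ f.q f.sym f.bit false
  { f with q := a.next, wr := a.write, mv := a.move, sym := fun _ => none, bit := none }

/-- One step of the simulated machine. -/
def simStep : Prog (Flags M) (Reg M.T) :=
  .seq addr <| .seq fetch <| .seq (forTapes readTape) <| .seq applyδ <|
  .seq (forTapes writeTape) <| .upd fun f _ => { f with wr := fun _ => none, mv := 0 }

/-- The registers represent the tapes of the configuration `c`. -/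
def Sim (c : M.Config) (σ : Reg M.T → ℕ) : Prop :=
  ∀ t, Enc (fun i => c.cell t (c.head t + i)) (σ (.inl (t, true))) ∧
    Enc (fun i => c.cell t (c.head t - 1 - i)) (σ (.inl (t, false)))

end Prog

/-- The flags that are used during one step of the simulated machine have their initial values. -/
def Flags.Clean {M : RATM} (f : Flags M) : Prop :=
  f.sym = (fun _ => none) ∧ f.wr = (fun _ => none) ∧ f.mv = 0 ∧ f.d = none ∧ f.bit = none

namespace Prog

open Function (update)
open Var

variable {M : RATM} {x : List Bool} {H : ℕ} {f : Flags M} {σ : Reg M.T → ℕ}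

/-- The space bound of the simulated machine bounds the registers afresh at each step, so no growth
has to be tracked over time. -/
lemma exec_simStep (hdet : ∀ q s i, M.δ q s i true = M.δ q s i false) {ρ : ℕ → Bool} {c : M.Config}
    {h : ℕ} (hhead : ∀ t, |c.head t| ≤ h) (hcell : ∀ t (z : ℤ), h < |z| → c.cell t z = none)
    (hS : Sim c σ) (hq : f.q = c.state) (hf : f.Clean)
    (hz : Zeros σ [idx, i, j, si, sj, s1, s2, s3, s4, ci, cj, A, pow, Y, go])
    (hB : (σ N + σ k + σ u + σ y + 4) ^ 2 + 2 * σ N * (σ N + 1) < 2 ^ H)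
    (hK : 3 ^ (2 * h + 5) ≤ 2 ^ H) (hh : ¬ (M.output c.state).isSome) :
    ∃ σ', Exec x (idx : Reg M.T) H simStep f σ
        { f with q := (M.step (simInput x (σ N) (σ k) (σ u) (σ y)) ρ c).state } σ' ∧
      Sim (M.step (simInput x (σ N) (σ k) (σ u) (σ y)) ρ c) σ' ∧
      ∀ n : Var, σ' n = σ n := by
  obtain ⟨q₀, sym₀, wr₀, mv₀, d₀, bit₀, o₀, g₀, r₀⟩ := f
  obtain ⟨hf₁, hf₂, hf₃, hf₄, hf₅⟩ := hf
  simp only at hf₁ hf₂ hf₃ hf₄ hf₅ hq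
  subst hf₁ hf₂ hf₃ hf₄ hf₅ hq
  have hz' : ∀ n ∈ [idx, i, j, si, sj, s1, s2, s3, s4, ci, cj, A, pow, Y, go], σ (.inr n) = 0 := hz
  simp only [List.mem_cons, List.not_mem_nil, or_false, forall_eq_or_imp, forall_eq] at hz'
  obtain ⟨z₁, z₂, z₃, z₄, z₅, z₆, z₇, z₈, z₉, z₁₀, z₁₁, z₁₂, z₁₃, z₁₄, z₁₅⟩ := hz'
  -- At most `2 * h + 1` cells on either side of the head are in use; the factor `81` leaves room
  -- for the digits pushed during the step.
  have hpow : 3 ^ (2 * h + 5) = 81 * 3 ^ (2 * h + 1) := by ring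
  have hpos : 1 ≤ 3 ^ (2 * h + 1) := Nat.one_le_pow _ _ (by norm_num)
  have hR : ∀ t, σ (.inl (t, true)) < 3 ^ (2 * h + 1) := fun t => (hS t).1.lt fun i hi => by
    have := abs_le.1 (hhead t)
    exact hcell t _ (lt_of_lt_of_le (by omega) (le_abs_self _))
  have hL : ∀ t, σ (.inl (t, false)) < 3 ^ (2 * h + 1) := fun t => (hS t).2.lt fun i hi => by
    have := abs_le.1 (hhead t)
    exact hcell t _ (lt_of_lt_of_le (by omega) (neg_le_abs _))
  -- The first blank on the index tape, as in `RATM.address`; so the sum computed by `addr` is the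
  -- address itself.
  set n := sInf {i : ℕ | c.cell M.index (c.head M.index + i) = none} with hn
  have hmem : (2 * h + 1) ∈ {i : ℕ | c.cell M.index (c.head M.index + i) = none} := by
    have := abs_le.1 (hhead M.index)
    exact hcell _ _ (lt_of_lt_of_le (by push_cast; omega) (le_abs_self _))
  have hn₁ : n ≤ 2 * h + 1 := Nat.sInf_le hmem
  have hn₂ : 2 ^ (n + 1) < 2 ^ H := by
    calc 2 ^ (n + 1) ≤ 2 ^ (2 * h + 2) := Nat.pow_le_pow_right (by norm_num) (by omega)
      _ ≤ 3 ^ (2 * h + 2) := Nat.pow_le_pow_left (by norm_num) _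
      _ < 3 ^ (2 * h + 5) := Nat.pow_lt_pow_right (by norm_num) (by omega)
      _ ≤ 2 ^ H := hK
  set X := simInput x (σ N) (σ k) (σ u) (σ y)
  set a := M.action X ρ c with ha
  -- The simulation always feeds the random bit `false`; by determinism this agrees with any tape
  -- `ρ`.
  have ha' : a = M.δ c.state (fun t => c.cell t (c.head t)) X[M.address c]? false := by
    rw [ha, RATM.action]
    cases ρ c.rpos
    · rfl
    · exact hdet _ _ _
  have hstep : M.step X ρ c =
      { state := a.next
        head := fun t => c.head t + (a.move t : ℤ)
        cell := fun t => Function.update (c.cell t) (c.head t) (a.write t)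
        rpos := if a.advance then c.rpos + 1 else c.rpos } := by
    rw [RATM.step, if_neg hh]
  set σ₁ := setTapes σ (fun t b => if b then σ (.inl (t, true)) / 3 else σ (.inl (t, false)))
    Finset.univ with hσ₁
  have hadd : update (update σ A (M.address c)) A 0 = σ := by simp [← z₁₂]
  have hsym : (fun t => symOf (σ (.inl (t, true)))) = fun t => c.cell t (c.head t) := by
    funext t; simpa using (hS t).1.symOf
  set F : Flags M := ⟨c.state, fun _ => none, fun _ => none, 0, none, none, o₀, g₀, r₀⟩
  have e₁ : Exec x (idx : Reg M.T) H addr F σ F (update σ A (M.address c)) := by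
    refine exec_addr (hS M.index).1 (n := n) (Nat.sInf_mem ⟨_, hmem⟩)
      (fun i hi => Nat.notMem_of_lt_sInf hi) (by simp [Zeros, *]) rfl ?_ hn₂
    have := hR M.index
    omega
  have e₂ : Exec x (idx : Reg M.T) H fetch F (update σ A (M.address c))
      { F with bit := X[M.address c]? } σ :=
    (exec_fetch (by simp [Zeros, *]) (by simpa using hB) rfl).congr (by simp [X]) hadd
  have e₃ : Exec x (idx : Reg M.T) H (forTapes readTape) { F with bit := X[M.address c]? } σ
      { F with bit := X[M.address c]?, sym := fun t => c.cell t (c.head t) } σ₁ := by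
    refine (exec_readTapes rfl rfl z₆ fun t => ?_).congr ?_ rfl
    · have := hR t
      omega
    · rw [hsym]
  have e₄ : Exec x (idx : Reg M.T) H applyδ
      { F with bit := X[M.address c]?, sym := fun t => c.cell t (c.head t) } σ₁
      ⟨a.next, fun _ => none, a.write, a.move, none, none, o₀, g₀, r₀⟩ σ₁ :=
    (Exec.upd _ _ _).congr (by rw [ha']) rfl
  have e₅ := exec_writeTapes (x := x) (H := H) (f := ⟨a.next, fun _ => none, a.write, a.move, none,
    none, o₀, g₀, r₀⟩) (σ := σ₁) rfl (by simp [hσ₁, z₆])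
    (fun t => by have := hL t; simp [hσ₁]; omega) (fun t => by have := hR t; simp [hσ₁]; omega)
  refine ⟨_, e₁.seq (e₂.seq (e₃.seq (e₄.seq (e₅.seq ((Exec.upd _ _ _).congr ?_ rfl))))), ?_, ?_⟩
  · simp [hstep, F]
  · intro t
    have := enc_moved (a.move t) (a.write t) (hS t).1 (hS t).2
    rw [hstep]
    simpa [hσ₁] using this
  · intro n
    rfl

end Prog
end

/-! ### Simulating a whole run -/

noncomputable section

lemma RATM.run_succ (M : RATM) (X : List Bool) (ρ : ℕ → Bool) (s : ℕ) :
    M.run X ρ (s + 1) = M.step X ρ (M.run X ρ s) := by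
  rw [RATM.run, Function.iterate_succ_apply']
  rfl

/-- A head writes only where it stands, so cells that are out of reach keep their initial blank. -/
lemma RATM.cell_run_eq_none {M : RATM} {X : List Bool} {ρ : ℕ → Bool} {h : ℕ}
    (hh : ∀ s t, |(M.run X ρ s).head t| ≤ h) (s : ℕ) (t : M.T) {z : ℤ} (hz : h < |z|) :
    (M.run X ρ s).cell t z = none := by
  induction s with
  | zero => rfl
  | succ s ih =>
    rw [RATM.run_succ, RATM.step]
    split_ifs
    · exact ih
    · have : z ≠ (M.run X ρ s).head t := by
        rintro rfl
        exact absurd (hh s t) (by omega)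
      simp only [Function.update_of_ne this, ih]

namespace Prog

open Function (update)
open Var

variable {M : RATM} {x : List Bool} {H : ℕ} {f : Flags M} {σ : Reg M.T → ℕ}

open Classical in
/-- Run the simulated machine, and record whether its output is `1`. -/
def simulate : Prog (Flags M) (Reg M.T) :=
  .seq (.inc run) <| .seq
    (.loop run <| .ite (fun f => (M.output f.q).isSome) skip <| .seq simStep <| .inc run) <|
  .seq (.upd fun f _ => { f with out := decide (M.output f.q = some true), q := M.start })
    (forTapes fun t => .seq (clear (.inl (t, false))) (clear (.inl (t, true))))

-- No clock is needed: the number of rounds is the halting time `Nat.find hhalt`, which occurs only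
-- in the proof. Everything except `out` is restored, so the simulation can be called repeatedly as
-- a subroutine.
open Classical in
lemma exec_simulate (hdet : ∀ q s i, M.δ q s i true = M.δ q s i false) {ρ : ℕ → Bool} {h : ℕ}
    (hhead : ∀ s t, |(M.run (simInput x (σ N) (σ k) (σ u) (σ y)) ρ s).head t| ≤ h)
    (hhalt : ∃ s, (M.output (M.run (simInput x (σ N) (σ k) (σ u) (σ y)) ρ s).state).isSome)
    (hq : f.q = M.start) (hf : f.Clean) (hT : ∀ p, σ (.inl p) = 0)
    (hz : Zeros σ [idx, i, j, si, sj, s1, s2, s3, s4, ci, cj, A, pow, Y, go, run])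
    (hB : (σ N + σ k + σ u + σ y + 4) ^ 2 + 2 * σ N * (σ N + 1) < 2 ^ H)
    (hK : 3 ^ (2 * h + 5) ≤ 2 ^ H) :
    Exec x (idx : Reg M.T) H simulate f σ
      { f with out := decide (M.Outputs (simInput x (σ N) (σ k) (σ u) (σ y)) ρ true) } σ := by
  set X := simInput x (σ N) (σ k) (σ u) (σ y) with hX
  have hz' : ∀ n ∈ [idx, i, j, si, sj, s1, s2, s3, s4, ci, cj, A, pow, Y, go, run],
    σ (.inr n) = 0 := hz
  simp only [List.mem_cons, List.not_mem_nil, or_false, forall_eq_or_imp, forall_eq] at hz'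
  obtain ⟨z₁, z₂, z₃, z₄, z₅, z₆, z₇, z₈, z₉, z₁₀, z₁₁, z₁₂, z₁₃, z₁₄, z₁₅, z₁₆⟩ := hz'
  have h1 : 1 < 2 ^ H := (Nat.one_lt_pow (by omega) (by norm_num)).trans_le hK
  have hw := exec_while (x := x) (ι := (idx : Reg M.T)) (r := (run : Reg M.T))
    (H := H) (f := f) (σ := σ) (n := Nat.find hhalt)
    (p := .ite (fun f => (M.output f.q).isSome) skip <| .seq simStep <| .inc run)
    (fun m f' σ' => f' = { f with q := (M.run X ρ m).state } ∧ Sim (M.run X ρ m) σ' ∧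
      ∀ n : Var, σ' n = σ n)
    (fun f' σ' => f' = { f with q := (M.run X ρ (Nat.find hhalt)).state } ∧
      ∀ n : Var, σ' n = σ n) ?_ z₁₆ ?_ ?_
  · obtain ⟨f', σ', he, rfl, hσ'⟩ := hw
    refine Exec.seq (Exec.inc _ (by rwa [z₁₆])) (Exec.seq (by rwa [z₁₆]) (Exec.seq
      (f₁ := { f with out := decide (M.Outputs X ρ true) }) ((Exec.upd _ _ _).congr ?_ rfl) ?_))
    · simp only [hq, Flags.mk.injEq, true_and, and_true, decide_eq_decide]
      constructor
      · exact fun h => ⟨_, h⟩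
      · intro h
        obtain ⟨b, hb⟩ := Option.isSome_iff_exists.1 (Nat.find_spec hhalt)
        rw [hb, RATM.Outputs.unique h ⟨_, hb⟩]
    · have := exec_forTapes (x := x) (H := H) (ι := (idx : Reg M.T))
        (fun t : M.T => .seq (clear (.inl (t, false))) (clear (.inl (t, true))))
        (fun _ => { f with out := decide (M.Outputs X ρ true) }) (setTapes σ' fun _ _ => 0)
        fun s t _ => (Exec.seq (exec_clear _) (exec_clear _)).congr rfl (setTapes_insert ..).symm
      rw [setTapes_empty] at this
      refine this.congr rfl ?_
      funext z
      rcases z with ⟨t, b⟩ | n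
      · simp [hT]
      · simp [hσ']
  · refine ⟨?_, fun t => ⟨?_, ?_⟩, fun n => rfl⟩
    · have : (M.run X ρ 0).state = f.q := hq.symm
      rw [this]
    · rw [hT]; exact enc_zero
    · rw [hT]; exact enc_zero
  · rintro m hm _ σ' ⟨rfl, hS, hσ'⟩ hr
    have hm' := Nat.find_min hhalt hm
    obtain ⟨σ'', he, hS', hσ''⟩ := exec_simStep (x := x) (H := H) (ρ := ρ) (c := M.run X ρ m)
      (f := { f with q := (M.run X ρ m).state }) hdet (hhead m)
      (fun t z hz => RATM.cell_run_eq_none hhead m t hz) hS rfl hf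
      (fun n hn => (hσ' n).trans (hz n (by simp at hn ⊢; tauto)))
      (by simpa only [hσ'] using hB) hK hm'
    simp only [hσ', ← hX, ← RATM.run_succ] at he hS' hσ''
    refine ⟨_, σ'', Exec.ite_false (by simpa using hm') (he.seq ((Exec.inc _ ?_).congr rfl ?_)),
      by rw [hσ'', z₁₆], rfl, hS', hσ''⟩
    · rwa [hσ'', z₁₆]
    · rw [hσ'', z₁₆]
  · rintro _ σ' ⟨rfl, hS, hσ'⟩ hr
    exact ⟨_, σ', Exec.ite_true (Nat.find_spec hhalt) exec_skip, hr, rfl, hσ'⟩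

end Prog
end

noncomputable section

/-! ### The machine that looks for a clique -/

namespace Prog

open Function (update)
open Var

variable {M : RATM} {x : List Bool} {H : ℕ} {f : Flags M} {σ : Reg M.T → ℕ}
  {ρ : ℕ → Bool} {h n κ : ℕ}

/-- The number of leading ones. -/
def ones (l : List Bool) : ℕ := (l.takeWhile id).length

lemma ones_replicate (n : ℕ) (l : List Bool) : ones (List.replicate n true ++ false :: l) = n := by
  induction n with
  | zero => simp [ones]
  | succ n ih => simp_all [ones, List.replicate_succ]

lemma ones_le (l : List Bool) : ones l ≤ l.length := by
  unfold ones
  exact (List.takeWhile_sublist _).length_le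

lemma getElem?_of_lt_ones {l : List Bool} {m : ℕ} (hm : m < ones l) : l[m]? = some true := by
  induction l generalizing m with
  | nil => simp [ones] at hm
  | cons a l ih =>
    cases a
    · simp [ones] at hm
    · cases m with
      | zero => rfl
      | succ m => simpa using ih (by simpa [ones] using hm)

lemma getElem?_ones (l : List Bool) : l[ones l]? ≠ some true := by
  induction l with
  | nil => simp
  | cons a l ih =>
    cases a
    · simp [ones]
    · simpa [ones] using ih

/-- Count in the register `r` the ones in the input from the present address on. -/
def scan (r : Var) : Prog (Flags M) (Reg M.T) :=
  .seq (.inc go) <| .loop go <| .seq (.upd fun f a => { f with bit := a }) <|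
    .seq (.ite (fun f => f.bit = some true) (.seq (.inc r) (.seq (.inc idx) (.inc go))) skip) <|
    .upd fun f _ => { f with bit := none }

lemma exec_scan {r : Var} (hr : r ≠ go) (hr' : r ≠ idx) (h₀ : σ r = 0) (hg : σ go = 0)
    (hf : f.bit = none) (hx : x.length + 1 < 2 ^ H) :
    Exec x (idx : Reg M.T) H (scan r) f σ f
      (update (update σ r (ones (x.drop (σ idx)))) idx (σ idx + ones (x.drop (σ idx)))) := by
  obtain ⟨p, hp⟩ : ∃ p, σ idx = p := ⟨_, rfl⟩
  rw [hp]
  obtain ⟨n, hn⟩ : ∃ n, ones (x.drop p) = n := ⟨_, rfl⟩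
  rw [hn]
  have hf' : { f with bit := none } = f := by rw [← hf]
  have hn' : n ≤ x.length - p := by simpa [hn] using ones_le (x.drop p)
  have hw := exec_while (x := x) (ι := (idx : Reg M.T)) (r := (go : Reg M.T)) (H := H) (f := f)
    (σ := σ) (n := n) (p := .seq (.upd fun f a => { f with bit := a }) <|
    .seq (.ite (fun f => f.bit = some true) (.seq (.inc r) (.seq (.inc idx) (.inc go))) skip) <|
    .upd fun f _ => { f with bit := none })
    (fun m f' σ' => f' = f ∧ σ' = update (update σ r m) idx (p + m))
    (fun f' σ' => f' = f ∧ σ' = update (update σ r n) idx (p + n)) ⟨rfl, ?_⟩ hg ?_ ?_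
  · obtain ⟨f', σ', he, rfl, rfl⟩ := hw
    exact Exec.seq (Exec.inc _ (by omega)) (by rwa [hg])
  · simp [← h₀, hp]
  · rintro m hm _ _ ⟨rfl, rfl⟩ -
    have hb : x[p + m]? = some true := by
      rw [← List.getElem?_drop]; exact getElem?_of_lt_ones (hn ▸ hm)
    refine ⟨_, update (update σ r (m + 1)) idx (p + (m + 1)), Exec.seq (Exec.upd _ _ _) <| Exec.seq
      (Exec.ite_true ?_ <| Exec.seq (Exec.inc _ ?_) <| Exec.seq (Exec.inc _ ?_) (Exec.inc _ ?_)) <|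
      (Exec.upd _ _ _).congr hf' ?_, ?_, rfl, rfl⟩
    · simpa using hb
    · simp [hr']; omega
    · simp [hr'.symm]; omega
    · have h1 : 1 < 2 ^ H := by omega
      simpa [hr.symm, hg] using h1
    · funext z
      simp only [Function.update_apply, Sum.inr.injEq, hr', hr.symm, hr'.symm, hg]
      split_ifs <;> first | omega | simp_all
    · simp [hr.symm, hg]
  · rintro _ _ ⟨rfl, rfl⟩ -
    have hb : x[p + n]? ≠ some true := by
      rw [← List.getElem?_drop]; exact hn ▸ getElem?_ones (x.drop p)
    refine ⟨_, update (update σ r n) idx (p + n), Exec.seq (Exec.upd _ _ _) <| Exec.seq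
      (Exec.ite_false ?_ exec_skip) <| (Exec.upd _ _ _).congr hf' rfl, ?_, rfl, rfl⟩
    · simpa using hb
    · simp [hr.symm, hg]

/-- Conditions under which all simulations on a graph with `n` vertices succeed. -/
structure Simulable (M : RATM) (x : List Bool) (ρ : ℕ → Bool) (H h n κ : ℕ) : Prop where
  det : ∀ q s i, M.δ q s i true = M.δ q s i false
  head : ∀ u < n, ∀ y < n, ∀ s t, |(M.run (simInput x n κ u y) ρ s).head t| ≤ h
  halt : ∀ u < n, ∀ y < n, ∃ s, (M.output (M.run (simInput x n κ u y) ρ s).state).isSome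
  bound : (3 * n + κ + 4) ^ 2 + 2 * n * (n + 1) < 2 ^ H
  pow : 3 ^ (2 * h + 5) ≤ 2 ^ H

/-- No simulation is under way, and the parameters are `n` and `κ`. -/
structure Idle (n κ : ℕ) (f : Flags M) (σ : Reg M.T → ℕ) : Prop where
  state : f.q = M.start
  clean : f.Clean
  out : f.out = false
  tape : ∀ p, σ (.inl p) = 0
  size : σ N = n
  clique : σ k = κ
  vertex : σ u < n
  zeros : Zeros σ [idx, i, j, si, sj, s1, s2, s3, s4, ci, cj, A, pow, Y, go, run, y]

lemma Idle.put (hi : Idle n κ f σ) {r : Var} (a : ℕ) (hr : r ∉ [N, k, u, idx, i, j, si, sj, s1, s2,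
    s3, s4, ci, cj, A, pow, Y, go, run, y] := by simp) : Idle n κ f (Function.update σ r a) := by
  have hne : ∀ {s : Var}, s ∈ [N, k, u, idx, i, j, si, sj, s1, s2, s3,
      s4, ci, cj, A, pow, Y, go, run, y] → Function.update σ r a s = σ s := by
    intro s hs
    rw [Function.update_of_ne]
    rintro ⟨⟩
    exact hr hs
  exact ⟨hi.state, hi.clean, hi.out, fun p => by simpa using hi.tape p,
    (hne (by simp)).trans hi.size, (hne (by simp)).trans hi.clique,
    (hne (by simp)).trans_lt hi.vertex,
    fun s hs => (hne (by simp only [List.mem_cons] at hs ⊢; tauto)).trans (hi.zeros s hs)⟩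

lemma Idle.setGood (hi : Idle n κ f σ) (b : Bool) : Idle n κ { f with good := b } σ :=
  ⟨hi.state, hi.clean, hi.out, hi.tape, hi.size, hi.clique, hi.vertex, hi.zeros⟩

lemma Simulable.lt_two_pow (hs : Simulable M x ρ H h n κ) : 3 * n + κ + 4 < 2 ^ H := by
  have := hs.bound
  nlinarith

/-- All numbers below `m` have the property `P`. -/
def AllBelow (P : ℕ → Prop) (m : ℕ) : Prop := ∀ a < m, P a

open Classical in
lemma decide_allBelow_succ (P : ℕ → Prop) (m : ℕ) :
    decide (AllBelow P (m + 1)) = (decide (AllBelow P m) && decide (P m)) := by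
  rw [← Bool.decide_and, decide_eq_decide]
  exact Nat.forall_lt_succ_right

lemma allBelow_zero (P : ℕ → Prop) : AllBelow P 0 := fun _ h => absurd h (Nat.not_lt_zero _)

/-- Some number below `m` has the property `P`. -/
def AnyBelow (P : ℕ → Prop) (m : ℕ) : Prop := ∃ a < m, P a

open Classical in
lemma decide_anyBelow_succ (P : ℕ → Prop) (m : ℕ) :
    decide (AnyBelow P (m + 1)) = (decide (AnyBelow P m) || decide (P m)) := by
  rw [← Bool.decide_or, decide_eq_decide]
  exact Nat.exists_lt_succ_right

lemma not_anyBelow_zero (P : ℕ → Prop) : ¬ AnyBelow P 0 :=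
  fun ⟨_, h, _⟩ => absurd h (Nat.not_lt_zero _)

open Classical in
/-- The simulated machine says `1` for the vertex `a`, when the vertices `0` and `u` are
exchanged. -/
def said (M : RATM) (x : List Bool) (ρ : ℕ → Bool) (n κ u a : ℕ) : Bool :=
  decide (M.Outputs (simInput x n κ u a) ρ true)

/-- Run `p` if the simulated machine says `1` for the vertex in the register `r`. -/
def whenSaid (r : Var) (p : Prog (Flags M) (Reg M.T)) : Prog (Flags M) (Reg M.T) :=
  .seq (copy y r s1) <| .seq simulate <| .seq (clear y) <|
    .ite (fun f => f.out) (.seq (.upd fun f _ => { f with out := false }) p) skip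

/-- The flag `out` is lowered before `p` starts, so that `p` begins in the same idle state and may
itself call the simulation. -/
lemma exec_whenSaid {r : Var} {p : Prog (Flags M) (Reg M.T)} {f' : Flags M} {σ' : Reg M.T → ℕ}
    (hs : Simulable M x ρ H h n κ) (hi : Idle n κ f σ) (hr : σ r < n) (hry : r ≠ y) (hrs : r ≠ s1)
    (hp : said M x ρ n κ (σ u) (σ r) = true → Exec x (idx : Reg M.T) H p f σ f' σ')
    (hp' : said M x ρ n κ (σ u) (σ r) = false → f = f' ∧ σ = σ') :
    Exec x (idx : Reg M.T) H (whenSaid r p) f σ f' σ' := by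
  have hlt := hs.lt_two_pow
  have hz : ∀ n ∈ [idx, i, j, si, sj, s1, s2, s3, s4, ci, cj, A, pow, Y, go, run, y],
    σ (.inr n) = 0 := hi.zeros
  simp only [List.mem_cons, List.not_mem_nil, or_false, forall_eq_or_imp, forall_eq] at hz
  obtain ⟨z₁, z₂, z₃, z₄, z₅, z₆, z₇, z₈, z₉, z₁₀, z₁₁, z₁₂, z₁₃, z₁₄, z₁₅, z₁₆, z₁₇⟩ := hz
  have hN := hi.size
  have hk := hi.clique
  have hu := hi.vertex
  have hsim : simInput x (update σ y (σ r) N) (update σ y (σ r) k) (update σ y (σ r) u)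
      (update σ y (σ r) y) = simInput x n κ (σ u) (σ r) := by simp [hN, hk]
  have hsim₁ := exec_simulate (x := x) (H := H) (f := f) (σ := update σ y (σ r)) (ρ := ρ) (h := h)
    hs.det (by rw [hsim]; exact hs.head _ hu _ hr) (by rw [hsim]; exact hs.halt _ hu _ hr) hi.state
    hi.clean (by simpa using hi.tape) (by simp [Zeros, *]) (by
      have := hs.bound
      have h₂ : (n + κ + σ u + σ r + 4) ^ 2 ≤ (3 * n + κ + 4) ^ 2 :=
        Nat.pow_le_pow_left (by omega) 2
      simp [hN, hk]
      omega) hs.pow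
  rw [hsim] at hsim₁
  refine Exec.seq (exec_copy (by simpa using hry.symm) (by simp) (by simpa) (by simpa)
    (by omega)) <| Exec.seq hsim₁ <| Exec.seq ((exec_clear _).congr rfl (σ₂ := σ) ?_) ?_
  · simp [← z₁₇]
  · cases hsd : said M x ρ n κ (σ u) (σ r)
    · obtain ⟨rfl, rfl⟩ := hp' hsd
      refine (Exec.ite_false (by exact hsd) exec_skip).congr ?_ rfl
      change { f with out := said M x ρ n κ (σ u) (σ r) } = f
      rw [hsd, ← hi.out]
    · refine Exec.ite_true (by exact hsd) (Exec.seq ((Exec.upd _ _ _).congr (f₂ := f) ?_ rfl)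
    (hp hsd))
      rw [← hi.out]

/-- The vertices `a` and `b` do not exclude each other from a clique. -/
def compatible (M : RATM) (x : List Bool) (ρ : ℕ → Bool) (n κ u a b : ℕ) : Prop :=
  said M x ρ n κ u b = true → a ≠ b → swapAdj x n κ u a b = true

/-- Check the pair of vertices in `v` and `w`. -/
def checkPair : Prog (Flags M) (Reg M.T) :=
  whenSaid w <| ifEq v w s2 s3 s4 s1 skip <| .seq (locate v w) <|
    .seq (.upd fun f a => { f with good := f.good && a == some true }) (clear idx)

-- The set of vertices with answer 1 does not fit into the work space; the answer for `w` is
-- therefore recomputed for each pair.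
open Classical in
lemma exec_checkPair (hs : Simulable M x ρ H h n κ) (hi : Idle n κ f σ) (hv : σ v < n)
    (hw : σ w < n) :
    Exec x (idx : Reg M.T) H checkPair f σ
      { f with good := f.good && decide (compatible M x ρ n κ (σ u) (σ v) (σ w)) } σ := by
  have hlt := hs.lt_two_pow
  have hz : ∀ n ∈ [idx, i, j, si, sj, s1, s2, s3, s4, ci, cj, A, pow, Y, go, run, y],
    σ (.inr n) = 0 := hi.zeros
  simp only [List.mem_cons, List.not_mem_nil, or_false, forall_eq_or_imp, forall_eq] at hz
  obtain ⟨z₁, z₂, z₃, z₄, z₅, z₆, z₇, z₈, z₉, z₁₀, z₁₁, z₁₂, z₁₃, z₁₄, z₁₅, z₁₆, z₁₇⟩ := hz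
  have hN := hi.size
  have hk := hi.clique
  have hu := hi.vertex
  refine exec_whenSaid hs hi hw (by simp) (by simp) (fun hsd => exec_ifEq (ht := z₆) (hc := z₇)
    (he := z₈) (hs := z₉) (ha := by omega) (hb := by omega) (h := ?_)) fun hsd => ⟨?_, rfl⟩
  · split_ifs with hvw
    · refine exec_skip.congr ?_ rfl
      simp [compatible, hvw]
    · refine Exec.seq (exec_locate (by simp) (by simp) (by simp [Zeros, *]) ?_) <|
        Exec.seq (Exec.upd _ _ _) <| (exec_clear _).congr ?_ ?_
      · have := hs.bound
        have h₁ : (n + κ + σ u + 4) ^ 2 ≤ (3 * n + κ + 4) ^ 2 :=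
        Nat.pow_le_pow_left (by omega) 2
        have h₂ : (σ v + σ w) * (n + 1) ≤ 2 * n * (n + 1) := by gcongr; omega
        simp only [hN, hk]
        omega
      · simp [compatible, hsd, hvw, swapAdj, hN, hk, Bool.beq_eq_decide_eq]
      · simp [← z₁]
  · simp [compatible, hsd]

/-- If the simulated machine says `1` for `a`, then `a` is compatible with all vertices. -/
def Passes (M : RATM) (x : List Bool) (ρ : ℕ → Bool) (n κ u a : ℕ) : Prop :=
  said M x ρ n κ u a = true → AllBelow (compatible M x ρ n κ u a) n

/-- Check the vertex in `v`. -/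
def checkVertex : Prog (Flags M) (Reg M.T) :=
  whenSaid v <| .seq (.ifnz need (.dec need) skip) (for' w cw N s1 checkPair)

open Classical in
lemma exec_checkVertex (hs : Simulable M x ρ H h n κ) (hi : Idle n κ f σ) (hv : σ v < n)
    (hw : σ w = 0) (hc : σ cw = 0) :
    Exec x (idx : Reg M.T) H checkVertex f σ
      { f with good := f.good && decide (Passes M x ρ n κ (σ u) (σ v)) }
      (update σ need (σ need - if said M x ρ n κ (σ u) (σ v) then 1 else 0)) := by
  have hlt := hs.lt_two_pow
  refine exec_whenSaid hs hi hv (by simp) (by simp) (fun hsd => ?_) fun hsd => ⟨?_, ?_⟩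
  · refine Exec.seq (f₁ := f) (σ₁ := update σ need (σ need - 1)) ?_ ?_
    · by_cases h0 : σ need = 0
      · refine (Exec.ifnz_zero h0 exec_skip).congr rfl ?_
        have : σ need - 1 = σ need := by omega
        rw [this, Function.update_eq_self]
      · exact Exec.ifnz_pos h0 (Exec.dec _ h0)
    · have := exec_for (x := x) (ι := (idx : Reg M.T)) (H := H) (i := (w : Reg M.T)) (c := cw)
        (n := N) (t := s1) (p := checkPair) (by simp) (by simp) (by simp) (by simp)
        (fun m => { f with good := f.good && decide (AllBelow (compatible M x ρ n κ (σ u) (σ v)) m) })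
        (fun _ => update σ need (σ need - 1)) (by simpa using hi.zeros s1 (by simp)) (a := n)
        (by simpa using hi.size) (by omega) (by simp [hc]) (by simp [hw]) fun m hm => ?_
      · simpa [Passes, hsd, allBelow_zero] using this
      · have := exec_checkPair (x := x) hs (f := { f with
            good := (f.good && decide (AllBelow (compatible M x ρ n κ (σ u) (σ v)) m)) })
          (σ := update (update (update σ need (σ need - 1)) cw (n - m - 1)) w m)
          ((((hi.put (r := need) _).put (r := cw) _).put (r := w) _).setGood _)
          (by simpa using hv) (by simpa using hm)
        refine this.congr ?_ rfl
        simp [decide_allBelow_succ, Bool.and_assoc]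
  · simp [Passes, hsd]
  · simp [hsd]

/-- The vertices for which the simulated machine says `1`, when `0` and `u` are exchanged, are at
least `κ` in number, and form a clique. -/
def Accepts (M : RATM) (x : List Bool) (ρ : ℕ → Bool) (n κ u : ℕ) : Prop :=
  AllBelow (Passes M x ρ n κ u) n ∧
    κ ≤ ((Finset.range n).filter fun a => said M x ρ n κ u a = true).card

/-- Check the set of vertices for the present `u`. -/
def checkClique : Prog (Flags M) (Reg M.T) :=
  .seq (copy need k s1) <| .seq (for' v cv N s1 checkVertex) <|
  .seq (.ite (fun f => f.good) (.ifnz need skip (.upd fun f _ => { f with res := true })) skip) <|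
  .seq (clear need) <| .upd fun f _ => { f with good := true }

-- The register `need` starts at `κ` and drops, truncated at zero, with every answer 1; it ends at
-- zero exactly if there are at least `κ` of them. The flag `good` accumulates the adjacency tests,
-- and both are reset for the next `u`.
open Classical in
lemma exec_checkClique (hs : Simulable M x ρ H h n κ) (hi : Idle n κ f σ) (hg : f.good = true)
    (hz : Zeros σ [v, w, cv, cw, need]) :
    Exec x (idx : Reg M.T) H checkClique f σ
      { f with res := f.res || decide (Accepts M x ρ n κ (σ u)) } σ := by
  have hlt := hs.lt_two_pow
  have hz' : ∀ n ∈ [v, w, cv, cw, need], σ (.inr n) = 0 := hz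
  simp only [List.mem_cons, List.not_mem_nil, or_false, forall_eq_or_imp, forall_eq] at hz'
  obtain ⟨z₁, z₂, z₃, z₄, z₅⟩ := hz'
  have hN := hi.size
  have hk := hi.clique
  set c : ℕ → ℕ := fun m => ((Finset.range m).filter fun a => said M x ρ n κ (σ u) a = true).card
  have hfor := exec_for (x := x) (ι := (idx : Reg M.T)) (H := H) (i := (v : Reg M.T)) (c := cv)
    (n := N) (t := s1) (p := checkVertex) (by simp) (by simp) (by simp) (by simp)
    (fun m => { f with good := decide (AllBelow (Passes M x ρ n κ (σ u)) m) })
    (fun m => update σ need (κ - c m)) (by simpa using hi.zeros s1 (by simp)) (a := n)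
    (by simpa using hi.size) (by omega) (by simp [z₃]) (by simp [z₁]) fun m hm => ?_
  · refine Exec.seq ((exec_copy (ht := hi.zeros s1 (by simp)) (hH := by omega)).congr
      (f₂ := { f with good := decide (AllBelow (Passes M x ρ n κ (σ u)) 0) }) ?_ ?_) <| Exec.seq hfor <|
      Exec.seq (f₁ := { f with
        good := decide (AllBelow (Passes M x ρ n κ (σ u)) n)
        res := f.res || decide (Accepts M x ρ n κ (σ u)) }) (σ₁ := update σ need (κ - c n)) ?_ <|
      Exec.seq (exec_clear _) ((Exec.upd _ _ _).congr ?_ ?_)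
    · simp [← hg, allBelow_zero]
    · simp [c, hk]
    · by_cases h₁ : AllBelow (Passes M x ρ n κ (σ u)) n
      · refine Exec.ite_true (by simpa using h₁) ?_
        by_cases h₂ : κ ≤ c n
        · refine Exec.ifnz_zero (by rw [Function.update_self]; omega) ((Exec.upd _ _ _).congr ?_ rfl)
          have : Accepts M x ρ n κ (σ u) := ⟨h₁, h₂⟩
          simp [this]
        · refine Exec.ifnz_pos (by simp; omega) (exec_skip.congr ?_ rfl)
          have : ¬ Accepts M x ρ n κ (σ u) := fun h => h₂ h.2
          simp [this]
      · refine Exec.ite_false (by simpa using h₁) (exec_skip.congr ?_ rfl)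
        have : ¬ Accepts M x ρ n κ (σ u) := fun h => h₁ h.1
        simp [this]
    · simp [← hg]
    · simp [← z₅]
  · have := exec_checkVertex (x := x) hs (f := { f with good := decide (AllBelow (Passes M x ρ n κ (σ u)) m) })
      (σ := update (update (update σ need (κ - c m)) cv (n - m - 1)) v m)
      ((((hi.put (r := need) _).put (r := cv) _).put (r := v) _).setGood _)
      (by simpa using hm) (by simpa using z₂) (by simpa using z₄)
    refine this.congr ?_ ?_
    · simp [decide_allBelow_succ]
    · have hc : c (m + 1) = c m + if said M x ρ n κ (σ u) m then 1 else 0 := by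
        simp only [c, Finset.range_add_one, Finset.filter_insert]
        split_ifs <;> simp
      rw [hc]
      funext z
      by_cases h₁ : z = Sum.inr need
      · subst h₁
        simp [Nat.sub_sub]
      · by_cases h₂ : z = Sum.inr v
        · subst h₂; simp
        · simp [Function.update_apply, h₁, h₂]

/-- Read the parameters. -/
def parse : Prog (Flags M) (Reg M.T) :=
  .seq (scan N) <| .seq (.inc idx) <| .seq (scan k) (clear idx)

/-- The number of vertices. -/
def sizeOf (x : List Bool) : ℕ := ones x

/-- The size of the cliques. -/
def cliqueOf (x : List Bool) : ℕ := ones (x.drop (sizeOf x + 1))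

lemma exec_parse (hf : f.bit = none) (hx : x.length + 1 < 2 ^ H) :
    Exec x (idx : Reg M.T) H parse f 0 f
      (update (update 0 N (sizeOf x)) k (cliqueOf x)) := by
  have h₁ := ones_le x
  refine Exec.seq (exec_scan (by simp) (by simp) rfl rfl hf hx) <| Exec.seq (Exec.inc _ ?_) <|
    Exec.seq (exec_scan (by simp) (by simp) ?_ ?_ hf hx) <| (exec_clear _).congr rfl ?_
  · simp; omega
  · simp
  · simp
  · funext z
    simp only [Function.update_apply]
    split_ifs <;> simp_all [sizeOf, cliqueOf]

/-- Look for a clique, for all choices of `u`. -/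
def search : Prog (Flags M) (Reg M.T) := .seq parse (for' u cu N s1 checkClique)

variable (M) in
/-- The initial flags. -/
def flags₀ : Flags M := ⟨M.start, fun _ => none, fun _ => none, 0, none, none, false, true, false⟩

-- The parameters `sizeOf x` and `cliqueOf x` make sense for every bit string, so the search is also
-- controlled on inputs that encode no graph, as the definition of a logspace machine demands.
open Classical in
lemma exec_search (hs : Simulable M x ρ H h (sizeOf x) (cliqueOf x)) (hx : x.length + 1 < 2 ^ H) :
    ∃ σ, Exec x (idx : Reg M.T) H search (flags₀ M) 0
      { flags₀ M with res := decide (AnyBelow (Accepts M x ρ (sizeOf x) (cliqueOf x)) (sizeOf x)) }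
      σ := by
  have hlt := hs.lt_two_pow
  set n := sizeOf x
  set κ := cliqueOf x
  set σ : Reg M.T → ℕ := update (update 0 N n) k κ with hσ
  have hfor := exec_for (x := x) (ι := (idx : Reg M.T)) (H := H) (i := (u : Reg M.T)) (c := cu)
    (n := N) (t := s1) (p := checkClique) (by simp) (by simp) (by simp) (by simp)
    (fun m => { flags₀ M with res := decide (AnyBelow (Accepts M x ρ n κ) m) })
    (fun m => σ) (by simp [σ]) (a := n)
    (by simp [σ]) (by omega) (by simp [σ]) (by simp [σ]) fun m hm => ?_
  · refine ⟨σ, Exec.seq ((exec_parse rfl hx).congr ?_ rfl) hfor⟩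
    simp [flags₀, not_anyBelow_zero]
  · have := exec_checkClique (x := x) hs (f := { flags₀ M with
        res := decide (AnyBelow (Accepts M x ρ n κ) m) })
      (σ := update (update σ cu (n - m - 1)) u m) ⟨rfl, ⟨rfl, rfl, rfl, rfl, rfl⟩, rfl, ?_, ?_, ?_,
        ?_, ?_⟩ rfl ?_
    · refine this.congr ?_ rfl
      simp [decide_anyBelow_succ]
    · simp [σ]
    · simp [σ]
    · simp [σ]
    · simpa using hm
    · simp [σ, Zeros]
    · simp [σ, Zeros]

end Prog
end

/-! ### The search in logarithmic space -/

noncomputable section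

namespace Prog

open Var

variable {M : RATM} {x : List Bool}

lemma length_simInput (x : List Bool) (n κ u y : ℕ) :
    (simInput x n κ u y).length = n + κ + n * n + y + 3 := by
  simp [simInput, List.length_flatMap]
  ring

variable (M) in
/-- The machine that looks for a clique with the help of `M`. -/
def searcher : RATM := machine search (idx : Reg M.T) (flags₀ M) fun f => f.res

lemma add_two_lt (L : ℕ) : L + 2 < 2 ^ (Nat.log 2 L + 2) := by
  have h := Nat.lt_pow_succ_log_self (b := 2) (by norm_num) L
  have h' := Nat.one_le_two_pow (n := Nat.log 2 L)
  rw [Nat.succ_eq_add_one, pow_succ] at h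
  rw [pow_add]
  omega

/-- Simulated inputs are at most quadratically longer than `x`, so `M` still works in O(log |x|)
cells on them. -/
lemma exists_simulable (hM : M.IsDeterministicLogspace) : ∃ c : ℕ, ∀ (x : List Bool) (ρ : ℕ → Bool),
    ∃ h, Simulable M x ρ (c * Nat.log 2 x.length + c) h (sizeOf x) (cliqueOf x) ∧
      x.length + 1 < 2 ^ (c * Nat.log 2 x.length + c) := by
  obtain ⟨⟨C, hC⟩, hdet⟩ := hM
  -- With `h = C * (2 * l + 4) + C` one has 3^(2h+5) ≤ 2^(4h+10) and 4h + 10 = 8Cl + 20C + 10, the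
  -- most demanding requirement; the other bounds need exponents `2 * l + 9` and `l + 2`.
  refine ⟨20 * C + 20, fun x ρ => ?_⟩
  set L := x.length
  set l := Nat.log 2 L
  set n := sizeOf x
  set κ := cliqueOf x
  have hn : n ≤ L := ones_le x
  have hκ : κ ≤ L := (ones_le _).trans (by simp [L])
  have hL := add_two_lt L
  have hsq : (L + 2) ^ 2 < 2 ^ (2 * l + 4) := by
    calc (L + 2) ^ 2 < (2 ^ (l + 2)) ^ 2 := Nat.pow_lt_pow_left hL (by norm_num)
      _ = 2 ^ (2 * l + 4) := by rw [← pow_mul]; ring_nf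
  have hlog : ∀ u < n, ∀ y < n, Nat.log 2 (simInput x n κ u y).length ≤ 2 * l + 4 := by
    intro u _ y hy
    rw [length_simInput]
    refine (Nat.log_mono_right (m := 2 ^ (2 * l + 4)) ?_).trans (by simp)
    nlinarith
  refine ⟨C * (2 * l + 4) + C, ⟨hdet, fun u hu y hy s t => ?_, fun u hu y hy => ⟨_, (hC _ ρ).1⟩, ?_,
    ?_⟩, ?_⟩
  · refine ((hC _ ρ).2 s t).trans ?_
    have := hlog u hu y hy
    push_cast
    gcongr
    exact_mod_cast this
  · calc (3 * n + κ + 4) ^ 2 + 2 * n * (n + 1) ≤ 32 * (L + 2) ^ 2 := by nlinarith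
      _ < 2 ^ 5 * 2 ^ (2 * l + 4) := by omega
      _ ≤ _ := by
        rw [← pow_add]
        exact Nat.pow_le_pow_right (by norm_num) (by nlinarith)
  · calc 3 ^ (2 * (C * (2 * l + 4) + C) + 5) ≤ (2 ^ 2) ^ (2 * (C * (2 * l + 4) + C) + 5) :=
        Nat.pow_le_pow_left (by norm_num) _
      _ ≤ _ := by
        rw [← pow_mul]
        exact Nat.pow_le_pow_right (by norm_num) (by nlinarith)
  · calc L + 1 < 2 ^ (l + 2) := (Nat.lt_succ_self _).trans hL
      _ ≤ _ := Nat.pow_le_pow_right (by norm_num) (by nlinarith)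

theorem searcher_isRandomizedLogspace (hM : M.IsDeterministicLogspace) :
    (searcher M).IsRandomizedLogspace := by
  obtain ⟨c, hc⟩ := exists_simulable hM
  refine machine_isRandomizedLogspace (c := c) fun x => ?_
  obtain ⟨h, hs, hx⟩ := hc x fun _ => false
  obtain ⟨σ, hσ⟩ := exec_search hs hx
  exact ⟨_, σ, hσ⟩

-- The tapes `r` and `ρ` are unrelated: the searcher reads no random bits, and `M` ignores those it
-- is given.
open Classical in
theorem searcher_outputs_iff (hM : M.IsDeterministicLogspace) (x : List Bool) (r ρ : ℕ → Bool)
    (b : Bool) : (searcher M).Outputs x r b ↔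
      b = decide (AnyBelow (Accepts M x ρ (sizeOf x) (cliqueOf x)) (sizeOf x)) := by
  obtain ⟨c, hc⟩ := exists_simulable hM
  obtain ⟨h, hs, hx⟩ := hc x ρ
  obtain ⟨σ, hσ⟩ := exec_search hs hx
  exact hσ.outputs_iff

/-! ### Encoded graphs -/

variable {n : ℕ} (κ : ℕ) (G : SimpleGraph (Fin n))

@[simp] lemma sizeOf_graphInput : sizeOf (graphInput κ G) = n := ones_replicate _ _

@[simp] lemma cliqueOf_graphInput : cliqueOf (graphInput κ G) = κ := by
  have : (graphInput κ G).drop (n + 1) = List.replicate κ true ++ false :: adjBits G := by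
    simp [graphInput, List.drop_append]
  rw [cliqueOf, sizeOf_graphInput, this, ones_replicate]

lemma mul_add_lt (a b : Fin n) : (a : ℕ) * n + b < n * n := by
  have := a.2
  have := b.2
  nlinarith

lemma divNat_mul_add (a b : Fin n) : (⟨a * n + b, mul_add_lt a b⟩ : Fin (n * n)).divNat = a := by
  ext
  change ((a : ℕ) * n + b) / n = a
  rw [mul_comm, Nat.mul_add_div b.pos, Nat.div_eq_of_lt b.2, add_zero]

lemma modNat_mul_add (a b : Fin n) : (⟨a * n + b, mul_add_lt a b⟩ : Fin (n * n)).modNat = b := by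
  ext
  change ((a : ℕ) * n + b) % n = b
  rw [mul_comm, Nat.mul_add_mod, Nat.mod_eq_of_lt b.2]

open Classical in
lemma adjBits_eq_flatMap {g : ℕ → ℕ → Bool} (hg : ∀ a b : Fin n, g a b = decide (G.Adj a b)) :
    adjBits G = (List.range n).flatMap fun a => (List.range n).flatMap fun b => [g a b] := by
  rw [adjBits, List.ofFn_mul, List.flatMap_def, ← List.map_coe_finRange_eq_range, List.map_map,
    List.ofFn_eq_map]
  congr 1
  refine List.map_congr_left fun a _ => ?_
  simp only [Function.comp, List.ofFn_eq_map, List.flatMap_map]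
  rw [← List.map_eq_flatMap]
  refine List.map_congr_left fun b _ => ?_
  rw [hg, divNat_mul_add, modNat_mul_add]

open Classical in
lemma getElem?_graphInput (a b : Fin n) :
    (graphInput κ G)[entryPos n κ a b]? = some (decide (G.Adj a b)) := by
  have h : entryPos n κ a b = n + ((κ + ((a * n + b) + 1)) + 1) := by unfold entryPos; ring
  rw [h, graphInput, List.getElem?_append_right (by simp), List.length_replicate,
    Nat.add_sub_cancel_left, List.getElem?_cons_succ, List.getElem?_append_right (by simp),
    List.length_replicate, Nat.add_sub_cancel_left, List.getElem?_cons_succ, adjBits,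
    List.getElem?_eq_getElem (by simpa using mul_add_lt a b), List.getElem_ofFn, divNat_mul_add,
    modNat_mul_add]

/-- The graph with the vertices `0` and `u` exchanged. -/
def _root_.SimpleGraph.swapZero (G : SimpleGraph (Fin n)) (u : Fin n) : SimpleGraph (Fin n) :=
  G.comap (Equiv.swap ⟨0, u.pos⟩ u)

lemma swapZero_eq (u a : Fin n) : swapZero u a = (Equiv.swap ⟨0, u.pos⟩ u a : Fin n) := by
  rw [swapZero, Equiv.swap_apply_def]
  simp only [Fin.ext_iff]
  split_ifs <;> rfl

open Classical in
lemma swapAdj_graphInput (u a b : Fin n) :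
    swapAdj (graphInput κ G) n κ u a b = decide ((G.swapZero u).Adj a b) := by
  rw [swapAdj, swapZero_eq, swapZero_eq, getElem?_graphInput]
  simp [SimpleGraph.swapZero]

/-- The exchange is carried out on addresses of matrix entries, yet what `M` gets to see is the
encoding of the relabelled graph. -/
lemma simInput_graphInput (u y : Fin n) :
    simInput (graphInput κ G) n κ u y = vertexInput κ (G.swapZero u) y := by
  have h : ∀ m, (List.range m).flatMap (fun _ => [true]) = List.replicate m true := by
    intro m
    induction m with
    | zero => rfl
    | succ m ih => simp [List.range_succ, ih, List.replicate_succ']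
  rw [simInput, ← adjBits_eq_flatMap (G.swapZero u) (swapAdj_graphInput κ G u)]
  simp [vertexInput, graphInput, h, List.replicate_succ']

variable {κ G} {ρ : ℕ → Bool} {u : Fin n}

open Classical in
lemma said_graphInput {K : Finset (Fin n)}
    (hK : ∀ v, M.Outputs (vertexInput κ (G.swapZero u) v) ρ (decide (v ∈ K))) (a : Fin n) :
    said M (graphInput κ G) ρ n κ u a = decide (a ∈ K) := by
  rw [said, simInput_graphInput, decide_eq_decide]
  constructor
  · intro h
    simpa using (RATM.Outputs.unique h (hK a)).symm
  · intro h
    simpa [h] using hK a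

lemma card_filter_said : ((Finset.range n).filter fun a =>
      said M (graphInput κ G) ρ n κ u a = true).card =
    (Finset.univ.filter fun a : Fin n => said M (graphInput κ G) ρ n κ u a = true).card := by
  rw [← Finset.card_map Fin.valEmbedding]
  congr 1
  ext a
  simp only [Finset.mem_filter, Finset.mem_range, Finset.mem_map, Finset.mem_univ, true_and,
    Fin.valEmbedding_apply]
  constructor
  · rintro ⟨h, h'⟩
    exact ⟨⟨a, h⟩, h', rfl⟩
  · rintro ⟨b, h, rfl⟩
    exact ⟨b.2, h⟩

-- Completeness: if `u` is the right guess, the answers of `M` single out the relabelled planted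
-- clique.
open Classical in
lemma accepts_of_recovers {K : Finset (Fin n)}
    (hK : ∀ v, M.Outputs (vertexInput κ (G.swapZero u) v) ρ (decide (v ∈ K)))
    (hc : (G.swapZero u).IsClique K) (hκ : κ ≤ K.card) :
    Accepts M (graphInput κ G) ρ n κ u := by
  have hs := said_graphInput hK
  constructor
  · intro a ha hsa b hb hsb hab
    lift a to Fin n using ha
    lift b to Fin n using hb
    rw [hs, decide_eq_true_eq] at hsa hsb
    rw [swapAdj_graphInput, decide_eq_true_eq]
    exact hc hsa hsb fun h => hab (congrArg _ h)
  · rw [card_filter_said]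
    simpa [hs] using hκ

/-- Soundness, for arbitrary `M`: any `κ` of the vertices that passed the test form a clique, which
the exchange carries back to the original graph. -/
lemma exists_isNClique_of_accepts (h : Accepts M (graphInput κ G) ρ n κ u) :
    ∃ S, G.IsNClique κ S := by
  obtain ⟨h₁, h₂⟩ := h
  rw [card_filter_said] at h₂
  obtain ⟨S, hS, hc⟩ := Finset.exists_subset_card_eq h₂
  refine ⟨S.map (Equiv.swap ⟨0, u.pos⟩ u).toEmbedding, ?_, by simpa using hc⟩
  rw [SimpleGraph.isClique_iff, Set.Pairwise]
  simp only [Finset.coe_map, Set.mem_image, Finset.mem_coe]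
  rintro _ ⟨a, ha, rfl⟩ _ ⟨b, hb, rfl⟩ hab
  have := h₁ a a.2 (by simpa using hS ha) b b.2 (by simpa using hS hb)
    fun h => hab (by rw [Fin.ext h])
  classical
  rw [swapAdj_graphInput, decide_eq_true_eq] at this
  exact this

end Prog
end

noncomputable section

/-! ### Random graphs -/

section RandomGraphs

variable {N k : ℕ}

/-- As there are finitely many graphs, all sets of graphs become measurable; the `.of_discrete`
proofs below depend on this. -/
instance : MeasurableSingletonClass (SimpleGraph (Fin N)) where
  measurableSet_singleton G := by
    have h : ({G} : Set (SimpleGraph (Fin N))) = SimpleGraph.edgeSet ⁻¹' {G.edgeSet} := by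
      ext; simp
    rw [h]
    exact SimpleGraph.measurable_edgeSet (measurableSet_singleton _)

instance : IsProbabilityMeasure coinMeasure := by
  have : IsProbabilityMeasure (uniformOn (Set.univ : Set Bool)) :=
    isProbabilityMeasure_uniformOn Set.finite_univ Set.univ_nonempty
  unfold coinMeasure
  infer_instance

instance : IsProbabilityMeasure (erdosRenyi N) := by
  unfold erdosRenyi
  infer_instance

/-- No more than finiteness holds in general: for `k > N` there is no set of `k` vertices and the
measure is zero. -/
instance : IsFiniteMeasure (plantedClique N k) := by
  unfold plantedClique uniformOn
  infer_instance

/-- The probability of an edge. -/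
def half : unitInterval := ⟨1 / 2, Set.mem_Icc.2 ⟨by norm_num, by norm_num⟩⟩

lemma erdosRenyi_eq : erdosRenyi N = SimpleGraph.binomialRandom (Fin N) half := rfl

lemma toNNReal_half : ((unitInterval.toNNReal half : NNReal) : ENNReal) = 2⁻¹ := by
  have : unitInterval.toNNReal half = 2⁻¹ := by
    ext
    simp [half]
  rw [this]
  simp

lemma symm_half : unitInterval.symm half = half := by
  ext
  simp [half]
  norm_num

/-- At edge probability 1/2 all graphs are equally likely, so every relabelling preserves the
measure. -/
lemma erdosRenyi_singleton (G : SimpleGraph (Fin N)) :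
    erdosRenyi N {G} = 2⁻¹ ^ N.choose 2 := by
  classical
  have h : G.edgeSet.ncard ≤ N.choose 2 := by
    have := G.card_edgeFinset_le_card_choose_two
    rwa [Fintype.card_fin, ← Set.ncard_coe_finset, SimpleGraph.coe_edgeFinset] at this
  rw [erdosRenyi_eq, SimpleGraph.binomialRandom_singleton, symm_half, toNNReal_half, ← pow_add,
    Nat.card_eq_fintype_card, Fintype.card_fin, Nat.add_sub_cancel' h]

/-- The clique event lies in a cylinder that fixes one coordinate of a product measure for each pair
in `S`. -/
lemma erdosRenyi_isClique_le (S : Finset (Fin N)) :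
    erdosRenyi N {G | G.IsClique S} ≤ 2⁻¹ ^ S.card.choose 2 := by
  classical
  set E : Finset (Sym2 (Fin N)) := S.offDiag.image (Function.uncurry Sym2.mk) with hE
  have hE' : ∀ e ∈ E, ¬ e.IsDiag := by
    intro e he
    simp only [hE, Finset.mem_image, Finset.mem_offDiag, Prod.exists] at he
    obtain ⟨a, b, ⟨_, _, hab⟩, rfl⟩ := he
    simpa using hab
  rw [erdosRenyi_eq, SimpleGraph.binomialRandom_apply', setBernoulli_apply',
    ← Sym2.card_image_offDiag S]
  refine (measure_mono (t := (E : Set _).pi fun _ => {True}) ?_).trans ?_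
  · rintro P ⟨G, hG, hP⟩ e he
    have : e ∈ G.edgeSet := by
      rw [Finset.mem_coe, hE, Finset.mem_image] at he
      obtain ⟨⟨a, b⟩, hab, rfl⟩ := he
      rw [Finset.mem_offDiag] at hab
      exact hG hab.1 hab.2.1 hab.2.2
    rw [hP] at this
    simpa using this
  · rw [Measure.infinitePi_pi _ fun _ _ => .of_discrete, ← Finset.prod_const]
    refine Finset.prod_le_prod' fun e he => ?_
    -- Off the diagonal the coordinate is a fair coin, and contributes the factor 1/2.
    have h₁ : (e ∈ (Sym2.diagSetᶜ : Set (Sym2 (Fin N)))) = True := by simpa using hE' e he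
    rw [h₁]
    have h₂ : Measure.dirac True ({True} : Set Prop) = 1 := Measure.dirac_apply_of_mem rfl
    have h₃ : Measure.dirac False ({True} : Set Prop) = 0 := by
      rw [Measure.dirac_apply' _ .of_discrete]
      exact Set.indicator_of_notMem (fun h => h.mpr trivial) _
    rw [Measure.add_apply, Measure.smul_apply, Measure.smul_apply, h₂, h₃, smul_zero, add_zero,
      ENNReal.smul_def, toNNReal_half, smul_eq_mul, mul_one]

lemma erdosRenyi_exists_isNClique_le :
    erdosRenyi N {G | ∃ S, G.IsNClique k S} ≤ (N : ENNReal) ^ k * 2⁻¹ ^ k.choose 2 := by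
  classical
  have h : {G : SimpleGraph (Fin N) | ∃ S, G.IsNClique k S} ⊆
      ⋃ S ∈ Finset.powersetCard k (Finset.univ : Finset (Fin N)), {G | G.IsClique S} := by
    rintro G ⟨S, hS, hc⟩
    simp only [Set.mem_iUnion]
    exact ⟨S, by simp [Finset.mem_powersetCard, hc], hS⟩
  refine (measure_mono h).trans ((measure_biUnion_finset_le _ _).trans ?_)
  calc ∑ S ∈ Finset.powersetCard k (Finset.univ : Finset (Fin N)),
        erdosRenyi N {G | G.IsClique (S : Set (Fin N))}
      ≤ ∑ S ∈ Finset.powersetCard k (Finset.univ : Finset (Fin N)), 2⁻¹ ^ k.choose 2 := by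
        refine Finset.sum_le_sum fun S hS => ?_
        have := erdosRenyi_isClique_le S
        rwa [(Finset.mem_powersetCard.1 hS).2] at this
    _ = (N.choose k : ENNReal) * 2⁻¹ ^ k.choose 2 := by simp
    _ ≤ (N : ENNReal) ^ k * 2⁻¹ ^ k.choose 2 := by
      gcongr
      exact_mod_cast Nat.choose_le_pow N k

/-! ### Relabelling of the vertices -/

lemma measurePreserving_comap (τ : Equiv.Perm (Fin N)) :
    MeasurePreserving (fun G : SimpleGraph (Fin N) => G.comap τ) (erdosRenyi N) (erdosRenyi N) := by
  refine ⟨.of_discrete, Measure.ext_of_singleton fun G => ?_⟩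
  have : (fun G : SimpleGraph (Fin N) => G.comap τ) ⁻¹' {G} = {G.comap τ.symm} := by
    ext G'
    simp only [Set.mem_preimage, Set.mem_singleton_iff]
    constructor
    · rintro rfl
      ext; simp
    · rintro rfl
      ext; simp
  rw [Measure.map_apply .of_discrete .of_discrete, this, erdosRenyi_singleton,
    erdosRenyi_singleton]

open Classical in
lemma uniformOn_card_singleton (K : Finset (Fin N)) :
    uniformOn {K : Finset (Fin N) | K.card = k} {K} =
      (Measure.count {K : Finset (Fin N) | K.card = k})⁻¹ * if K.card = k then 1 else 0 := by
  rw [uniformOn, cond_apply .of_discrete]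
  congr 1
  split_ifs with h
  · rw [Set.inter_eq_self_of_subset_right (by simpa using h), Measure.count_singleton]
  · have : {K : Finset (Fin N) | K.card = k} ∩ {K} = ∅ := by
      ext K'
      simp only [Set.mem_inter_iff, Set.mem_ofPred_eq, Set.mem_singleton_iff, Set.mem_empty_iff_false,
        iff_false, not_and]
      rintro h' rfl
      exact h h'
    rw [this, measure_empty]

lemma measurePreserving_map (τ : Equiv.Perm (Fin N)) :
    MeasurePreserving (fun K : Finset (Fin N) => K.map τ.toEmbedding)
      (uniformOn {K : Finset (Fin N) | K.card = k}) (uniformOn {K : Finset (Fin N) | K.card = k}) := by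
  refine ⟨.of_discrete, Measure.ext_of_singleton fun K => ?_⟩
  have : (fun K : Finset (Fin N) => K.map τ.toEmbedding) ⁻¹' {K} =
      {K.map τ.symm.toEmbedding} := by
    ext K'
    simp only [Set.mem_preimage, Set.mem_singleton_iff]
    constructor
    · rintro rfl
      ext; simp
    · rintro rfl
      ext; simp
  rw [Measure.map_apply .of_discrete .of_discrete, this, uniformOn_card_singleton,
    uniformOn_card_singleton, Finset.card_map]

/-- Relabel the vertices of a graph and of a planted set by a permutation. -/
def relabel (τ : Equiv.Perm (Fin N)) (p : Finset (Fin N) × SimpleGraph (Fin N)) :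
    Finset (Fin N) × SimpleGraph (Fin N) := (p.1.map τ.toEmbedding, p.2.comap τ.symm)

/-- Planting commutes with relabelling, and both the uniform set and the random graph are invariant.
-/
lemma measurePreserving_relabel (τ : Equiv.Perm (Fin N)) :
    MeasurePreserving (relabel τ) (plantedClique N k) (plantedClique N k) := by
  refine ⟨.of_discrete, ?_⟩
  rw [plantedClique, Measure.map_map .of_discrete .of_discrete]
  have h : relabel τ ∘ (fun p : Finset (Fin N) × SimpleGraph (Fin N) => (p.1, p.2 ⊔ cliqueOn p.1)) =
      (fun p => (p.1, p.2 ⊔ cliqueOn p.1)) ∘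
        Prod.map (fun K : Finset (Fin N) => K.map τ.toEmbedding)
          (fun G : SimpleGraph (Fin N) => G.comap τ.symm) := by
    funext p
    refine Prod.ext rfl ?_
    ext a b
    simp [relabel, cliqueOn]
  have hT := (measurePreserving_map (k := k) τ).prod (measurePreserving_comap τ.symm)
  rw [h, ← Measure.map_map .of_discrete .of_discrete, hT.map_eq]

lemma ae_plantedClique : ∀ᵐ p ∂plantedClique N k, p.2.IsNClique k p.1 := by
  rw [plantedClique, ae_map_iff (Measurable.of_discrete).aemeasurable .of_discrete]
  have h : ∀ᵐ K ∂uniformOn {K : Finset (Fin N) | K.card = k}, K.card = k :=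
    ae_cond_mem .of_discrete
  filter_upwards [Measure.quasiMeasurePreserving_fst.ae h] with p hp
  refine ⟨fun a ha b hb hab => Or.inr ?_, hp⟩
  simpa [cliqueOn, hab] using Or.inl ⟨ha, hb⟩

end RandomGraphs
end

/-! ### Symmetry of the first block -/

noncomputable section

section RandomGraphs

variable {ℓ k : ℕ}

/-- Each of the blocks has exactly one planted vertex. -/
def partiteSet (ℓ k : ℕ) : Set (Finset (Fin (ℓ * k)) × SimpleGraph (Fin (ℓ * k))) :=
  {p | ∀ i < k, ∃! v : Fin (ℓ * k), v ∈ p.1 ∧ i * ℓ ≤ (v : ℕ) ∧ (v : ℕ) < (i + 1) * ℓ}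

instance : IsFiniteMeasure (partitePlantedClique ℓ k) := by
  unfold partitePlantedClique
  infer_instance

/-- The vertex `u` is planted. -/
def plantedAt (u : Fin (ℓ * k)) : Set (Finset (Fin (ℓ * k)) × SimpleGraph (Fin (ℓ * k))) :=
  {p | u ∈ p.1}

lemma mem_block_iff {i v : ℕ} (hv : v < ℓ) : i * ℓ ≤ v ∧ v < (i + 1) * ℓ ↔ i = 0 := by
  constructor
  · rintro ⟨h, -⟩
    by_contra hi
    have : 1 * ℓ ≤ i * ℓ := Nat.mul_le_mul_right _ (Nat.one_le_iff_ne_zero.2 hi)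
    omega
  · rintro rfl
    omega

/-- An exchange within the first block maps every block to itself, so it preserves the event that is
conditioned on in kG. -/
lemma swap_mem_block_iff {z u : Fin (ℓ * k)} (hz : (z : ℕ) < ℓ) (hu : (u : ℕ) < ℓ) (i : ℕ)
    (v : Fin (ℓ * k)) : i * ℓ ≤ (Equiv.swap z u v : ℕ) ∧ (Equiv.swap z u v : ℕ) < (i + 1) * ℓ ↔
      i * ℓ ≤ (v : ℕ) ∧ (v : ℕ) < (i + 1) * ℓ := by
  rw [Equiv.swap_apply_def]
  split_ifs with h₁ h₂
  · rw [mem_block_iff hu, h₁, mem_block_iff hz]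
  · rw [mem_block_iff hz, h₂, mem_block_iff hu]
  · rfl

lemma mem_map_swap {N : ℕ} {K : Finset (Fin N)} {z u v : Fin N} :
    v ∈ K.map (Equiv.swap z u).toEmbedding ↔ Equiv.swap z u v ∈ K := by
  rw [Finset.mem_map_equiv, Equiv.symm_swap]

lemma relabel_mem_partiteSet {z u : Fin (ℓ * k)} (hz : (z : ℕ) < ℓ) (hu : (u : ℕ) < ℓ)
    (p : Finset (Fin (ℓ * k)) × SimpleGraph (Fin (ℓ * k))) :
    relabel (Equiv.swap z u) p ∈ partiteSet ℓ k ↔ p ∈ partiteSet ℓ k := by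
  refine forall₂_congr fun i _ => ((Equiv.swap z u).existsUnique_congr fun {v} => ?_)
  rw [relabel, mem_map_swap, swap_mem_block_iff hz hu]

variable {z : Fin (ℓ * k)} (E : Set (Finset (Fin (ℓ * k)) × SimpleGraph (Fin (ℓ * k))))

lemma plantedClique_plantedAt (hz : (z : ℕ) < ℓ) {u : Fin (ℓ * k)} (hu : (u : ℕ) < ℓ) :
    plantedClique (ℓ * k) k (partiteSet ℓ k ∩ plantedAt u ∩ relabel (Equiv.swap z u) ⁻¹' E) =
      plantedClique (ℓ * k) k (partiteSet ℓ k ∩ plantedAt z ∩ E) := by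
  rw [← (measurePreserving_relabel (Equiv.swap z u)).measure_preimage
    (MeasurableSet.of_discrete (s := partiteSet ℓ k ∩ plantedAt z ∩ E)).nullMeasurableSet]
  congr 1
  ext p
  simp only [Set.mem_inter_iff, Set.mem_preimage, relabel_mem_partiteSet hz hu]
  have : relabel (Equiv.swap z u) p ∈ plantedAt z ↔ p ∈ plantedAt u := by
    change _ ∈ Finset.map _ _ ↔ _ ∈ _
    rw [mem_map_swap, Equiv.swap_apply_left]
    rfl
  rw [this]

/-- The first block. -/
def firstBlock (ℓ k : ℕ) : Finset (Fin (ℓ * k)) := Finset.univ.filter fun u => (u : ℕ) < ℓ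

lemma card_firstBlock (hk : 0 < k) : (firstBlock ℓ k).card = ℓ := by
  have : ℓ ≤ ℓ * k := Nat.le_mul_of_pos_right _ hk
  rw [firstBlock, Fin.card_filter_val_lt, min_eq_right this]

lemma pairwiseDisjoint_plantedAt (hk : 0 < k) :
    ((firstBlock ℓ k : Finset _) : Set (Fin (ℓ * k))).PairwiseDisjoint
      fun u => partiteSet ℓ k ∩ plantedAt u := by
  intro u hu v hv huv
  refine Set.disjoint_left.2 fun p hp hp' => huv ?_
  simp only [firstBlock, Finset.coe_filter, Finset.mem_univ, true_and, Set.mem_ofPred_eq] at hu hv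
  exact (hp.1 0 hk).unique ⟨hp.2, (mem_block_iff hu).2 rfl⟩ ⟨hp'.2, (mem_block_iff hv).2 rfl⟩

/-- The `ℓ` events are disjoint, since the first block has only one planted vertex, and equally
likely by exchanging `z` and `u`. -/
lemma sum_plantedClique (hz : (z : ℕ) < ℓ) (hk : 0 < k) :
    plantedClique (ℓ * k) k (⋃ u ∈ firstBlock ℓ k,
      partiteSet ℓ k ∩ plantedAt u ∩ relabel (Equiv.swap z u) ⁻¹' E) =
      ℓ * plantedClique (ℓ * k) k (partiteSet ℓ k ∩ plantedAt z ∩ E) := by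
  rw [measure_biUnion_finset _ fun _ _ => .of_discrete, Finset.sum_congr rfl fun u hu =>
    plantedClique_plantedAt E hz (by simpa [firstBlock] using hu), Finset.sum_const,
    card_firstBlock hk, nsmul_eq_mul]
  intro u hu v hv huv
  exact (pairwiseDisjoint_plantedAt hk hu hv huv).mono Set.inter_subset_left Set.inter_subset_left

lemma biUnion_plantedAt (hk : 0 < k) :
    ⋃ u ∈ firstBlock ℓ k, partiteSet ℓ k ∩ plantedAt u = partiteSet ℓ k := by
  ext p
  simp only [Set.mem_iUnion, Set.mem_inter_iff]
  constructor
  · rintro ⟨u, -, h, -⟩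
    exact h
  · intro h
    obtain ⟨v, ⟨hv, hv'⟩, -⟩ := h 0 hk
    exact ⟨v, by simpa [firstBlock] using hv'.2, h, hv⟩

/-- If an event `E` for the labelled vertex `z` implies `W` for the graph with the labels of `z`
and `u` exchanged, then `W` is at least as likely without leakage as `E` is with leakage. -/
theorem leakagePlantedClique_le (hk : 0 < k) (hz : (z : ℕ) = 0) (hℓ : 0 < ℓ)
    {E W : Set (Finset (Fin (ℓ * k)) × SimpleGraph (Fin (ℓ * k)))}
    (hW : ∀ u p, p.2.IsNClique k p.1 → relabel (Equiv.swap z u) p ∈ E → p ∈ W) :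
    leakagePlantedClique ℓ k E ≤ partitePlantedClique ℓ k W := by
  have hzℓ : (z : ℕ) < ℓ := by omega
  have hA : {p : Finset (Fin (ℓ * k)) × SimpleGraph (Fin (ℓ * k)) | ∃ v ∈ p.1, (v : ℕ) = 0} =
      plantedAt z := by
    ext p
    constructor
    · rintro ⟨v, hv, h⟩
      have : v = z := Fin.ext (h.trans hz.symm)
      exact this ▸ hv
    · exact fun h => ⟨z, h, hz⟩
  -- In kG the first vertex is planted with probability 1/ℓ.
  have hB : plantedClique (ℓ * k) k (partiteSet ℓ k) =
      ℓ * plantedClique (ℓ * k) k (partiteSet ℓ k ∩ plantedAt z) := by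
    have := sum_plantedClique Set.univ hzℓ hk
    simpa [biUnion_plantedAt hk] using this
  have hE : ℓ * plantedClique (ℓ * k) k (partiteSet ℓ k ∩ plantedAt z ∩ E) ≤
      plantedClique (ℓ * k) k (partiteSet ℓ k ∩ W) := by
    rw [← sum_plantedClique E hzℓ hk]
    refine measure_mono_ae ?_
    filter_upwards [ae_plantedClique] with p hp hp'
    obtain ⟨u, -, ⟨h₁, -⟩, h₂⟩ := Set.mem_iUnion₂.1 hp'
    exact ⟨h₁, hW u p hp h₂⟩
  have hℓ₀ : (ℓ : ENNReal) ≠ 0 := by exact_mod_cast hℓ.ne'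
  calc leakagePlantedClique ℓ k E
      = (plantedClique (ℓ * k) k (partiteSet ℓ k ∩ plantedAt z))⁻¹ *
          plantedClique (ℓ * k) k (partiteSet ℓ k ∩ plantedAt z ∩ E) := by
        rw [leakagePlantedClique, hA, partitePlantedClique,
          cond_cond_eq_cond_inter .of_discrete .of_discrete, cond_apply .of_discrete]
        rfl
    -- The factor `ℓ` cancels as it is neither `0` nor `∞`, whether or not the conditioning event is
    -- null.
    _ = (plantedClique (ℓ * k) k (partiteSet ℓ k))⁻¹ *
          (ℓ * plantedClique (ℓ * k) k (partiteSet ℓ k ∩ plantedAt z ∩ E)) := by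
        rw [hB, ENNReal.mul_inv (Or.inl hℓ₀) (Or.inl (ENNReal.natCast_ne_top _)),
          mul_comm (ℓ : ENNReal)⁻¹, mul_assoc, ← mul_assoc (ℓ : ENNReal)⁻¹,
          ENNReal.inv_mul_cancel hℓ₀ (ENNReal.natCast_ne_top _), one_mul]
    _ ≤ (plantedClique (ℓ * k) k (partiteSet ℓ k))⁻¹ *
          plantedClique (ℓ * k) k (partiteSet ℓ k ∩ W) := by gcongr
    _ = partitePlantedClique ℓ k W := by
        rw [partitePlantedClique, cond_apply .of_discrete]
        rfl

end RandomGraphs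
end

noncomputable section

/-! ### The reduction -/

open Prog

/-- The graphs on which the search with the help of `M` succeeds. -/
def acceptedGraphs (M : RATM) (N k : ℕ) : Set (SimpleGraph (Fin N)) :=
  {G | AnyBelow (Accepts M (graphInput k G) (fun _ => false) N k) N}

variable {M : RATM} {N ℓ k : ℕ}

lemma searcher_outputs_graphInput (hM : M.IsDeterministicLogspace) (G : SimpleGraph (Fin N))
    (r : ℕ → Bool) : (searcher M).Outputs (graphInput k G) r true ↔ G ∈ acceptedGraphs M N k := by
  classical
  rw [searcher_outputs_iff hM _ r fun _ => false, sizeOf_graphInput, cliqueOf_graphInput, eq_comm,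
    decide_eq_true_eq]
  rfl

lemma searcher_outputs_graphInput_false (hM : M.IsDeterministicLogspace) (G : SimpleGraph (Fin N))
    (r : ℕ → Bool) : (searcher M).Outputs (graphInput k G) r false ↔ G ∉ acceptedGraphs M N k := by
  classical
  rw [searcher_outputs_iff hM _ r fun _ => false, sizeOf_graphInput, cliqueOf_graphInput, eq_comm,
    decide_eq_false_iff_not]
  rfl

lemma searcher_false_real (hM : M.IsDeterministicLogspace) :
    ((erdosRenyi N).prod coinMeasure).real
      {p | (searcher M).Outputs (graphInput k p.1) p.2 false} =
      1 - (erdosRenyi N).real (acceptedGraphs M N k) := by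
  have : {p : SimpleGraph (Fin N) × (ℕ → Bool) |
      (searcher M).Outputs (graphInput k p.1) p.2 false} =
      (acceptedGraphs M N k)ᶜ ×ˢ Set.univ := by
    ext p
    simp [searcher_outputs_graphInput_false hM]
  rw [this, measureReal_prod_prod, probReal_univ, mul_one, probReal_compl_eq_one_sub .of_discrete]

lemma searcher_true_real (hM : M.IsDeterministicLogspace) :
    (((partitePlantedClique ℓ k).map Prod.snd).prod coinMeasure).real
      {p | (searcher M).Outputs (graphInput k p.1) p.2 true} =
      (partitePlantedClique ℓ k).real (Prod.snd ⁻¹' acceptedGraphs M (ℓ * k) k) := by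
  have : {p : SimpleGraph (Fin (ℓ * k)) × (ℕ → Bool) |
      (searcher M).Outputs (graphInput k p.1) p.2 true} =
      (acceptedGraphs M (ℓ * k) k) ×ˢ Set.univ := by
    ext p
    simp [searcher_outputs_graphInput hM]
  rw [this, measureReal_prod_prod, probReal_univ, mul_one,
    map_measureReal_apply .of_discrete .of_discrete]

lemma acceptedGraphs_real_le : (erdosRenyi N).real (acceptedGraphs M N k) ≤
    (N : ℝ) ^ k * 2⁻¹ ^ k.choose 2 := by
  have h : erdosRenyi N (acceptedGraphs M N k) ≤ (N : ENNReal) ^ k * 2⁻¹ ^ k.choose 2 := by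
    refine (measure_mono ?_).trans erdosRenyi_exists_isNClique_le
    rintro G ⟨u, hu, h⟩
    lift u to Fin N using hu
    exact exists_isNClique_of_accepts h
  have h' := ENNReal.toReal_mono (by finiteness) h
  simpa [Measure.real] using h'

-- The guess `u` of the search that succeeds is the one for which the exchanged pair lies in the
-- recovery event; there `M` answers correctly on every random tape, in particular on the constant
-- one.
open Classical in
lemma recovery_real_le (hℓ : 0 < ℓ) (hk : 0 < k) :
    (leakagePlantedClique ℓ k).real {p | ∀ (v : Fin (ℓ * k)) (r : ℕ → Bool),
      M.Outputs (vertexInput k p.2 v) r (decide (v ∈ p.1))} ≤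
      (partitePlantedClique ℓ k).real (Prod.snd ⁻¹' acceptedGraphs M (ℓ * k) k) := by
  refine ENNReal.toReal_mono (measure_ne_top _ _) (leakagePlantedClique_le hk
    (z := ⟨0, Nat.mul_pos hℓ hk⟩) rfl hℓ fun u p hp hu => ⟨u, u.2, ?_⟩)
  refine accepts_of_recovers (K := p.1.map (Equiv.swap ⟨0, Nat.mul_pos hℓ hk⟩ u).toEmbedding)
    (fun v => ?_) ?_ ?_
  · have := hu v fun _ => false
    rw [relabel, Equiv.symm_swap] at this
    exact this
  · intro a ha b hb hab
    simp only [Finset.mem_coe, mem_map_swap] at ha hb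
    exact hp.1 ha hb fun h => hab ((Equiv.injective _) h)
  · rw [Finset.card_map, hp.2]

/-- In base two the exponent is at most k²/8 - k(k-1)/2, and this is at most -k exactly if k ≥ 4. -/
lemma pow_mul_half_pow_le {x : ℝ} (hx : 0 < x) (hk : 4 ≤ k) (h : Real.logb 2 x ≤ k / 8) :
    x ^ k * 2⁻¹ ^ k.choose 2 ≤ (1 / 2) ^ k := by
  have hx' : x ^ k = 2 ^ (Real.logb 2 x * k) := by
    rw [Real.rpow_mul (by norm_num), Real.rpow_logb (by norm_num) (by norm_num) hx,
      Real.rpow_natCast]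
  have hc : ((2 : ℝ)⁻¹) ^ k.choose 2 = 2 ^ (-((k : ℝ) * (k - 1) / 2)) := by
    rw [← Nat.cast_choose_two, Real.rpow_neg (by norm_num), Real.rpow_natCast, inv_pow]
  have hk' : ((1 / 2 : ℝ)) ^ k = 2 ^ (-(k : ℝ)) := by
    rw [Real.rpow_neg (by norm_num), Real.rpow_natCast, one_div, inv_pow]
  have hk₄ : (4 : ℝ) ≤ k := by exact_mod_cast hk
  rw [hx', hc, hk', ← Real.rpow_add (by norm_num)]
  refine Real.rpow_le_rpow_of_exponent_le (by norm_num) ?_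
  nlinarith

lemma tendsto_acceptedGraphs {ℓ k : ℕ → ℕ} (hseq : AdmissibleSeqs ℓ k)
    (hlog : (fun t => Real.logb 2 ((ℓ t : ℝ) * (k t : ℝ))) =o[atTop] (fun t => (k t : ℝ))) :
    Tendsto (fun t => (erdosRenyi (ℓ t * k t)).real (acceptedGraphs M (ℓ t * k t) (k t))) atTop
      (𝓝 0) := by
  obtain ⟨-, -, hℓ, hk, hℓt⟩ := hseq
  have h₁ : Tendsto (fun t => Real.logb 2 ((ℓ t : ℝ) * (k t : ℝ))) atTop atTop := by
    refine (Real.tendsto_logb_atTop (by norm_num)).comp ?_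
    refine tendsto_atTop_mono (fun t => ?_) (tendsto_natCast_atTop_atTop.comp hℓt)
    have : (1 : ℝ) ≤ k t := by exact_mod_cast hk t
    exact le_mul_of_one_le_right (Nat.cast_nonneg _) this
  have h₂ : ∀ᶠ t in atTop, Real.logb 2 ((ℓ t : ℝ) * (k t : ℝ)) ≤ k t / 8 := by
    filter_upwards [hlog.bound (show (0 : ℝ) < 1 / 8 by norm_num)] with t ht
    rw [Real.norm_natCast] at ht
    have := (Real.le_norm_self _).trans ht
    linarith
  -- The divergence of `k` is not assumed; it follows because `k` eventually dominates the diverging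
  -- log(ℓk).
  have h₃ : Tendsto k atTop atTop := by
    rw [← tendsto_natCast_atTop_iff (R := ℝ)]
    refine tendsto_atTop_mono' _ ?_ (h₁.const_mul_atTop (show (0 : ℝ) < 8 by norm_num))
    filter_upwards [h₂] with t ht
    linarith
  refine squeeze_zero' (.of_forall fun _ => measureReal_nonneg) ?_
    ((tendsto_pow_atTop_nhds_zero_of_lt_one (r := (1 / 2 : ℝ)) (by norm_num) (by norm_num)).comp h₃)
  filter_upwards [h₂, h₃.eventually_ge_atTop 4] with t ht ht₄
  have hpos : (0 : ℝ) < (ℓ t : ℝ) * k t := by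
    exact_mod_cast Nat.mul_pos (hℓ t) (hk t)
  refine acceptedGraphs_real_le.trans ?_
  rw [Nat.cast_mul]
  exact pow_mul_half_pow_le hpos ht₄ ht

end

theorem mainTheorem11 (ℓ k : ℕ → ℕ) (hseq : AdmissibleSeqs ℓ k)
    (hlog : (fun t => Real.logb 2 ((ℓ t : ℝ) * (k t : ℝ))) =o[atTop] (fun t => (k t : ℝ)))
    (δ : ℝ) (hδ : 0 < δ)
    (hk : (fun t => (k t : ℝ)) =O[atTop] (fun t => (ℓ t : ℝ) ^ (1 - δ)))
    (hconj : KPCConjSpace) :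
    ¬ ∃ M : RATM, M.IsDeterministicLogspace ∧ SolvesLeakageRecovery M ℓ k := by
  rintro ⟨M, hM, c, hc, hrec⟩
  have hlim := hconj (Prog.searcher M) (Prog.searcher_isRandomizedLogspace hM) ℓ k hseq δ hδ hk
  simp only [searcher_false_real hM, searcher_true_real hM] at hlim
  have hsum := hlim.add (tendsto_acceptedGraphs (M := M) hseq hlog)
  -- Adding the false alarm probability back cancels it exactly: each term is 1 plus the acceptance
  -- probability under kG, hence eventually at least `1 + c`.
  have : 1 + c ≤ 1 + 0 := by
    refine ge_of_tendsto hsum ?_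
    filter_upwards [hrec] with t ht
    have := recovery_real_le (M := M) (hseq.2.2.1 t) (hseq.2.2.2.1 t)
    linarith
  linarith
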